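/- Let $m_1\ge m_2\ge0$ be integers, $m:=m_1-m_2$, $\lambda:=(m_1,m_2)$. A partition is a pair $\mu=(\mu_1,\mu_2)$ of integers with $\mu_1\ge\mu_2\ge0$; $|\mu|:=\mu_1+\mu_2$; $\mu\le\lambda$ means $\mu_1\le\lambda_1$ and $|\mu|\le|\lambda|$; $\mu$ contains $\lambda$ if $\lambda_i\le\mu_i$ for $i=1,2$. Let $m_\mu(x)$ be the sum of the distinct monomials among $x_1^{\mu_1}x_2^{\mu_2}$, $x_1^{\mu_2}x_2^{\mu_1}$. Put $(a)_k:=\prod_{i=0}^{k-1}(a+i)$, $(a;q)_k:=\prod_{i=0}^{k-1}(1-aq^i)$, $(a;q)_\infty:=\prod_{i\ge0}(1-aq^i)$, $(a_1,\dots,a_r)_k:=\prod_j(a_j)_k$, $(a_1,\dots,a_r;q)_k:=\prod_j(a_j;q)_k$, and, for an integer $N\ge0$, $${}_{s+1}F_{s}\Big({-N,a_2,\dots,a_{s+1}\atop b_1,\dots,b_s};z\Big)=\sum_{k=0}^N\frac{(-N)_k(a_2,\dots,a_{s+1})_k}{k!\,(b_1,\dots,b_s)_k}z^k,\qquad {}_{s+1}\phi_{s}\Big({q^{-N},a_2,\dots,a_{s+1}\atop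 b_1,\dots,b_s};q,z\Big)=\sum_{k=0}^N\frac{(q^{-N},a_2,\dots,a_{s+1};q)_k}{(q,b_1,\dots,b_s;q)_k}z^k.$$ Let $C_k(\cdot\,;t|q)$ and $C_k^\tau$ be the polynomials with $$C_k(\cos\theta;t|q)=\sum_{j=0}^k\frac{(t;q)_j(t;q)_{k-j}}{(q;q)_j(q;q)_{k-j}}e^{i(k-2j)\theta},\qquad C_k^\tau(\cos\theta)=\sum_{j=0}^k\frac{(\tau)_j(\tau)_{k-j}}{j!\,(k-j)!}e^{i(k-2j)\theta}.$$ Let $0<q<1$, $0<t<1$, $\tau>0$, and let $\alpha\in\mathbb C$ satisfy $i+j\tau+2\alpha\ne0$ for all integers $i>0$, $j\ge0$. All variables are complex. The following polynomials exist and are unique. * The interpolation Macdonald polynomial $P^{\rm ip}_\lambda(x_1,x_2;q,t)$: symmetric, of degree $|\lambda|$, with coefficient of $m_\lambda$ equal to $1$, vanishing at $(q^{\mu_1}t,q^{\mu_2})$ for all partitions $\mu\ne\lambda$ with $|\mu|\le|\lambda|$. * The interpolation Jack polynomial $P^{\rm ip}_\lambda(x_1,x_2;\tau)$: the same with the points $(\mu_1+\tau,\mu_2)$.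 * The Macdonald polynomial $P_\lambda(x_1,x_2;q,t)=\sum_{\mu\le\lambda}u_{\lambda,\mu}m_\mu(x)$, $u_{\lambda,\lambda}=1$, such that $\int_{\mathbb T^2}P_\lambda(x)\,m_\mu(x^{-1})\,\Delta_+(x)\Delta_+(x^{-1})\frac{dx_1}{x_1}\frac{dx_2}{x_2}=0$ for all partitions $\mu<\lambda$, where $\mathbb T^2$ is the torus $|x_1|=|x_2|=1$ and $\Delta_+(x)=\frac{(x_1/x_2;q)_\infty}{(tx_1/x_2;q)_\infty}$. * The Jack polynomial $P_\lambda(x_1,x_2;\tau)$: the same with $\Delta_+(x)=(1-x_1/x_2)^\tau$. * The $BC_2$-type interpolation Jack polynomial $P^{\rm ip}_\lambda(x_1,x_2;\tau,\alpha):=\lim_{q\uparrow1}(1-q)^{-2|\lambda|}P^{\rm ip}_\lambda(q^{x_1},q^{x_2};q,q^\tau,q^\alpha)$ for all $x$. Here $P^{\rm ip}_\lambda(x;q,t,a)$ is the Laurent polynomial of degree $|\lambda|$, invariant under $x_1\leftrightarrow x_2$ and $x_i\mapsto x_i^{-1}$, with coefficient of $x_1^{\lambda_1}x_2^{\lambda_2}$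 equal to $1$, vanishing at $(q^{\mu_1}ta,q^{\mu_2}a)$ for all partitions $\mu$ not containing $\lambda$; for $t=q^\tau$, $a=q^\alpha$ it exists and is unique for all $q<1$ close enough to $1$. They are given by the following formulas. 1. If $x_1,x_2\ne0$ and $x_2\ne q^j$ for $m_2\le j<m_1$: $$P^{\rm ip}_{m_1,m_2}(x_1,x_2;q,t)=x_1^{m_2}x_2^{m_1}(x_1^{-1};q)_{m_2}(x_2^{-1};q)_{m_1}\;{}_3\phi_2\Big({q^{-m_1+m_2},\,t,\,q^{-m_1+1}t^{-1}x_1\atop q^{1-m_1+m_2}t^{-1},\,q^{-m_1+1}x_2};q,q\Big).$$ 2. For the Macdonald polynomials, $$P_{m_1,m_2}(x_1,x_2;q,t)=x_1^{m_1}x_2^{m_2}\;{}_2\phi_1\Big({q^{-m_1+m_2},\,t\atop q^{1-m_1+m_2}t^{-1}};q,\frac{qx_2}{tx_1}\Big)\quad(x_1\ne0),$$ $$P_{m_1,m_2}(x_1,x_2;q,t)=\frac{(q;q)_m}{(t;q)_m}\sum_{j=0}^m\frac{(t;q)_j(t;q)_{m-j}}{(q;q)_j(q;q)_{m-j}}x_1^{m_1-j}x_2^{m_2+j},$$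 $$P_{m_1,m_2}(x_1,x_2;q,t)=\frac{(q;q)_m}{(t;q)_m}(x_1x_2)^{\frac12(m_1+m_2)}\,C_m\Big(\frac{x_1+x_2}{2(x_1x_2)^{1/2}};t\,\Big|\,q\Big)\quad(x_1x_2\ne0),$$ for either choice of the square root $(x_1x_2)^{1/2}$, where $(x_1x_2)^{\frac12(m_1+m_2)}:=\big((x_1x_2)^{1/2}\big)^{m_1+m_2}$. 3. If $m_2+\tau+\alpha+x_1+j\ne0$ and $m_2+\tau+\alpha-x_1+j\ne0$ for $0\le j<m$: $$P^{\rm ip}_{m_1,m_2}(x_1,x_2;\tau,\alpha)=(-1)^{m_1+m_2}(\alpha+x_1,\alpha-x_1,\alpha+x_2,\alpha-x_2)_{m_2}\,(m_2+\tau+\alpha+x_1,\,m_2+\tau+\alpha-x_1)_{m}$$ $$\times\;{}_4F_3\Big({-m_1+m_2,\,\tau,\,m_2+\alpha+x_2,\,m_2+\alpha-x_2\atop 1-m_1+m_2-\tau,\,m_2+\tau+\alpha+x_1,\,m_2+\tau+\alpha-x_1};1\Big).$$ 4. If $x_2\ne j$ for all integers $m_2\le j<m_1$: $$P^{\rm ip}_{m_1,m_2}(x_1,x_2;\tau)=(-1)^{m_1+m_2}(-x_1)_{m_2}(-x_2)_{m_1}\;{}_3F_2\Big({-m_1+m_2,\,\tau,\,-m_1+1-\tau+x_1\atop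 1-m_1+m_2-\tau,\,-m_1+1+x_2};1\Big).$$ 5. For the Jack polynomials, $$P_{m_1,m_2}(x_1,x_2;\tau)=x_1^{m_1}x_2^{m_2}\;{}_2F_1\Big({-m_1+m_2,\,\tau\atop 1-m_1+m_2-\tau};\frac{x_2}{x_1}\Big)\quad(x_1\ne0),$$ $$P_{m_1,m_2}(x_1,x_2;\tau)=\frac{m!}{(\tau)_m}\sum_{j=0}^m\frac{(\tau)_j(\tau)_{m-j}}{j!\,(m-j)!}x_1^{m_1-j}x_2^{m_2+j},$$ $$P_{m_1,m_2}(x_1,x_2;\tau)=\frac{m!}{(\tau)_m}(x_1x_2)^{\frac12(m_1+m_2)}\,C_m^\tau\Big(\frac{x_1+x_2}{2(x_1x_2)^{1/2}}\Big)\quad(x_1x_2\ne0),$$ again for either choice of the square root. -/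

import Mathlib

noncomputable section

namespace InterpolationPoly

/-! ### Shifted factorials and terminating hypergeometric series -/

/-- The shifted factorial `(a)_k = a (a+1) ⋯ (a+k-1)`. -/
def shiftedFactorial (a : ℂ) (k : ℕ) : ℂ := ∏ i ∈ Finset.range k, (a + i)

/-- The `q`-shifted factorial `(a;q)_k = (1-a)(1-aq) ⋯ (1-aq^{k-1})`. -/
def qShiftedFactorial (a q : ℂ) (k : ℕ) : ℂ := ∏ i ∈ Finset.range k, (1 - a * q ^ i)

/-- The infinite `q`-shifted factorial `(a;q)_∞`. -/
def qShiftedFactorialInf (a q : ℂ) : ℂ := ∏' i : ℕ, (1 - a * q ^ i)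

/-- The terminating hypergeometric series `ᵣFₛ(-n, a₂, …, aᵣ; b₁, …, bₛ; z)`. -/
def hyp (n : ℕ) (as bs : List ℂ) (z : ℂ) : ℂ :=
  ∑ k ∈ Finset.range (n + 1),
    shiftedFactorial (-(n : ℂ)) k / (Nat.factorial k : ℂ) *
      ((as.map fun a => shiftedFactorial a k).prod /
        (bs.map fun b => shiftedFactorial b k).prod) * z ^ k

/-- The terminating `q`-hypergeometric series `ᵣφₛ(q⁻ⁿ, a₂, …, aᵣ; b₁, …, bₛ; q, z)`; the factor
`(-1)^k q^{k(k-1)/2}` occurs to the power `1 + s - r`. -/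
def qHyp (q : ℂ) (n : ℕ) (as bs : List ℂ) (z : ℂ) : ℂ :=
  ∑ k ∈ Finset.range (n + 1),
    qShiftedFactorial (q ^ (-(n : ℤ))) q k / qShiftedFactorial q q k *
      ((as.map fun a => qShiftedFactorial a q k).prod /
        (bs.map fun b => qShiftedFactorial b q k).prod) *
      ((-1) ^ k * q ^ (k * (k - 1) / 2)) ^ ((bs.length : ℤ) - (as.length : ℤ)) * z ^ k

/-! ### (`q`-)ultraspherical polynomials -/

/-- For a symmetric sequence of coefficients, `∑ cⱼ T_{m-2j}(cos θ) = ∑ cⱼ e^{i(m-2j)θ}`. -/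
theorem sum_chebyshev_eval_cos (m : ℕ) (c : ℕ → ℂ) (hc : ∀ j ≤ m, c (m - j) = c j) (θ : ℂ) :
    (∑ j ∈ Finset.range (m + 1),
      Polynomial.C (c j) * Polynomial.Chebyshev.T ℂ ((m : ℤ) - 2 * j)).eval (Complex.cos θ) =
    ∑ j ∈ Finset.range (m + 1), c j * Complex.exp (Complex.I * ((m : ℂ) - 2 * j) * θ) := by
  have h1 : ∑ j ∈ Finset.range (m + 1), c j * Complex.exp (-(Complex.I * ((m : ℂ) - 2 * j) * θ)) =
      ∑ j ∈ Finset.range (m + 1), c j * Complex.exp (Complex.I * ((m : ℂ) - 2 * j) * θ) := by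
    rw [← Finset.sum_range_reflect]
    refine Finset.sum_congr rfl fun j hj => ?_
    have hj' : j ≤ m := Nat.lt_succ_iff.mp (Finset.mem_range.mp hj)
    have h2 : m + 1 - 1 - j = m - j := by omega
    rw [h2, hc j hj', Nat.cast_sub hj']
    congr 2
    ring
  have h3 : ∀ j : ℕ, (Polynomial.Chebyshev.T ℂ ((m : ℤ) - 2 * j)).eval (Complex.cos θ) =
      (Complex.exp (Complex.I * ((m : ℂ) - 2 * j) * θ) +
        Complex.exp (-(Complex.I * ((m : ℂ) - 2 * j) * θ))) / 2 := by
    intro j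
    rw [Polynomial.Chebyshev.T_complex_cos, Complex.cos]
    push_cast
    congr 3 <;> ring
  simp only [Polynomial.eval_finsetSum, Polynomial.eval_mul, Polynomial.eval_C, h3]
  have h4 : ∀ j : ℕ, c j * ((Complex.exp (Complex.I * ((m : ℂ) - 2 * j) * θ) +
        Complex.exp (-(Complex.I * ((m : ℂ) - 2 * j) * θ))) / 2) =
      (c j * Complex.exp (Complex.I * ((m : ℂ) - 2 * j) * θ) +
        c j * Complex.exp (-(Complex.I * ((m : ℂ) - 2 * j) * θ))) / 2 := fun j => by ring
  simp only [h4, ← Finset.sum_div, Finset.sum_add_distrib, h1]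
  ring

/-- The `q`-ultraspherical polynomial `C_m(·; t | q)`, written in Chebyshev polynomials of the
first kind; `qUltraspherical_eval_cos` gives its usual defining formula. -/
def qUltraspherical (t q : ℂ) (m : ℕ) : Polynomial ℂ :=
  ∑ j ∈ Finset.range (m + 1),
    Polynomial.C (qShiftedFactorial t q j * qShiftedFactorial t q (m - j) /
      (qShiftedFactorial q q j * qShiftedFactorial q q (m - j))) *
      Polynomial.Chebyshev.T ℂ ((m : ℤ) - 2 * j)

theorem qUltraspherical_eval_cos (t q : ℂ) (m : ℕ) (θ : ℂ) :
    (qUltraspherical t q m).eval (Complex.cos θ) =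
      ∑ j ∈ Finset.range (m + 1),
        qShiftedFactorial t q j * qShiftedFactorial t q (m - j) /
          (qShiftedFactorial q q j * qShiftedFactorial q q (m - j)) *
          Complex.exp (Complex.I * ((m : ℂ) - 2 * j) * θ) := by
  refine sum_chebyshev_eval_cos m _ (fun j hj => ?_) θ
  rw [Nat.sub_sub_self hj, mul_comm (qShiftedFactorial t q _),
    mul_comm (qShiftedFactorial q q _)]

/-- The ultraspherical polynomial `C_m^τ`, written in Chebyshev polynomials of the first kind;
`ultraspherical_eval_cos` gives its usual defining formula. -/
def ultraspherical (τ : ℂ) (m : ℕ) : Polynomial ℂ :=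
  ∑ j ∈ Finset.range (m + 1),
    Polynomial.C (shiftedFactorial τ j * shiftedFactorial τ (m - j) /
      ((Nat.factorial j : ℂ) * (Nat.factorial (m - j) : ℂ))) *
      Polynomial.Chebyshev.T ℂ ((m : ℤ) - 2 * j)

theorem ultraspherical_eval_cos (τ : ℂ) (m : ℕ) (θ : ℂ) :
    (ultraspherical τ m).eval (Complex.cos θ) =
      ∑ j ∈ Finset.range (m + 1),
        shiftedFactorial τ j * shiftedFactorial τ (m - j) /
          ((Nat.factorial j : ℂ) * (Nat.factorial (m - j) : ℂ)) *
          Complex.exp (Complex.I * ((m : ℂ) - 2 * j) * θ) := by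
  refine sum_chebyshev_eval_cos m _ (fun j hj => ?_) θ
  rw [Nat.sub_sub_self hj, mul_comm (shiftedFactorial τ _), mul_comm (Nat.factorial _ : ℂ)]

/-! ### Partitions of length at most `n`: antitone functions `Fin n → ℕ` -/

variable {n : ℕ}

/-- The dominance partial ordering (without the requirement of equal weights). -/
def Dominated (mu lam : Fin n → ℕ) : Prop :=
  ∀ i, ∑ j ∈ Finset.univ.filter (· ≤ i), mu j ≤ ∑ j ∈ Finset.univ.filter (· ≤ i), lam j

/-- The symmetrized monomial `m_μ`, the sum of `x^ν` over the orbit of `μ` under `S_n`. -/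
def symMonomial (mu : Fin n → ℕ) : MvPolynomial (Fin n) ℂ :=
  ∑ nu ∈ Finset.univ.image (fun σ : Equiv.Perm (Fin n) => mu ∘ σ),
    MvPolynomial.monomial (Finsupp.equivFunOnFinite.symm nu) 1

/-! ### Macdonald and Jack polynomials -/

/-- `P = ∑_{μ ≤ λ} u_{λ,μ} m_μ` with `u_{λ,λ} = 1`, and
`∫_{𝕋ⁿ} P(x) m_μ(x⁻¹) Δ₊(x) Δ₊(x⁻¹) dx₁/x₁ ⋯ dxₙ/xₙ = 0` for all partitions `μ < λ`. -/
def IsOrthogonalPoly (Δplus : (Fin n → ℂ) → ℂ) (lam : Fin n → ℕ)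
    (P : MvPolynomial (Fin n) ℂ) : Prop :=
  (∃ u : (Fin n → ℕ) →₀ ℂ, u lam = 1 ∧ (∀ mu ∈ u.support, Antitone mu ∧ Dominated mu lam) ∧
    P = ∑ mu ∈ u.support, MvPolynomial.C (u mu) * symMonomial mu) ∧
  ∀ mu : Fin n → ℕ, Antitone mu → Dominated mu lam → mu ≠ lam →
    torusIntegral (fun x : Fin n → ℂ =>
      MvPolynomial.eval x P * MvPolynomial.eval x⁻¹ (symMonomial mu) *
        (Δplus x * Δplus x⁻¹) * ∏ i, (x i)⁻¹) 0 1 = 0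

/-- `Δ₊(x; q, t) = ∏_{i<j} (xᵢ/xⱼ; q)_∞ / (t xᵢ/xⱼ; q)_∞`. -/
def macdonaldWeight (q t : ℝ) (x : Fin n → ℂ) : ℂ :=
  ∏ p ∈ (Finset.univ : Finset (Fin n × Fin n)).filter (fun p => p.1 < p.2),
    qShiftedFactorialInf (x p.1 * (x p.2)⁻¹) q / qShiftedFactorialInf (t * x p.1 * (x p.2)⁻¹) q

/-- `Δ₊(x; τ) = ∏_{i<j} (1 - xᵢ/xⱼ)^τ` (principal branch; on the torus the base has nonnegative
real part). -/
def jackWeight (τ : ℝ) (x : Fin n → ℂ) : ℂ :=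
  ∏ p ∈ (Finset.univ : Finset (Fin n × Fin n)).filter (fun p => p.1 < p.2),
    (1 - x p.1 * (x p.2)⁻¹) ^ (τ : ℂ)

/-- `P` is the Macdonald polynomial `P_λ(x; q, t)`. -/
def IsMacdonald (q t : ℝ) (lam : Fin n → ℕ) (P : MvPolynomial (Fin n) ℂ) : Prop :=
  IsOrthogonalPoly (macdonaldWeight q t) lam P

/-- `P` is the Jack polynomial `P_λ(x; τ)`. -/
def IsJack (τ : ℝ) (lam : Fin n → ℕ) (P : MvPolynomial (Fin n) ℂ) : Prop :=
  IsOrthogonalPoly (jackWeight τ) lam P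

/-! ### Interpolation Macdonald and interpolation Jack polynomials -/

/-- `P` is a `λ`-monic symmetric polynomial of degree `|λ|` which vanishes at `node μ` for every
partition `μ ≠ λ` with `|μ| ≤ |λ|`. -/
def IsInterpolationPoly (node : (Fin n → ℕ) → (Fin n → ℂ)) (lam : Fin n → ℕ)
    (P : MvPolynomial (Fin n) ℂ) : Prop :=
  P.IsSymmetric ∧ P.totalDegree = ∑ i, lam i ∧
  P.coeff (Finsupp.equivFunOnFinite.symm lam) = 1 ∧
  ∀ mu : Fin n → ℕ, Antitone mu → mu ≠ lam → ∑ i, mu i ≤ ∑ i, lam i →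
    MvPolynomial.eval (node mu) P = 0

/-- `P` is the interpolation Macdonald polynomial `P_λ^{ip}(x; q, t)`: the nodes are
`q^μ t^δ` with `δ = (n-1, n-2, …, 0)`. -/
def IsInterpolationMacdonald (q t : ℝ) (lam : Fin n → ℕ) (P : MvPolynomial (Fin n) ℂ) : Prop :=
  IsInterpolationPoly (fun mu i => (q : ℂ) ^ mu i * (t : ℂ) ^ (n - 1 - (i : ℕ))) lam P

/-- `P` is the interpolation Jack polynomial `P_λ^{ip}(x; τ)`: the nodes are `μ + τ δ`. -/
def IsInterpolationJack (τ : ℝ) (lam : Fin n → ℕ) (P : MvPolynomial (Fin n) ℂ) : Prop :=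
  IsInterpolationPoly (fun mu i => (mu i : ℂ) + (τ : ℂ) * ((n - 1 - (i : ℕ) : ℕ) : ℂ)) lam P

/-! ### `BCₙ`-type interpolation Macdonald and interpolation Jack polynomials -/

/-- Laurent polynomials in `n` variables. -/
abbrev LaurentPoly (n : ℕ) : Type := AddMonoidAlgebra ℂ (Fin n → ℤ)

/-- The value of a Laurent polynomial at a point with nonzero coordinates. -/
def LaurentPoly.eval (x : Fin n → ℂ) (P : LaurentPoly n) : ℂ :=
  ∑ mu ∈ P.coeff.support, P.coeff mu * ∏ i, x i ^ mu i

/-- `P` is the `BCₙ`-type interpolation Macdonald polynomial `P_λ^{ip}(x; q, t, a)`: a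
`λ`-monic Laurent polynomial of degree `|λ|`, invariant under `Wₙ = Sₙ ⋉ (ℤ/2)ⁿ` (permutations
and inversions of the variables), which vanishes at `q^μ t^δ a` for every partition `μ` not
containing `λ`. As the coefficient of `x^λ` is `1`, the degree is `|λ|` if it is at most `|λ|`. -/
def IsBCInterpolationMacdonald (q t : ℝ) (a : ℂ) (lam : Fin n → ℕ) (P : LaurentPoly n) : Prop :=
  (∀ (σ : Equiv.Perm (Fin n)) (ε : Fin n → ℤˣ) (mu : Fin n → ℤ),
    P.coeff (fun i => (ε i : ℤ) * mu (σ i)) = P.coeff mu) ∧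
  (∀ mu ∈ P.coeff.support, ∑ i, mu i ≤ ∑ i, (lam i : ℤ)) ∧
  P.coeff (fun i => (lam i : ℤ)) = 1 ∧
  ∀ mu : Fin n → ℕ, Antitone mu → ¬ (∀ i, lam i ≤ mu i) →
    P.eval (fun i => (q : ℂ) ^ mu i * (t : ℂ) ^ (n - 1 - (i : ℕ)) * a) = 0

/-- `F` is the `BCₙ`-type interpolation Jack polynomial `P_λ^{ip}(x; τ, α)`:
`F(x) = lim_{q ↑ 1} (1-q)^{-2|λ|} P_λ^{ip}(q^x; q, q^τ, q^α)` for all `x`. -/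
def IsBCInterpolationJack (τ : ℝ) (α : ℂ) (lam : Fin n → ℕ) (F : MvPolynomial (Fin n) ℂ) : Prop :=
  ∃ P : ℝ → LaurentPoly n,
    (∀ᶠ q in nhdsWithin (1 : ℝ) (Set.Iio 1),
      IsBCInterpolationMacdonald q (q ^ τ) ((q : ℂ) ^ α) lam (P q)) ∧
    ∀ x : Fin n → ℂ, Filter.Tendsto
      (fun q : ℝ => ((1 - (q : ℂ)) ^ (2 * ∑ i, lam i))⁻¹ * (P q).eval (fun i => (q : ℂ) ^ x i))
      (nhdsWithin (1 : ℝ) (Set.Iio 1)) (nhds (MvPolynomial.eval x F))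

end InterpolationPoly

end

open InterpolationPoly

noncomputable section

namespace InterpolationPoly

open Finset

/-! Everything rests on the coefficients g_k = (t;q)_k/(q;q)_k, or (τ)_k/k! in the Jack case, and on
the ultraspherical three-term recurrence p_{m+2} R_{m+2} = b_{m+1} (x+y) R_{m+1} - d_m xy R_m for
R_m = ∑ g_j g_{m-j} x^j y^{m-j}. `RecurrenceData` isolates what is needed of g, so that the q-case
and the Jack case share their algebra.

Interpolation polynomials. Replace the powers in R_m by Newton products ∏ (X - s_i) ∏ (Y - r_l). For
suitable nodes (`NodePair`) these sums obey a deformed recurrence whose multipliers are symmetric in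
X and Y, so they are symmetric by induction (`newtonSum_recurrence`, `newtonSum_comm`), which is not
visible from their form. After multiplication by ∏_{i<m₂} (X - r_i)(Y - r_i), each summand
separately vanishes at every (s_i, r_j), j ≤ i, for which (i, j) does not contain (m₁, m₂)
(`interpSum_eq_zero`). These vanishing properties make the evaluation matrix triangular, and a
dimension count gives uniqueness (`eq_zero_of_triangular`, `eq_of_interpolation`). The BC₂ case is
the same statement in the variables x + x⁻¹, with nodes that are linear combinations of q^i and
q^{-i}. As q ↑ 1, differences of such nodes divided by (1-q)² tend to differences of squares, which
gives the limit polynomial explicitly (`tendsto_interpSum`). The hypergeometric formulas come from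
dividing the Newton sum by its full product in one variable.

Orthogonal polynomials. The weight depends on x₁/x₂ only, so the torus integral is a bilinear form
determined by the Fourier moments w_k of a function on the circle (`torusIntegral_eq_pairing`).
Orthogonality of R_m to the intermediate monomials says that ∑ g_j g_{m-j} w_{k-j} = 0 for 0 < k <
m. The recurrence reduces this to a two-term relation between the sums at k = 0
(`IsMomentSeq.momentSum_eq_zero`), and that relation is a telescoping consequence of a first-order
recurrence for w (`isMomentSeq_jack`, `isMomentSeq_q`). The recurrence for w follows by integrating
a derivative in the Jack case, and by moving the contour from |z| = 1 to |z| = q in the Macdonald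
case. -/

/-- Scalars `p`, `b`, `d` and coefficients `g`, with `g k = ∏ b i / p (i + 1)`, which satisfy the
relation behind the three-term recurrence of the polynomials `∑ g j g (m - j) x ^ j y ^ (m - j)`. -/
structure RecurrenceData (p b d g : ℕ → ℂ) : Prop where
  p_ne : ∀ k, p (k + 1) ≠ 0
  b_ne : ∀ k, b k ≠ 0
  g_zero : g 0 = 1
  g_succ : ∀ k, g (k + 1) * p (k + 1) = g k * b k
  rel : ∀ j l, p (j + l + 2) * b j * b l =
    b (j + l + 1) * (b l * p (j + 1) + b j * p (l + 1)) - d (j + l) * p (j + 1) * p (l + 1)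

theorem RecurrenceData.g_ne {p b d g : ℕ → ℂ} (h : RecurrenceData p b d g) (k : ℕ) : g k ≠ 0 := by
  induction k with
  | zero => simp [h.g_zero]
  | succ k ih =>
    intro h0
    have := h.g_succ k
    rw [h0, zero_mul] at this
    exact mul_ne_zero ih (h.b_ne k) this.symm

theorem RecurrenceData.g_succ_eq {p b d g : ℕ → ℂ} (h : RecurrenceData p b d g) (k : ℕ) :
    g (k + 1) = g k * b k / p (k + 1) := by
  rw [eq_div_iff (h.p_ne k), h.g_succ]

/-- Comparison of coefficients in the three-term recurrence for ∑ g_j g_{m-j} x^j y^{m-j}, with m =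
j + l; `rel` is this identity cleared of the factor g_j g_l and of denominators. -/
theorem RecurrenceData.g_mul {p b d g : ℕ → ℂ} (h : RecurrenceData p b d g) (j l : ℕ) :
    p (j + l + 2) * (g (j + 1) * g (l + 1)) =
      b (j + l + 1) * (g (j + 1) * g l + g j * g (l + 1)) - d (j + l) * (g j * g l) := by
  rw [h.g_succ_eq, h.g_succ_eq]
  have h1 := h.p_ne j
  have h2 := h.p_ne l
  have := h.rel j l
  field_simp
  linear_combination (g j * g l) * this

/-! ### Newton sums and their symmetry -/

/-- The condition on a pair of sequences of nodes (and on all its shifts) under which the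
interpolation polynomials `newtonSum` are symmetric. -/
def NodePair (p b d r s : ℕ → ℂ) : Prop :=
  ∀ n j l, -(p (j + l + 2) * b j * b l * s (j + l + 1 + n)) +
      b (j + l + 1) * b j * p (l + 1) * (s (j + l + 1 + n) + r n) -
      d (j + l) * p (j + 1) * p (l + 1) * r n =
    -(b (j + l + 1) * p (j + 1) * b l * s (j + n)) +
      b (j + l + 1) * b j * p (l + 1) * r (j + 1 + n)

theorem NodePair.shift {p b d r s : ℕ → ℂ} (h : NodePair p b d r s) (k : ℕ) :
    NodePair p b d (fun i => r (i + k)) (fun i => s (i + k)) := by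
  intro n j l
  have := h (n + k) j l
  simpa only [← add_assoc] using this

/-- The defining identity is homogeneous linear in the nodes. This is what lets the BC₂ nodes be
built from q^i and q^{-i}. -/
theorem NodePair.linear {p b d r s r' s' : ℕ → ℂ} (h : NodePair p b d r s)
    (h' : NodePair p b d r' s') (x y : ℂ) :
    NodePair p b d (fun i => x * r i + y * r' i) (fun i => x * s i + y * s' i) := by
  intro n j l
  linear_combination x * h n j l + y * h' n j l

/-- `∑ g j g (m - j) ∏_{j ≤ i < m} (X - s i) ∏_{l < j} (Y - r l)`. -/
def newtonSum {R : Type*} [CommRing R] [Algebra ℂ R] (g r s : ℕ → ℂ) (m : ℕ) (X Y : R) : R :=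
  ∑ j ∈ range (m + 1), algebraMap ℂ R (g j * g (m - j)) *
    ((∏ i ∈ Ico j m, (X - algebraMap ℂ R (s i))) * ∏ l ∈ range j, (Y - algebraMap ℂ R (r l)))

/-- Deformation of the three-term recurrence: x + y becomes X + Y - s_{m+1} - r_0, and xy becomes (X
- r_0)(Y - r_0) at the price of shifting the nodes in the last term. Both multipliers are symmetric
in X and Y. -/
theorem newtonSum_recurrence {p b d g r s : ℕ → ℂ} (h : RecurrenceData p b d g)
    (hn : NodePair p b d r s) (m : ℕ) (X Y : ℂ) :
    p (m + 2) * newtonSum g r s (m + 2) X Y =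
      b (m + 1) * (X + Y - s (m + 1) - r 0) * newtonSum g r s (m + 1) X Y -
      d m * ((X - r 0) * (Y - r 0)) *
        newtonSum g (fun i => r (i + 1)) (fun i => s (i + 1)) m X Y := by
  set A : ℕ → ℂ := fun j => ∏ i ∈ Ico j (m + 1), (X - s i) with hA
  set B : ℕ → ℂ := fun j => ∏ i ∈ range j, (Y - r i) with hB
  have hAs : ∀ j ≤ m, A j = (X - s j) * A (j + 1) := fun j hj =>
    prod_eq_prod_Ico_succ_bot (by omega) _
  have hBs : ∀ j, B (j + 1) = B j * (Y - r j) := fun j => prod_range_succ _ _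
  have hAm : A (m + 1) = 1 := by simp [hA]
  have e2 : newtonSum g r s (m + 2) X Y =
      ∑ j ∈ range (m + 2), g j * g (m + 2 - j) * ((X - s (m + 1)) * (A j * B j)) +
        g (m + 2) * B (m + 2) := by
    rw [newtonSum, sum_range_succ]
    congr 1
    · refine sum_congr rfl fun j hj => ?_
      simp only [Algebra.algebraMap_self, RingHom.id_apply]
      rw [prod_Ico_succ_top (by have := mem_range.mp hj; omega)]
      simp only [hA, hB]
      ring
    · simp [hB, h.g_zero]
  have e1 : newtonSum g r s (m + 1) X Y =
      ∑ j ∈ range (m + 2), g j * g (m + 1 - j) * (A j * B j) := by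
    simp [newtonSum, hA, hB]
  have e0 : (X - r 0) * (Y - r 0) * newtonSum g (fun i => r (i + 1)) (fun i => s (i + 1)) m X Y =
      ∑ j ∈ range (m + 1), g j * g (m - j) * ((X - r 0) * (A (j + 1) * B (j + 1))) := by
    rw [newtonSum, mul_sum]
    refine sum_congr rfl fun j hj => ?_
    simp only [Algebra.algebraMap_self, RingHom.id_apply, hA, hB]
    rw [prod_range_succ', prod_Ico_add' (fun i => X - s i) j m 1]
    ring
  -- The difference of the two sides is summed term by term; its partial sums have a one-term closed
  -- form, so the induction on n is a telescoping. At n = m + 1 the remainder cancels the last term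
  -- of the sum of order m + 2.
  have key : ∀ n ≤ m + 1,
      p (m + 2) * ∑ j ∈ range (n + 1), g j * g (m + 2 - j) * ((X - s (m + 1)) * (A j * B j)) -
        b (m + 1) * (X + Y - s (m + 1) - r 0) *
          ∑ j ∈ range (n + 1), g j * g (m + 1 - j) * (A j * B j) +
        d m * ∑ j ∈ range n, g j * g (m - j) * ((X - r 0) * (A (j + 1) * B (j + 1))) =
      -(b (m + 1) * (g n * g (m + 1 - n)) * ((Y - r n) * (A n * B n))) := by
    intro n
    induction n with
    | zero =>
      intro _
      have := h.g_succ (m + 1)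
      simp only [zero_add, sum_range_one, sum_range_zero, Nat.sub_zero, h.g_zero]
      linear_combination (X - s (m + 1)) * A 0 * B 0 * this
    | succ n ih =>
      intro hn'
      have ih := ih (by omega)
      obtain ⟨l, rfl⟩ : ∃ l, m = n + l := ⟨m - n, by omega⟩
      rw [sum_range_succ, sum_range_succ _ (n + 1),
        sum_range_succ (fun j => g j * g (n + l - j) * ((X - r 0) * (A (j + 1) * B (j + 1)))) n]
      have i1 : n + l + 2 - (n + 1) = l + 1 := by omega
      have i2 : n + l + 1 - (n + 1) = l := by omega
      have i3 : n + l - n = l := by omega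
      have i4 : n + l + 1 - n = l + 1 := by omega
      rw [i4] at ih
      rw [i1, i2, i3]
      -- After the new summand is added, everything is a multiple of A_{n+1} B_{n+1}: the
      -- coefficient of X is settled by `hI`, the terms free of X and Y by `hII`, and `hT` rewrites
      -- the remainder of the induction hypothesis as such a multiple.
      have hI := h.g_mul n l
      have hT : (X - s n) * (A (n + 1) * B (n + 1)) = (Y - r n) * (A n * B n) := by
        rw [hAs n (by omega), hBs]; ring
      have hII : -(p (n + l + 2) * (g (n + 1) * g (l + 1)) * s (n + l + 1)) +
          b (n + l + 1) * (g (n + 1) * g l) * (s (n + l + 1) + r 0) -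
            d (n + l) * (g n * g l) * r 0 =
          -(b (n + l + 1) * (g n * g (l + 1)) * s n) +
            b (n + l + 1) * (g (n + 1) * g l) * r (n + 1) := by
        have := hn 0 n l
        simp only [add_zero] at this
        rw [h.g_succ_eq, h.g_succ_eq]
        have h1 := h.p_ne n
        have h2 := h.p_ne l
        field_simp
        linear_combination (g n * g l) * this
      linear_combination ih + X * (A (n + 1) * B (n + 1)) * hI + (A (n + 1) * B (n + 1)) * hII +
        b (n + l + 1) * (g n * g (l + 1)) * hT
  have k1 := key (m + 1) le_rfl
  have hp := h.g_succ (m + 1)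
  simp only [Nat.sub_self, h.g_zero, hAm] at k1
  rw [mul_assoc (d m), e0, e1, e2, hBs]
  linear_combination k1 + B (m + 1) * (Y - r (m + 1)) * hp

/-- Strong induction through the recurrence, whose multipliers are symmetric. The recurrence has
order two, so m = 0 and m = 1 are checked by hand; for m = 1 the two coefficients coincide. -/
theorem newtonSum_comm {p b d g : ℕ → ℂ} (h : RecurrenceData p b d g) (m : ℕ) :
    ∀ r s : ℕ → ℂ, NodePair p b d r s → ∀ X Y : ℂ, newtonSum g r s m X Y = newtonSum g r s m Y X := by
  induction m using Nat.strong_induction_on with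
  | _ m ih =>
    intro r s hn X Y
    match m, ih with
    | 0, _ => simp [newtonSum]
    | 1, _ => simp [newtonSum, sum_range_succ]; ring
    | m + 2, ih =>
      refine mul_left_cancel₀ (h.p_ne (m + 1)) ?_
      rw [newtonSum_recurrence h hn, newtonSum_recurrence h hn, ih (m + 1) (by omega) r s hn X Y,
        ih m (by omega) _ _ (hn.shift 1) X Y]
      ring

/-! ### The two instances -/

theorem shiftedFactorial_zero (a : ℂ) : shiftedFactorial a 0 = 1 := prod_range_zero _

theorem shiftedFactorial_succ (a : ℂ) (k : ℕ) :
    shiftedFactorial a (k + 1) = shiftedFactorial a k * (a + k) := prod_range_succ _ _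

theorem qShiftedFactorial_zero (a q : ℂ) : qShiftedFactorial a q 0 = 1 := prod_range_zero _

theorem qShiftedFactorial_succ (a q : ℂ) (k : ℕ) :
    qShiftedFactorial a q (k + 1) = qShiftedFactorial a q k * (1 - a * q ^ k) :=
  prod_range_succ _ _

/-- The coefficients `(t;q)_k / (q;q)_k`. -/
def qCoeff (q t : ℂ) (k : ℕ) : ℂ := qShiftedFactorial t q k / qShiftedFactorial q q k

/-- The coefficients `(τ)_k / k!`. -/
def jackCoeff (τ : ℂ) (k : ℕ) : ℂ := shiftedFactorial τ k / (Nat.factorial k : ℂ)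

theorem qShiftedFactorial_self_ne {q : ℂ} (hq : ∀ k : ℕ, 1 - q ^ (k + 1) ≠ 0) (k : ℕ) :
    qShiftedFactorial q q k ≠ 0 :=
  prod_ne_zero_iff.mpr fun i _ => by rw [← pow_succ']; exact hq i

theorem recurrenceData_q {q t : ℂ} (hq : ∀ k : ℕ, 1 - q ^ (k + 1) ≠ 0)
    (ht : ∀ k : ℕ, 1 - t * q ^ k ≠ 0) :
    RecurrenceData (fun k => 1 - q ^ k) (fun k => 1 - t * q ^ k) (fun k => 1 - t ^ 2 * q ^ k)
      (qCoeff q t) where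
  p_ne := hq
  b_ne := ht
  g_zero := by simp [qCoeff, qShiftedFactorial_zero]
  g_succ k := by
    have h1 := qShiftedFactorial_self_ne hq k
    have h2 : 1 - q ^ k * q ≠ 0 := hq k
    simp only [qCoeff, qShiftedFactorial_succ, pow_succ, mul_comm q (q ^ k)]
    field_simp
  rel j l := by ring

theorem recurrenceData_jack {τ : ℂ} (hτ : ∀ k : ℕ, τ + k ≠ 0) :
    RecurrenceData (fun k => k) (fun k => τ + k) (fun k => 2 * τ + k) (jackCoeff τ) where
  p_ne k := by exact_mod_cast k.succ_ne_zero
  b_ne := hτ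
  g_zero := by simp [jackCoeff, shiftedFactorial_zero]
  g_succ k := by
    have h1 : (Nat.factorial k : ℂ) ≠ 0 := by exact_mod_cast k.factorial_ne_zero
    have h2 : (k : ℂ) + 1 ≠ 0 := by exact_mod_cast k.succ_ne_zero
    simp only [jackCoeff, shiftedFactorial_succ, Nat.factorial_succ]
    push_cast
    field_simp
  rel j l := by push_cast; ring

theorem nodePair_q (q t : ℂ) :
    NodePair (fun k => 1 - q ^ k) (fun k => 1 - t * q ^ k) (fun k => 1 - t ^ 2 * q ^ k)
      (fun i => q ^ i) (fun i => t * q ^ i) := by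
  intro n j l
  ring

theorem nodePair_q_inv {q t : ℂ} (hq0 : q ≠ 0) (ht0 : t ≠ 0) :
    NodePair (fun k => 1 - q ^ k) (fun k => 1 - t * q ^ k) (fun k => 1 - t ^ 2 * q ^ k)
      (fun i => (q ^ i)⁻¹) (fun i => (t * q ^ i)⁻¹) := by
  intro n j l
  simp only [pow_add, pow_one, pow_two]
  have h1 := pow_ne_zero n hq0
  have h2 := pow_ne_zero j hq0
  have h3 := pow_ne_zero l hq0
  field_simp
  ring

theorem nodePair_jack (τ : ℂ) :
    NodePair (fun k => k) (fun k => τ + k) (fun k => 2 * τ + k) (fun i => i) (fun i => i + τ) := by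
  intro n j l
  push_cast
  ring

/-! ### The interpolation polynomials in Newton form -/

/-- The interpolation polynomial with nodes `(s i, r j)`, `j ≤ i`, attached to `(m₁, m₂)`. -/
def interpSum {R : Type*} [CommRing R] [Algebra ℂ R] (g r s : ℕ → ℂ) (m₁ m₂ : ℕ) (X Y : R) : R :=
  algebraMap ℂ R (g (m₁ - m₂))⁻¹ *
    ((∏ i ∈ range m₂, (X - algebraMap ℂ R (r i))) * (∏ i ∈ range m₂, (Y - algebraMap ℂ R (r i))) *
      newtonSum g (fun i => r (i + m₂)) (fun i => s (i + m₂)) (m₁ - m₂) X Y)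

theorem interpSum_comm {p b d g r s : ℕ → ℂ} (h : RecurrenceData p b d g)
    (hn : NodePair p b d r s) (m₁ m₂ : ℕ) (X Y : ℂ) :
    interpSum g r s m₁ m₂ X Y = interpSum g r s m₁ m₂ Y X := by
  rw [interpSum, interpSum, newtonSum_comm h _ _ _ (hn.shift m₂)]
  ring

theorem map_interpSum {R S : Type*} [CommRing R] [Algebra ℂ R] [CommRing S] [Algebra ℂ S]
    (f : R →ₐ[ℂ] S) (g r s : ℕ → ℂ) (m₁ m₂ : ℕ) (X Y : R) :
    f (interpSum g r s m₁ m₂ X Y) = interpSum g r s m₁ m₂ (f X) (f Y) := by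
  simp [interpSum, newtonSum]

/-- If j < m₂, the prefactor in Y vanishes. Otherwise i < m₁, and the k-th summand contains X - s_i
when k ≤ j - m₂ (because j ≤ i) and Y - r_j when k > j - m₂. So all summands vanish one by one,
without any hypothesis on g or the nodes. -/
theorem interpSum_eq_zero (g r s : ℕ → ℂ) {m₁ m₂ i j : ℕ} (hji : j ≤ i)
    (h : ¬ (m₂ ≤ j ∧ m₁ ≤ i)) : interpSum g r s m₁ m₂ (s i) (r j) = 0 := by
  rw [interpSum]
  by_cases hj : m₂ ≤ j
  · have hi : i < m₁ := by by_contra; exact h ⟨hj, by omega⟩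
    refine mul_eq_zero_of_right _ (mul_eq_zero_of_right _ (sum_eq_zero fun k hk => ?_))
    refine mul_eq_zero_of_right _ ?_
    by_cases hkj : k ≤ j - m₂
    · refine mul_eq_zero_of_left (prod_eq_zero (i := i - m₂) (mem_Ico.mpr ⟨by omega, by omega⟩) ?_) _
      simp [Nat.sub_add_cancel (hj.trans hji)]
    · refine mul_eq_zero_of_right _ (prod_eq_zero (i := j - m₂) (mem_range.mpr (by omega)) ?_)
      simp [Nat.sub_add_cancel hj]
  · refine mul_eq_zero_of_right _ (mul_eq_zero_of_left (mul_eq_zero_of_right _ ?_) _)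
    exact prod_eq_zero (i := j) (mem_range.mpr (by omega)) (by simp)

/-- The first nodes `s i` and `r i` (up to index `N`) are in general position. -/
def NodesDistinct (r s : ℕ → ℂ) (N : ℕ) : Prop :=
  ∀ i ≤ N, ∀ j < i, s i ≠ s j ∧ s i ≠ r j ∧ r i ≠ r j

/-- At this point Y equals the first shifted node r_{m₂}, so only the summand j = 0 survives, and it
is a product of nonzero differences. -/
theorem interpSum_ne_zero {p b d g r s : ℕ → ℂ} (h : RecurrenceData p b d g) {N m₁ m₂ : ℕ}
    (hd : NodesDistinct r s N) (hN : m₁ ≤ N) (hm : m₂ ≤ m₁) :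
    interpSum g r s m₁ m₂ (s m₁) (r m₂) ≠ 0 := by
  rw [interpSum]
  refine mul_ne_zero (by simpa using h.g_ne _) (mul_ne_zero (mul_ne_zero ?_ ?_) ?_)
  · refine prod_ne_zero_iff.mpr fun i hi => sub_ne_zero.mpr ?_
    exact (hd m₁ hN i (by have := mem_range.mp hi; omega)).2.1
  · refine prod_ne_zero_iff.mpr fun i hi => sub_ne_zero.mpr ?_
    exact (hd m₂ (by omega) i (mem_range.mp hi)).2.2
  · rw [newtonSum, sum_eq_single 0]
    · refine mul_ne_zero (by simpa using ⟨h.g_ne _, h.g_ne _⟩) (mul_ne_zero ?_ (by simp))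
      refine prod_ne_zero_iff.mpr fun i hi => sub_ne_zero.mpr ?_
      exact (hd m₁ hN (i + m₂) (by have := mem_Ico.mp hi; omega)).1
    · intro j _ hj
      refine mul_eq_zero_of_right _ (mul_eq_zero_of_right _ (prod_eq_zero (i := 0) ?_ ?_))
      · exact mem_range.mpr (Nat.pos_of_ne_zero hj)
      · simp
    · simp

/-! ### Uniqueness -/

/-- The coefficients bound dim V above by |ι|. The evaluation matrix of the E i is triangular for
`deg` with nonzero diagonal, so evaluation maps V onto ℂ^ι. Hence dim V = |ι| and evaluation is also
injective. -/
theorem eq_zero_of_triangular {W ι : Type*} [AddCommGroup W] [Module ℂ W] [Fintype ι]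
    (V : Submodule ℂ W) (coef ev : W →ₗ[ℂ] (ι → ℂ)) (hcoef : ∀ v ∈ V, coef v = 0 → v = 0)
    (E : ι → W) (hE : ∀ i, E i ∈ V) (deg : ι → ℕ)
    (h0 : ∀ i j, j ≠ i → deg j ≤ deg i → ev (E i) j = 0) (h1 : ∀ i, ev (E i) i ≠ 0)
    {v : W} (hv : v ∈ V) (hev : ev v = 0) : v = 0 := by
  classical
  have hli : LinearIndependent ℂ fun i => ev (E i) := by
    let M : Matrix ι ι ℂ := Matrix.of fun i => ev (E i)
    have hM : Function.Injective M.mulVec := by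
      refine (injective_iff_map_eq_zero M.mulVecLin).mpr fun c hc => ?_
      by_contra hne
      have hne' : (univ.filter fun i => c i ≠ 0).Nonempty := by
        obtain ⟨i, hi⟩ := Function.ne_iff.mp hne
        exact ⟨i, by simpa using hi⟩
      -- For a kernel vector c, take i of maximal degree in the support of c: by triangularity, row
      -- i of the equation reduces to its diagonal term.
      obtain ⟨i, hi, hmax⟩ := exists_max_image _ deg hne'
      have h2 := congrFun hc i
      simp only [Matrix.mulVecLin_apply, Matrix.mulVec, dotProduct, Pi.zero_apply] at h2
      rw [sum_eq_single i] at h2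
      · exact mul_ne_zero (h1 i) (by simpa using hi) h2
      · intro j _ hj
        by_cases hcj : c j = 0
        · simp [hcj]
        · exact mul_eq_zero_of_left (h0 i j hj (hmax j (by simpa using hcj))) _
      · simp
    exact Matrix.linearIndependent_rows_iff_isUnit.mpr (Matrix.mulVec_injective_iff_isUnit.mp hM)
  let evV : V →ₗ[ℂ] (ι → ℂ) := ev.comp V.subtype
  let coefV : V →ₗ[ℂ] (ι → ℂ) := coef.comp V.subtype
  have hinj : Function.Injective coefV :=
    (injective_iff_map_eq_zero coefV).mpr fun w hw => Subtype.ext (hcoef w w.2 hw)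
  have : FiniteDimensional ℂ V := FiniteDimensional.of_injective coefV hinj
  have hle : Module.finrank ℂ V ≤ Fintype.card ι := by
    simpa using LinearMap.finrank_le_finrank_of_injective hinj
  have hsurj : Function.Surjective evV := by
    rw [← LinearMap.range_eq_top, eq_top_iff, ← hli.span_eq_top_of_card_eq_finrank' (by simp),
      Submodule.span_le]
    rintro _ ⟨i, rfl⟩
    exact ⟨⟨E i, hE i⟩, rfl⟩
  have hge : Fintype.card ι ≤ Module.finrank ℂ V := by
    simpa using LinearMap.finrank_le_finrank_of_surjective hsurj
  have hinj' : Function.Injective evV :=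
    (LinearMap.injective_iff_surjective_of_finrank_eq_finrank (by simpa using le_antisymm hle hge)).mpr
      hsurj
  exact congrArg Subtype.val ((injective_iff_map_eq_zero evV).mp hinj' ⟨v, hv⟩ hev)

/-- A multiple of E i can be subtracted from v so that all evaluations vanish; the result is zero by
triangularity, and the normalization of the coefficient with index i shows that the multiple is 1.
-/
theorem eq_of_triangular {W ι : Type*} [AddCommGroup W] [Module ℂ W] [Fintype ι]
    (V : Submodule ℂ W) (coef ev : W →ₗ[ℂ] (ι → ℂ)) (hcoef : ∀ v ∈ V, coef v = 0 → v = 0)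
    (E : ι → W) (hE : ∀ i, E i ∈ V) (deg : ι → ℕ)
    (h0 : ∀ i j, j ≠ i → deg j ≤ deg i → ev (E i) j = 0) (h1 : ∀ i, ev (E i) i ≠ 0)
    {v : W} (hv : v ∈ V) (i : ι) (hEi : coef (E i) i = 1) (hvi : coef v i = 1)
    (hev : ∀ j, j ≠ i → ev v j = 0) (hEv : ∀ j, j ≠ i → ev (E i) j = 0) : v = E i := by
  have h2 : v - (ev v i / ev (E i) i) • E i = 0 := by
    refine eq_zero_of_triangular V coef ev hcoef E hE deg h0 h1
      (V.sub_mem hv (V.smul_mem _ (hE i))) (funext fun j => ?_)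
    by_cases hj : j = i
    · subst hj
      simp [div_mul_cancel₀ _ (h1 j)]
    · simp [hev j hj, hEv j hj]
  have h3 := congrFun (congrArg coef h2) i
  simp only [map_sub, map_smul, map_zero, Pi.sub_apply, Pi.smul_apply, Pi.zero_apply, hEi, hvi,
    smul_eq_mul, mul_one, sub_eq_zero] at h3
  rw [← h3, one_smul, sub_eq_zero] at h2
  exact h2

/-- Pairs `(i, j)` with `j ≤ i` and `i + j ≤ N`. -/
def partitionPairs (N : ℕ) : Finset (ℕ × ℕ) :=
  (range (N + 1) ×ˢ range (N + 1)).filter fun a => a.2 ≤ a.1 ∧ a.1 + a.2 ≤ N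

theorem mem_partitionPairs {N : ℕ} {a : ℕ × ℕ} :
    a ∈ partitionPairs N ↔ a.2 ≤ a.1 ∧ a.1 + a.2 ≤ N := by
  simp only [partitionPairs, mem_filter, mem_product, mem_range]
  omega

/-! ### Symmetric polynomials in two variables -/

/-- The exponent `(i, j)`. -/
def expo (i j : ℕ) : Fin 2 →₀ ℕ := Finsupp.equivFunOnFinite.symm ![i, j]

@[simp] theorem expo_zero (i j : ℕ) : expo i j 0 = i := rfl

@[simp] theorem expo_one (i j : ℕ) : expo i j 1 = j := rfl

theorem expo_eta (nu : Fin 2 →₀ ℕ) : expo (nu 0) (nu 1) = nu := by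
  ext i; fin_cases i <;> rfl

theorem vec_eta {α : Type*} (x : Fin 2 → α) : ![x 0, x 1] = x := by
  ext i; fin_cases i <;> rfl

/-- Each summand of a Newton sum is a polynomial in x₁ times a polynomial in x₂; this is how its
coefficients are read off. -/
theorem coeff_aeval_mul_aeval (p q : Polynomial ℂ) (nu : Fin 2 →₀ ℕ) :
    (Polynomial.aeval (MvPolynomial.X 0) p * Polynomial.aeval (MvPolynomial.X 1) q :
      MvPolynomial (Fin 2) ℂ).coeff nu = p.coeff (nu 0) * q.coeff (nu 1) := by
  induction p using Polynomial.induction_on' with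
  | add p p' hp hp' => simp [add_mul, hp, hp']
  | monomial i a =>
    induction q using Polynomial.induction_on' with
    | add q q' hq hq' =>
      rw [map_add, mul_add, MvPolynomial.coeff_add, hq, hq', Polynomial.coeff_add, mul_add]
    | monomial j b =>
      have h1 : (Polynomial.aeval (MvPolynomial.X 0) (Polynomial.monomial i a) *
          Polynomial.aeval (MvPolynomial.X 1) (Polynomial.monomial j b) :
            MvPolynomial (Fin 2) ℂ) = MvPolynomial.monomial (expo i j) (a * b) := by
        rw [MvPolynomial.monomial_eq, Finsupp.prod_fintype _ _ (by simp)]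
        simp [Polynomial.aeval_monomial, MvPolynomial.algebraMap_eq]
        ring
      rw [h1, MvPolynomial.coeff_monomial, Polynomial.coeff_monomial, Polynomial.coeff_monomial]
      by_cases h : expo i j = nu
      · subst h; simp
      · rw [if_neg h]
        by_cases h0 : i = nu 0
        · by_cases h2 : j = nu 1
          · exact absurd (by rw [h0, h2, expo_eta]) h
          · simp [h2]
        · simp [h0]

/-- The interpolation polynomial as an element of `ℂ[x₁, x₂]`. -/
def interpMv (g r s : ℕ → ℂ) (m₁ m₂ : ℕ) : MvPolynomial (Fin 2) ℂ :=
  interpSum g r s m₁ m₂ (MvPolynomial.X 0) (MvPolynomial.X 1)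

theorem eval_interpMv (g r s : ℕ → ℂ) (m₁ m₂ : ℕ) (x : Fin 2 → ℂ) :
    MvPolynomial.eval x (interpMv g r s m₁ m₂) = interpSum g r s m₁ m₂ (x 0) (x 1) := by
  have := map_interpSum (MvPolynomial.aeval x) g r s m₁ m₂ (MvPolynomial.X 0) (MvPolynomial.X 1)
  simpa [interpMv, MvPolynomial.aeval_eq_eval] using this

theorem isSymmetric_of_eval_comm {P : MvPolynomial (Fin 2) ℂ}
    (h : ∀ x y : ℂ, MvPolynomial.eval ![x, y] P = MvPolynomial.eval ![y, x] P) :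
    P.IsSymmetric := by
  intro σ
  refine MvPolynomial.funext fun x => ?_
  rw [MvPolynomial.eval_rename]
  have hx : ∀ f : Fin 2 → ℂ, f = ![f 0, f 1] := fun f => (vec_eta f).symm
  have hσ : σ = 1 ∨ σ = Equiv.swap 0 1 := by
    clear h hx x
    revert σ
    decide
  rcases hσ with rfl | rfl
  · rfl
  · rw [hx (x ∘ _), h]
    simp [vec_eta]

theorem coeff_comm_of_isSymmetric {P : MvPolynomial (Fin 2) ℂ} (h : P.IsSymmetric) (i j : ℕ) :
    P.coeff (expo i j) = P.coeff (expo j i) := by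
  have h1 := h (Equiv.swap 0 1)
  have h2 : Finsupp.mapDomain (Equiv.swap (0 : Fin 2) 1) (expo i j) = expo j i := by
    rw [← Finsupp.equivMapDomain_eq_mapDomain]
    ext k; fin_cases k <;> rfl
  rw [← h2, ← h1, MvPolynomial.coeff_rename_mapDomain _ (Equiv.injective _), h1]

theorem interpMv_isSymmetric {p b d g r s : ℕ → ℂ} (h : RecurrenceData p b d g)
    (hn : NodePair p b d r s) (m₁ m₂ : ℕ) : (interpMv g r s m₁ m₂).IsSymmetric :=
  isSymmetric_of_eval_comm fun x y => by
    simp only [eval_interpMv]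
    exact interpSum_comm h hn m₁ m₂ x y

theorem prod_X_sub_C_monic (S : Finset ℕ) (a : ℕ → ℂ) :
    (∏ i ∈ S, (Polynomial.X - Polynomial.C (a i))).Monic :=
  Polynomial.monic_prod_of_monic _ _ fun _ _ => Polynomial.monic_X_sub_C _

theorem natDegree_prod_X_sub_C (S : Finset ℕ) (a : ℕ → ℂ) :
    (∏ i ∈ S, (Polynomial.X - Polynomial.C (a i))).natDegree = S.card := by
  rw [Polynomial.natDegree_prod_of_monic _ _ fun i _ => Polynomial.monic_X_sub_C _]
  simp

/-- The degrees of the two monic factors in the j-th summand add up to m₁ + m₂; this is all that the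
degree bound and the leading coefficient require. -/
theorem coeff_interpMv (g r s : ℕ → ℂ) (m₁ m₂ : ℕ) :
    ∃ P Q : ℕ → Polynomial ℂ, (∀ j ≤ m₁ - m₂, (P j).Monic ∧ (Q j).Monic ∧
      (P j).natDegree = m₂ + (m₁ - m₂ - j) ∧ (Q j).natDegree = m₂ + j) ∧
    ∀ nu, (interpMv g r s m₁ m₂).coeff nu = (g (m₁ - m₂))⁻¹ * ∑ j ∈ range (m₁ - m₂ + 1),
      g j * g (m₁ - m₂ - j) * ((P j).coeff (nu 0) * (Q j).coeff (nu 1)) := by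
  refine ⟨fun j => (∏ i ∈ range m₂, (Polynomial.X - Polynomial.C (r i))) *
      ∏ i ∈ Ico j (m₁ - m₂), (Polynomial.X - Polynomial.C (s (i + m₂))),
    fun j => (∏ i ∈ range m₂, (Polynomial.X - Polynomial.C (r i))) *
      ∏ i ∈ range j, (Polynomial.X - Polynomial.C (r (i + m₂))), fun j hj => ⟨?_, ?_, ?_, ?_⟩,
    fun nu => ?_⟩
  · exact (prod_X_sub_C_monic _ _).mul (prod_X_sub_C_monic _ fun i => s (i + m₂))
  · exact (prod_X_sub_C_monic _ _).mul (prod_X_sub_C_monic _ fun i => r (i + m₂))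
  · rw [(prod_X_sub_C_monic _ _).natDegree_mul (prod_X_sub_C_monic _ fun i => s (i + m₂)),
      natDegree_prod_X_sub_C, natDegree_prod_X_sub_C _ fun i => s (i + m₂)]
    simp
  · rw [(prod_X_sub_C_monic _ _).natDegree_mul (prod_X_sub_C_monic _ fun i => r (i + m₂)),
      natDegree_prod_X_sub_C, natDegree_prod_X_sub_C _ fun i => r (i + m₂)]
    simp
  · simp only [← coeff_aeval_mul_aeval, ← MvPolynomial.coeff_C_mul, ← MvPolynomial.coeff_sum]
    refine congrArg (MvPolynomial.coeff nu) ?_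
    simp only [interpMv, interpSum, newtonSum, MvPolynomial.algebraMap_eq, map_mul, map_prod,
      map_sub, Polynomial.aeval_X, Polynomial.aeval_C, mul_sum]
    refine sum_congr rfl fun j _ => ?_
    ring

theorem coeff_interpMv_eq_zero (g r s : ℕ → ℂ) {m₁ m₂ : ℕ} (hm : m₂ ≤ m₁) {nu : Fin 2 →₀ ℕ}
    (h : m₁ + m₂ < nu 0 + nu 1) : (interpMv g r s m₁ m₂).coeff nu = 0 := by
  obtain ⟨P, Q, h1, h2⟩ := coeff_interpMv g r s m₁ m₂
  rw [h2, sum_eq_zero, mul_zero]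
  intro j hj
  have hj' : j ≤ m₁ - m₂ := by have := mem_range.mp hj; omega
  obtain ⟨_, _, h3, h4⟩ := h1 j hj'
  by_cases h5 : m₂ + (m₁ - m₂ - j) < nu 0
  · rw [Polynomial.coeff_eq_zero_of_natDegree_lt (h3 ▸ h5)]; ring
  · rw [Polynomial.coeff_eq_zero_of_natDegree_lt (p := Q j) (by omega)]; ring

theorem coeff_interpMv_self {p b d g r s : ℕ → ℂ} (h : RecurrenceData p b d g) {m₁ m₂ : ℕ}
    (hm : m₂ ≤ m₁) : (interpMv g r s m₁ m₂).coeff (expo m₁ m₂) = 1 := by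
  obtain ⟨P, Q, h1, h2⟩ := coeff_interpMv g r s m₁ m₂
  rw [h2, sum_eq_single 0]
  · obtain ⟨h3, h4, h5, h6⟩ := h1 0 (by omega)
    have e1 : (P 0).coeff m₁ = 1 := by
      have := h3.coeff_natDegree
      rwa [h5, show m₂ + (m₁ - m₂ - 0) = m₁ by omega] at this
    have e2 : (Q 0).coeff m₂ = 1 := by
      have := h4.coeff_natDegree
      rwa [h6] at this
    simp [e1, e2, h.g_zero, h.g_ne]
  -- For j > 0 the factor in x₁ has degree m₁ - j < m₁, so only j = 0 reaches x₁^{m₁}.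
  · intro j hj hj0
    have hj' : j ≤ m₁ - m₂ := by have := mem_range.mp hj; omega
    obtain ⟨_, _, h3, _⟩ := h1 j hj'
    rw [Polynomial.coeff_eq_zero_of_natDegree_lt (p := P j) (by simp only [expo_zero]; omega)]
    ring
  · simp

/-- Symmetric polynomials in two variables of degree at most `N`. -/
def symmetricLE (N : ℕ) : Submodule ℂ (MvPolynomial (Fin 2) ℂ) where
  carrier := {P | P.IsSymmetric ∧ ∀ nu : Fin 2 →₀ ℕ, N < nu 0 + nu 1 → P.coeff nu = 0}
  zero_mem' := ⟨MvPolynomial.IsSymmetric.zero, by simp⟩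
  add_mem' h1 h2 := ⟨h1.1.add h2.1, fun nu hnu => by simp [h1.2 nu hnu, h2.2 nu hnu]⟩
  smul_mem' c P h := ⟨h.1.smul c, fun nu hnu => by simp [h.2 nu hnu]⟩

theorem interpMv_mem {p b d g r s : ℕ → ℂ} (h : RecurrenceData p b d g)
    (hn : NodePair p b d r s) {m₁ m₂ N : ℕ} (hm : m₂ ≤ m₁) (hN : m₁ + m₂ ≤ N) :
    interpMv g r s m₁ m₂ ∈ symmetricLE N :=
  ⟨interpMv_isSymmetric h hn m₁ m₂, fun _ hnu =>
    coeff_interpMv_eq_zero g r s hm (lt_of_le_of_lt hN hnu)⟩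

theorem antitone_fin_two {mu : Fin 2 → ℕ} : Antitone mu ↔ mu 1 ≤ mu 0 := by
  refine ⟨fun h => h (Fin.zero_le 1), fun h i j hij => ?_⟩
  fin_cases i <;> fin_cases j <;> simp_all

theorem totalDegree_le_iff (P : MvPolynomial (Fin 2) ℂ) (N : ℕ) :
    P.totalDegree ≤ N ↔ ∀ nu : Fin 2 →₀ ℕ, N < nu 0 + nu 1 → P.coeff nu = 0 := by
  rw [MvPolynomial.totalDegree, Finset.sup_le_iff]
  refine forall_congr' fun nu => ?_
  rw [Finsupp.sum_fintype _ _ (by simp), Fin.sum_univ_two, MvPolynomial.mem_support_iff,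
    ← not_lt, not_imp_not]

/-- Stated for an abstract space with coefficient and evaluation functionals, so that it covers both
symmetric polynomials and W₂-invariant Laurent polynomials. Triangularity comes from the vanishing
of `interpSum`, graded by the weight of the partition. -/
theorem eq_of_interpolation {p b d g r s : ℕ → ℂ} (h : RecurrenceData p b d g) {m₁ m₂ : ℕ}
    (hm : m₂ ≤ m₁) (hd : NodesDistinct r s (m₁ + m₂))
    {W : Type*} [AddCommGroup W] [Module ℂ W] (V : Submodule ℂ W) (coef ev : ℕ → ℕ → W →ₗ[ℂ] ℂ)
    (hcoef : ∀ v ∈ V, (∀ i j, j ≤ i → i + j ≤ m₁ + m₂ → coef i j v = 0) → v = 0)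
    (E : ℕ → ℕ → W) (hE : ∀ i j, j ≤ i → i + j ≤ m₁ + m₂ → E i j ∈ V)
    (hEv : ∀ i j k l, ev i j (E k l) = interpSum g r s k l (s i) (r j))
    (hE1 : coef m₁ m₂ (E m₁ m₂) = 1) {v : W} (hv : v ∈ V) (hv1 : coef m₁ m₂ v = 1)
    (hv0 : ∀ i j, j ≤ i → i + j ≤ m₁ + m₂ → (i, j) ≠ (m₁, m₂) → ev i j v = 0) :
    v = E m₁ m₂ := by
  let ι := partitionPairs (m₁ + m₂)
  have hι : ∀ a : ι, a.1.2 ≤ a.1.1 ∧ a.1.1 + a.1.2 ≤ m₁ + m₂ := fun a => mem_partitionPairs.mp a.2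
  have h0 : ∀ a a' : ι, a' ≠ a → a'.1.1 + a'.1.2 ≤ a.1.1 + a.1.2 →
      ev a'.1.1 a'.1.2 (E a.1.1 a.1.2) = 0 := by
    intro a a' hne hle
    rw [hEv, interpSum_eq_zero _ _ _ (hι a').1]
    -- A partition that contains another one and has no larger weight is equal to it.
    rintro ⟨h2, h3⟩
    exact hne (Subtype.ext (Prod.ext (by omega) (by omega)))
  refine eq_of_triangular (ι := ι) V (LinearMap.pi fun a => coef a.1.1 a.1.2)
    (LinearMap.pi fun a => ev a.1.1 a.1.2) (fun v hv hv0 => hcoef v hv fun i j hji hij => ?_)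
    (fun a => E a.1.1 a.1.2) (fun a => hE _ _ (hι a).1 (hι a).2) (fun a => a.1.1 + a.1.2)
    (fun a a' => h0 a a') (fun a => ?_) hv ⟨(m₁, m₂), mem_partitionPairs.mpr ⟨hm, le_rfl⟩⟩
    hE1 hv1 (fun a ha => hv0 _ _ (hι a).1 (hι a).2 fun h2 => ha (Subtype.ext h2))
    (fun a ha => h0 _ a ha (hι a).2)
  · exact congrFun hv0 ⟨(i, j), mem_partitionPairs.mpr ⟨hji, hij⟩⟩
  · simp only [LinearMap.pi_apply, hEv]
    exact interpSum_ne_zero h hd (by have := hι a; omega) (hι a).1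

theorem eq_zero_of_mem_symmetricLE {N : ℕ} {P : MvPolynomial (Fin 2) ℂ} (hP : P ∈ symmetricLE N)
    (h : ∀ i j, j ≤ i → i + j ≤ N → P.coeff (expo i j) = 0) : P = 0 := by
  ext nu
  rw [MvPolynomial.coeff_zero]
  by_cases hnu : nu 0 + nu 1 ≤ N
  · rcases le_total (nu 1) (nu 0) with h1 | h1
    · rw [← expo_eta nu]
      exact h _ _ h1 hnu
    · rw [← expo_eta nu, coeff_comm_of_isSymmetric hP.1]
      exact h _ _ h1 (by omega)
  · exact hP.2 nu (by omega)

theorem isInterpolationPoly_iff {p b d g r s : ℕ → ℂ} (h : RecurrenceData p b d g)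
    (hn : NodePair p b d r s) (hd : ∀ N, NodesDistinct r s N)
    {node : (Fin 2 → ℕ) → (Fin 2 → ℂ)} (hnode : ∀ mu, node mu = ![s (mu 0), r (mu 1)])
    {m₁ m₂ : ℕ} (hm : m₂ ≤ m₁) (P : MvPolynomial (Fin 2) ℂ) :
    IsInterpolationPoly node ![m₁, m₂] P ↔ P = interpMv g r s m₁ m₂ := by
  have hsum : ∑ i, ![m₁, m₂] i = m₁ + m₂ := by simp
  constructor
  · rintro ⟨h1, h2, h3, h4⟩
    refine eq_of_interpolation h hm (hd _) (symmetricLE (m₁ + m₂))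
      (fun i j => MvPolynomial.lcoeff ℂ (expo i j))
      (fun i j => (MvPolynomial.aeval ![s i, r j]).toLinearMap)
      (fun v hv => eq_zero_of_mem_symmetricLE hv) (interpMv g r s)
      (fun i j hji hij => interpMv_mem h hn hji hij) (fun i j k l => ?_)
      (coeff_interpMv_self h hm) ⟨h1, (totalDegree_le_iff P _).mp (h2.trans hsum).le⟩ h3
      fun i j hji hij hne => ?_
    · simp [MvPolynomial.aeval_eq_eval, eval_interpMv]
    · have := h4 ![i, j] (antitone_fin_two.mpr hji) (fun h5 => hne ?_) (by simpa using hij)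
      · simpa [hnode, MvPolynomial.aeval_eq_eval] using this
      · exact Prod.ext (congrFun h5 0) (congrFun h5 1)
  · rintro rfl
    have h3 := coeff_interpMv_self (r := r) (s := s) h hm
    refine ⟨interpMv_isSymmetric h hn _ _, le_antisymm ?_ ?_, h3, fun mu hmu hne hle => ?_⟩
    · rw [hsum, totalDegree_le_iff]
      exact fun nu hnu => coeff_interpMv_eq_zero g r s hm hnu
    · have h5 := MvPolynomial.le_totalDegree (MvPolynomial.mem_support_iff.mpr
        (h3.trans_ne one_ne_zero))
      rwa [Finsupp.sum_fintype _ _ (by simp), Fin.sum_univ_two, expo_zero, expo_one, ← hsum] at h5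
    · rw [eval_interpMv, hnode]
      refine interpSum_eq_zero g r s (antitone_fin_two.mp hmu) fun h5 => hne ?_
      simp only [Fin.sum_univ_two, Matrix.cons_val_zero, Matrix.cons_val_one] at hle
      rw [← vec_eta mu]
      congr 1
      · omega
      · congr 1; omega

/-! ### Hypergeometric forms of the interpolation polynomials -/

theorem prod_Ico_sub_eq_prod_range {R : Type*} [CommMonoid R] (f : ℕ → R) {k m : ℕ} (h : k ≤ m) :
    ∏ i ∈ Ico (m - k) m, f i = ∏ i ∈ range k, f (m - 1 - i) := by
  induction k with
  | zero => simp
  | succ k ih =>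
    rw [prod_range_succ, ← ih (by omega), prod_eq_prod_Ico_succ_bot (by omega),
      show m - (k + 1) + 1 = m - k by omega, show m - 1 - k = m - (k + 1) by omega, mul_comm]

/-- Reverse the order of summation and take the full product in y out of the sum. Term k then lacks
the top k factors in y, which appear in the denominator. -/
theorem interpSum_eq_first (g r s : ℕ → ℂ) {m₁ m₂ : ℕ} (hm : m₂ ≤ m₁) (x y : ℂ)
    (hy : ∀ j, m₂ ≤ j → j < m₁ → y ≠ r j) :
    interpSum g r s m₁ m₂ x y = (∏ i ∈ range m₂, (x - r i)) * (∏ i ∈ range m₁, (y - r i)) *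
      ∑ k ∈ range (m₁ - m₂ + 1), g k * g (m₁ - m₂ - k) / g (m₁ - m₂) *
        ((∏ i ∈ range k, (x - s (m₁ - 1 - i))) / ∏ i ∈ range k, (y - r (m₁ - 1 - i))) := by
  rw [interpSum, newtonSum, ← sum_range_reflect]
  simp only [mul_sum]
  refine sum_congr rfl fun k hk => ?_
  have hk' : k ≤ m₁ - m₂ := by have := mem_range.mp hk; omega
  have e1 : m₁ - m₂ + 1 - 1 - k = m₁ - m₂ - k := by omega
  have e2 : m₁ - m₂ - (m₁ - m₂ - k) = k := by omega
  have e3 : ∀ f : ℕ → ℂ, ∏ i ∈ Ico (m₁ - m₂ - k) (m₁ - m₂), f (i + m₂) =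
      ∏ i ∈ range k, f (m₁ - 1 - i) := fun f => by
    rw [prod_Ico_sub_eq_prod_range (fun i => f (i + m₂)) hk']
    refine prod_congr rfl fun i hi => ?_
    have := mem_range.mp hi
    congr 1
    omega
  have e4 : ∏ i ∈ range m₁, (y - r i) = (∏ i ∈ range m₂, (y - r i)) *
      ((∏ i ∈ range (m₁ - m₂ - k), (y - r (i + m₂))) * ∏ i ∈ range k, (y - r (m₁ - 1 - i))) := by
    rw [← e3 fun i => y - r i, range_eq_Ico (a := m₁ - m₂ - k),
      prod_Ico_consecutive (fun i => y - r (i + m₂)) (Nat.zero_le _) (by omega),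
      prod_Ico_add' (fun i => y - r i), range_eq_Ico, range_eq_Ico,
      Nat.zero_add, Nat.sub_add_cancel hm, prod_Ico_consecutive _ (Nat.zero_le _) hm]
  have e5 : ∏ i ∈ range k, (y - r (m₁ - 1 - i)) ≠ 0 := prod_ne_zero_iff.mpr fun i hi =>
    sub_ne_zero.mpr (by have := mem_range.mp hi; exact hy _ (by omega) (by omega))
  simp only [Algebra.algebraMap_self, RingHom.id_apply]
  rw [e1, e2, e3 fun i => x - s i, e4]
  field_simp

/-- The same with the full product in x taken out and no reversal. This form suits the BC₂ case,
where both products then start at the node of index m₂. -/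
theorem interpSum_eq_second (g r s : ℕ → ℂ) {m₁ m₂ : ℕ} (x y : ℂ)
    (hx : ∀ j < m₁ - m₂, x ≠ s (j + m₂)) :
    interpSum g r s m₁ m₂ x y = (∏ i ∈ range m₂, (x - r i)) * (∏ i ∈ range m₂, (y - r i)) *
      (∏ i ∈ range (m₁ - m₂), (x - s (i + m₂))) *
      ∑ k ∈ range (m₁ - m₂ + 1), g k * g (m₁ - m₂ - k) / g (m₁ - m₂) *
        ((∏ i ∈ range k, (y - r (i + m₂))) / ∏ i ∈ range k, (x - s (i + m₂))) := by
  rw [interpSum, newtonSum]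
  simp only [mul_sum]
  refine sum_congr rfl fun k hk => ?_
  have hk' : k ≤ m₁ - m₂ := by have := mem_range.mp hk; omega
  have e5 : ∏ i ∈ range k, (x - s (i + m₂)) ≠ 0 := prod_ne_zero_iff.mpr fun i hi =>
    sub_ne_zero.mpr (hx i (by have := mem_range.mp hi; omega))
  simp only [Algebra.algebraMap_self, RingHom.id_apply]
  rw [range_eq_Ico (a := m₁ - m₂), ← prod_Ico_consecutive _ (Nat.zero_le k) hk', ← range_eq_Ico]
  field_simp

/-- Reversal of q-shifted factorials: the factors of (t;q)_{m-k}/(q;q)_{m-k} missing from the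
quotient of order m are, read from the top, those of (q^{-m};q)_k and (q^{1-m}/t;q)_k. Inverting
each pair of factors costs q/t, hence the power. -/
theorem qCoeff_eq {q t : ℂ} (hq0 : q ≠ 0) (ht0 : t ≠ 0) (hq : ∀ k : ℕ, 1 - q ^ (k + 1) ≠ 0)
    (ht : ∀ k : ℕ, 1 - t * q ^ k ≠ 0) {k m : ℕ} (hk : k ≤ m) :
    qShiftedFactorial (q ^ (-(m : ℤ))) q k / qShiftedFactorial q q k *
        (qShiftedFactorial t q k / qShiftedFactorial (q ^ (1 - (m : ℤ)) * t⁻¹) q k) * (q / t) ^ k =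
      qCoeff q t k * qCoeff q t (m - k) / qCoeff q t m := by
  have h := recurrenceData_q hq ht
  have key : qShiftedFactorial (q ^ (-(m : ℤ))) q k /
      qShiftedFactorial (q ^ (1 - (m : ℤ)) * t⁻¹) q k * (q / t) ^ k =
      qCoeff q t (m - k) / qCoeff q t m := by
    induction k with
    | zero => simp [qShiftedFactorial_zero, h.g_ne]
    | succ k ih =>
      obtain ⟨l, rfl⟩ : ∃ l, m = k + 1 + l := ⟨m - (k + 1), by omega⟩
      have ih := ih (by omega)
      rw [show k + 1 + l - k = l + 1 by omega, h.g_succ_eq] at ih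
      rw [show k + 1 + l - (k + 1) = l by omega, qShiftedFactorial_succ, qShiftedFactorial_succ,
        pow_succ, mul_div_mul_comm]
      have h1 := hq l
      have h2 := ht l
      have e1 : q ^ (-((k + 1 + l : ℕ) : ℤ)) * q ^ k = (q ^ (l + 1))⁻¹ := by
        rw [← zpow_natCast q k, ← zpow_add₀ hq0, ← zpow_natCast, ← zpow_neg]
        congr 1; push_cast; ring
      have e2 : q ^ (1 - ((k + 1 + l : ℕ) : ℤ)) * t⁻¹ * q ^ k = (q ^ l * t)⁻¹ := by
        rw [mul_right_comm, ← zpow_natCast q k, ← zpow_add₀ hq0, mul_inv, ← zpow_natCast, ← zpow_neg]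
        congr 2; push_cast; ring
      have h3 : (1 - (q ^ (l + 1))⁻¹) / (1 - (q ^ l * t)⁻¹) * (q / t) =
          (1 - q ^ (l + 1)) / (1 - t * q ^ l) := by
        have h4 : q ^ l * t - 1 ≠ 0 := fun h5 => h2 (by linear_combination -h5)
        have h6 := pow_ne_zero l hq0
        have h7 : (1 - (q ^ l * t)⁻¹) = (q ^ l * t - 1) / (q ^ l * t) := by field_simp
        have h8 : 1 - (q ^ (l + 1))⁻¹ = (q ^ (l + 1) - 1) / q ^ (l + 1) := by field_simp
        rw [h7, h8, div_div_div_eq, div_mul_div_comm, div_eq_div_iff (mul_ne_zero (mul_ne_zero (pow_ne_zero _ hq0) h4) ht0) h2]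
        ring
      rw [e1, e2]
      calc _ = qShiftedFactorial (q ^ (-((k + 1 + l : ℕ) : ℤ))) q k /
            qShiftedFactorial (q ^ (1 - ((k + 1 + l : ℕ) : ℤ)) * t⁻¹) q k * (q / t) ^ k *
            ((1 - (q ^ (l + 1))⁻¹) / (1 - (q ^ l * t)⁻¹) * (q / t)) := by ring
        _ = _ := by rw [ih, h3]; field_simp
  rw [show qCoeff q t k * qCoeff q t (m - k) / qCoeff q t m =
    qCoeff q t k * (qCoeff q t (m - k) / qCoeff q t m) by ring, ← key, qCoeff]
  ring

theorem jackCoeff_eq {τ : ℂ} (hτ : ∀ k : ℕ, τ + k ≠ 0) {k m : ℕ} (hk : k ≤ m) :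
    shiftedFactorial (-(m : ℂ)) k / (Nat.factorial k : ℂ) *
        (shiftedFactorial τ k / shiftedFactorial (1 - m - τ) k) =
      jackCoeff τ k * jackCoeff τ (m - k) / jackCoeff τ m := by
  have h := recurrenceData_jack hτ
  have key : shiftedFactorial (-(m : ℂ)) k / shiftedFactorial (1 - m - τ) k =
      jackCoeff τ (m - k) / jackCoeff τ m := by
    induction k with
    | zero => simp [shiftedFactorial_zero, h.g_ne]
    | succ k ih =>
      obtain ⟨l, rfl⟩ : ∃ l, m = k + 1 + l := ⟨m - (k + 1), by omega⟩
      have ih := ih (by omega)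
      rw [show k + 1 + l - k = l + 1 by omega, h.g_succ_eq] at ih
      rw [show k + 1 + l - (k + 1) = l by omega, shiftedFactorial_succ, shiftedFactorial_succ,
        mul_div_mul_comm, ih]
      have h1 : (l : ℂ) + 1 ≠ 0 := by exact_mod_cast l.succ_ne_zero
      have h2 := hτ l
      have h3 := h.g_ne (k + 1 + l)
      push_cast
      rw [show -((k : ℂ) + 1 + l) + k = -(l + 1) by ring,
        show 1 - ((k : ℂ) + 1 + l) - τ + k = -(τ + l) by ring]
      field_simp
  rw [show jackCoeff τ k * jackCoeff τ (m - k) / jackCoeff τ m =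
    jackCoeff τ k * (jackCoeff τ (m - k) / jackCoeff τ m) by ring, ← key, jackCoeff]
  ring

theorem qHyp_eq {q t : ℂ} (hq0 : q ≠ 0) (ht0 : t ≠ 0) (hq : ∀ k : ℕ, 1 - q ^ (k + 1) ≠ 0)
    (ht : ∀ k : ℕ, 1 - t * q ^ k ≠ 0) (m : ℕ) (as bs : List ℂ) (hl : as.length = bs.length)
    (z : ℂ) :
    qHyp q m (t :: as) (q ^ (1 - (m : ℤ)) * t⁻¹ :: bs) z = ∑ k ∈ range (m + 1),
      qCoeff q t k * qCoeff q t (m - k) / qCoeff q t m *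
        ((as.map fun a => qShiftedFactorial a q k).prod /
          (bs.map fun b => qShiftedFactorial b q k).prod) * (t / q * z) ^ k := by
  refine sum_congr rfl fun k hk => ?_
  rw [← qCoeff_eq hq0 ht0 hq ht (by have := mem_range.mp hk; omega : k ≤ m)]
  simp only [List.map_cons, List.prod_cons, List.length_cons, hl, sub_self, zpow_zero, mul_one]
  have : (q / t) ^ k * (t / q) ^ k = 1 := by rw [← mul_pow]; field_simp; simp
  rw [mul_pow, mul_div_mul_comm]
  linear_combination (-(qShiftedFactorial (q ^ (-(m : ℤ))) q k / qShiftedFactorial q q k *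
    (qShiftedFactorial t q k / qShiftedFactorial (q ^ (1 - (m : ℤ)) * t⁻¹) q k) *
    ((as.map fun a => qShiftedFactorial a q k).prod /
      (bs.map fun b => qShiftedFactorial b q k).prod) * z ^ k)) * this

theorem hyp_eq {τ : ℂ} (hτ : ∀ k : ℕ, τ + k ≠ 0) (m : ℕ) (as bs : List ℂ) (z : ℂ) :
    hyp m (τ :: as) ((1 - (m : ℂ) - τ) :: bs) z = ∑ k ∈ range (m + 1),
      jackCoeff τ k * jackCoeff τ (m - k) / jackCoeff τ m *
        ((as.map fun a => shiftedFactorial a k).prod /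
          (bs.map fun b => shiftedFactorial b k).prod) * z ^ k := by
  refine sum_congr rfl fun k hk => ?_
  rw [← jackCoeff_eq hτ (by have := mem_range.mp hk; omega : k ≤ m)]
  simp only [List.map_cons, List.prod_cons]
  rw [mul_div_mul_comm]
  ring

theorem pow_mul_qShiftedFactorial_inv {x : ℂ} (hx : x ≠ 0) (q : ℂ) (n : ℕ) :
    x ^ n * qShiftedFactorial x⁻¹ q n = ∏ i ∈ range n, (x - q ^ i) := by
  rw [qShiftedFactorial, ← card_range n, ← prod_const, card_range, ← prod_mul_distrib]
  exact prod_congr rfl fun i _ => by field_simp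

theorem shiftedFactorial_neg (x : ℂ) (n : ℕ) :
    (-1) ^ n * shiftedFactorial (-x) n = ∏ i ∈ range n, (x - i) := by
  rw [shiftedFactorial, ← card_range n, ← prod_const, card_range, ← prod_mul_distrib]
  exact prod_congr rfl fun i _ => by ring

theorem interpSum_q_eq {q t : ℂ} (hq0 : q ≠ 0) (ht0 : t ≠ 0) (hq : ∀ k : ℕ, 1 - q ^ (k + 1) ≠ 0)
    (ht : ∀ k : ℕ, 1 - t * q ^ k ≠ 0) {m₁ m₂ : ℕ} (hm : m₂ ≤ m₁) {x₁ x₂ : ℂ} (hx₁ : x₁ ≠ 0)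
    (hx₂ : x₂ ≠ 0) (hx : ∀ j : ℕ, m₂ ≤ j → j < m₁ → x₂ ≠ q ^ j) :
    interpSum (qCoeff q t) (fun i => q ^ i) (fun i => t * q ^ i) m₁ m₂ x₁ x₂ =
      x₁ ^ m₂ * x₂ ^ m₁ * qShiftedFactorial x₁⁻¹ q m₂ * qShiftedFactorial x₂⁻¹ q m₁ *
        qHyp q (m₁ - m₂) [t, q ^ (1 - (m₁ : ℤ)) * t⁻¹ * x₁]
          [q ^ (1 - (m₁ : ℤ) + (m₂ : ℤ)) * t⁻¹, q ^ (1 - (m₁ : ℤ)) * x₂] q := by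
  rw [interpSum_eq_first _ _ _ hm _ _ hx,
    show 1 - (m₁ : ℤ) + m₂ = 1 - ((m₁ - m₂ : ℕ) : ℤ) by push_cast [hm]; ring,
    qHyp_eq hq0 ht0 hq ht _ _ _ (by rfl), ← pow_mul_qShiftedFactorial_inv hx₁,
    ← pow_mul_qShiftedFactorial_inv hx₂]
  -- Each factor x₁ - t q^{m₁-1-i} yields an extra t when normalized. The resulting t^k is exactly
  -- what the argument q becomes in `qHyp_eq`, since (t/q)·q = t.
  have hsum : ∀ k ∈ range (m₁ - m₂ + 1),
      (∏ i ∈ range k, (x₁ - t * q ^ (m₁ - 1 - i))) / ∏ i ∈ range k, (x₂ - q ^ (m₁ - 1 - i)) =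
      qShiftedFactorial (q ^ (1 - (m₁ : ℤ)) * t⁻¹ * x₁) q k /
        qShiftedFactorial (q ^ (1 - (m₁ : ℤ)) * x₂) q k * t ^ k := by
    intro k hk
    have hk' : k ≤ m₁ - m₂ := by have := mem_range.mp hk; omega
    rw [← card_range k, ← prod_const, card_range, qShiftedFactorial, qShiftedFactorial,
      ← prod_div_distrib, ← prod_div_distrib, ← prod_mul_distrib]
    refine prod_congr rfl fun i hi => ?_
    have hi' := mem_range.mp hi
    have e1 : q ^ (1 - (m₁ : ℤ)) * q ^ i = (q ^ (m₁ - 1 - i))⁻¹ := by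
      rw [← zpow_natCast q i, ← zpow_add₀ hq0, ← zpow_natCast, ← zpow_neg]
      congr 1; omega
    have h1 := pow_ne_zero (m₁ - 1 - i) hq0
    have h2 : x₂ - q ^ (m₁ - 1 - i) ≠ 0 := sub_ne_zero.mpr (hx _ (by omega) (by omega))
    have h3 : 1 - q ^ (1 - (m₁ : ℤ)) * x₂ * q ^ i = -(x₂ - q ^ (m₁ - 1 - i)) / q ^ (m₁ - 1 - i) := by
      rw [mul_right_comm, e1]; field_simp; ring
    have h4 : (1 - q ^ (1 - (m₁ : ℤ)) * t⁻¹ * x₁ * q ^ i) * t =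
        -(x₁ - t * q ^ (m₁ - 1 - i)) / q ^ (m₁ - 1 - i) := by
      rw [show q ^ (1 - (m₁ : ℤ)) * t⁻¹ * x₁ * q ^ i = q ^ (1 - (m₁ : ℤ)) * q ^ i * t⁻¹ * x₁ by ring,
        e1]
      field_simp; ring
    rw [div_mul_eq_mul_div, h3, h4, div_div_div_cancel_right₀ h1, neg_div_neg_eq]
  rw [sum_congr rfl fun k hk => by rw [hsum k hk]]
  rw [show t / q * q = t by field_simp]
  simp only [List.map_cons, List.map_nil, List.prod_cons, List.prod_nil, mul_one, ← mul_assoc]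
  ring

theorem interpSum_jack_eq {τ : ℂ} (hτ : ∀ k : ℕ, τ + k ≠ 0) {m₁ m₂ : ℕ} (hm : m₂ ≤ m₁) {x₁ x₂ : ℂ}
    (hx : ∀ j : ℕ, m₂ ≤ j → j < m₁ → x₂ ≠ j) :
    interpSum (jackCoeff τ) (fun i => i) (fun i => i + τ) m₁ m₂ x₁ x₂ =
      (-1) ^ (m₁ + m₂) * shiftedFactorial (-x₁) m₂ * shiftedFactorial (-x₂) m₁ *
        hyp (m₁ - m₂) [τ, -(m₁ : ℂ) + 1 - τ + x₁] [1 - (m₁ : ℂ) + m₂ - τ, -(m₁ : ℂ) + 1 + x₂] 1 := by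
  rw [interpSum_eq_first _ _ _ hm _ _ hx,
    show 1 - (m₁ : ℂ) + m₂ - τ = 1 - ((m₁ - m₂ : ℕ) : ℂ) - τ by push_cast [hm]; ring,
    hyp_eq hτ, ← shiftedFactorial_neg, ← shiftedFactorial_neg]
  have hsum : ∀ k ∈ range (m₁ - m₂ + 1),
      (∏ i ∈ range k, (x₁ - (((m₁ - 1 - i : ℕ) : ℂ) + τ))) /
        ∏ i ∈ range k, (x₂ - ((m₁ - 1 - i : ℕ) : ℂ)) =
      shiftedFactorial (-(m₁ : ℂ) + 1 - τ + x₁) k / shiftedFactorial (-(m₁ : ℂ) + 1 + x₂) k := by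
    intro k hk
    have hk' : k ≤ m₁ - m₂ := by have := mem_range.mp hk; omega
    rw [shiftedFactorial, shiftedFactorial]
    congr 1 <;> refine prod_congr rfl fun i hi => ?_ <;> have hi' := mem_range.mp hi <;>
      · rw [Nat.cast_sub (by omega), Nat.cast_sub (by omega)]
        push_cast
        ring
  rw [sum_congr rfl fun k hk => by rw [hsum k hk]]
  simp only [List.map_cons, List.map_nil, List.prod_cons, List.prod_nil, mul_one, one_pow]
  ring

theorem qHyp_macdonald {q t : ℂ} (hq0 : q ≠ 0) (ht0 : t ≠ 0) (hq : ∀ k : ℕ, 1 - q ^ (k + 1) ≠ 0)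
    (ht : ∀ k : ℕ, 1 - t * q ^ k ≠ 0) {m₁ m₂ : ℕ} (hm : m₂ ≤ m₁) (x₁ x₂ : ℂ) :
    qHyp q (m₁ - m₂) [t] [q ^ (1 - (m₁ : ℤ) + (m₂ : ℤ)) * t⁻¹] (q * x₂ / (t * x₁)) =
      ∑ k ∈ range (m₁ - m₂ + 1), qCoeff q t k * qCoeff q t (m₁ - m₂ - k) / qCoeff q t (m₁ - m₂) *
        (x₂ / x₁) ^ k := by
  rw [show 1 - (m₁ : ℤ) + m₂ = 1 - ((m₁ - m₂ : ℕ) : ℤ) by push_cast [hm]; ring,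
    qHyp_eq hq0 ht0 hq ht _ _ _ (by rfl), show t / q * (q * x₂ / (t * x₁)) = x₂ / x₁ by field_simp]
  simp

theorem hyp_jack {τ : ℂ} (hτ : ∀ k : ℕ, τ + k ≠ 0) {m₁ m₂ : ℕ} (hm : m₂ ≤ m₁) (x₁ x₂ : ℂ) :
    hyp (m₁ - m₂) [τ] [1 - (m₁ : ℂ) + m₂ - τ] (x₂ / x₁) =
      ∑ k ∈ range (m₁ - m₂ + 1), jackCoeff τ k * jackCoeff τ (m₁ - m₂ - k) /
        jackCoeff τ (m₁ - m₂) * (x₂ / x₁) ^ k := by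
  rw [show 1 - (m₁ : ℂ) + m₂ - τ = 1 - ((m₁ - m₂ : ℕ) : ℂ) - τ by push_cast [hm]; ring, hyp_eq hτ]
  simp

/-! ### Interpolation Macdonald and Jack polynomials -/

theorem one_sub_pow_ne_zero {q : ℝ} (h0 : 0 < q) (h1 : q < 1) (k : ℕ) :
    1 - (q : ℂ) ^ (k + 1) ≠ 0 := by
  have : q ^ (k + 1) < 1 := pow_lt_one₀ h0.le h1 k.succ_ne_zero
  exact_mod_cast (sub_pos.mpr this).ne'

theorem mul_pow_lt_one {q t : ℝ} (h0 : 0 < q) (h1 : q < 1) (ht0 : 0 < t) (ht1 : t < 1) (k : ℕ) :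
    t * q ^ k < 1 :=
  lt_of_le_of_lt (mul_le_of_le_one_right ht0.le (pow_le_one₀ h0.le h1.le)) ht1

theorem one_sub_mul_pow_ne_zero {q t : ℝ} (h0 : 0 < q) (h1 : q < 1) (ht0 : 0 < t) (ht1 : t < 1)
    (k : ℕ) : 1 - (t : ℂ) * (q : ℂ) ^ k ≠ 0 := by
  exact_mod_cast (sub_pos.mpr (mul_pow_lt_one h0 h1 ht0 ht1 k)).ne'

theorem ofReal_add_natCast_ne_zero {τ : ℝ} (h : 0 < τ) (k : ℕ) : (τ : ℂ) + k ≠ 0 := by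
  exact_mod_cast (by positivity : 0 < τ + k).ne'

theorem nodesDistinct_q {q t : ℝ} (h0 : 0 < q) (h1 : q < 1) (ht0 : 0 < t) (ht1 : t < 1) (N : ℕ) :
    NodesDistinct (fun i => (q : ℂ) ^ i) (fun i => (t : ℂ) * (q : ℂ) ^ i) N := by
  intro i _ j hj
  have h2 : q ^ i < q ^ j := pow_lt_pow_right_of_lt_one₀ h0 h1 hj
  have h3 : t * q ^ i < t * q ^ j := mul_lt_mul_of_pos_left h2 ht0
  have h4 : t * q ^ j < q ^ j := mul_lt_of_lt_one_left (pow_pos h0 j) ht1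
  refine ⟨?_, ?_, ?_⟩ <;> dsimp only <;> norm_cast
  · exact h3.ne
  · exact (h3.trans h4).ne
  · exact h2.ne

theorem nodesDistinct_jack {τ : ℝ} (h0 : 0 < τ) (N : ℕ) :
    NodesDistinct (fun i => (i : ℂ)) (fun i => (i : ℂ) + τ) N := by
  intro i _ j hj
  have h2 : (j : ℝ) < i := by exact_mod_cast hj
  refine ⟨?_, ?_, ?_⟩ <;> dsimp only <;> norm_cast
  · exact fun h => by linarith
  · exact (by linarith : (j : ℝ) < i + τ).ne'
  · exact hj.ne'

theorem interpolationMacdonald {q t : ℝ} (h0 : 0 < q) (h1 : q < 1) (ht0 : 0 < t) (ht1 : t < 1)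
    {m₁ m₂ : ℕ} (hm : m₂ ≤ m₁) (P : MvPolynomial (Fin 2) ℂ) :
    IsInterpolationMacdonald q t ![m₁, m₂] P ↔
      P = interpMv (qCoeff q t) (fun i => (q : ℂ) ^ i) (fun i => (t : ℂ) * (q : ℂ) ^ i) m₁ m₂ :=
  isInterpolationPoly_iff
    (recurrenceData_q (one_sub_pow_ne_zero h0 h1) (one_sub_mul_pow_ne_zero h0 h1 ht0 ht1))
    (nodePair_q q t) (nodesDistinct_q h0 h1 ht0 ht1)
    (fun mu => by ext i; fin_cases i <;> simp [mul_comm]) hm P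

theorem interpolationJack {τ : ℝ} (h0 : 0 < τ) {m₁ m₂ : ℕ} (hm : m₂ ≤ m₁)
    (P : MvPolynomial (Fin 2) ℂ) :
    IsInterpolationJack τ ![m₁, m₂] P ↔
      P = interpMv (jackCoeff τ) (fun i => (i : ℂ)) (fun i => (i : ℂ) + τ) m₁ m₂ :=
  isInterpolationPoly_iff (recurrenceData_jack (ofReal_add_natCast_ne_zero h0))
    (nodePair_jack τ) (nodesDistinct_jack h0)
    (fun mu => by ext i; fin_cases i <;> simp) hm P

/-! ### Invariant Laurent polynomials in two variables -/

/-- The substitution `xᵢ ↦ xᵢ + xᵢ⁻¹`. -/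
def toLaurent : MvPolynomial (Fin 2) ℂ →ₐ[ℂ] LaurentPoly 2 :=
  MvPolynomial.aeval fun i =>
    AddMonoidAlgebra.single (Pi.single i 1) 1 + AddMonoidAlgebra.single (-Pi.single i 1) 1

theorem single_add_single_pow (i : Fin 2) (n : ℕ) :
    ((AddMonoidAlgebra.single (Pi.single i 1) 1 + AddMonoidAlgebra.single (-Pi.single i 1) 1 :
      LaurentPoly 2)) ^ n = ∑ k ∈ range (n + 1),
        AddMonoidAlgebra.single (Pi.single i ((n : ℤ) - 2 * k)) (n.choose k : ℂ) := by
  rw [add_comm, add_pow]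
  refine sum_congr rfl fun k hk => ?_
  have hk' : k ≤ n := by have := mem_range.mp hk; omega
  rw [AddMonoidAlgebra.single_pow, AddMonoidAlgebra.single_pow, AddMonoidAlgebra.single_mul_single,
    ← nsmul_eq_mul', AddMonoidAlgebra.smul_single]
  congr 1
  · ext j
    by_cases h : j = i
    · subst h; simp [Nat.cast_sub hk']; ring
    · simp [h]
  · simp

/-- Expanding (x₁ + x₁⁻¹)^{ν₁} (x₂ + x₂⁻¹)^{ν₂} gives exponents ν - 2(k, l); in degree at least |ν|
only k = l = 0 can occur. Hence the substitution preserves top-degree coefficients. -/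
theorem coeff_toLaurent_monomial (nu : Fin 2 →₀ ℕ) (c : ℂ) (mu : Fin 2 → ℤ)
    (h : (nu 0 : ℤ) + nu 1 ≤ mu 0 + mu 1) :
    (toLaurent (MvPolynomial.monomial nu c)).coeff mu =
      if mu = (fun i => (nu i : ℤ)) then c else 0 := by
  have e1 : toLaurent (MvPolynomial.monomial nu c) = ∑ k ∈ range (nu 0 + 1), ∑ l ∈ range (nu 1 + 1),
      AddMonoidAlgebra.single (![(nu 0 : ℤ) - 2 * k, (nu 1 : ℤ) - 2 * l])
        (c * (((nu 0).choose k : ℂ) * ((nu 1).choose l : ℂ))) := by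
    rw [toLaurent, MvPolynomial.aeval_monomial, Finsupp.prod_fintype _ _ (by simp),
      Fin.prod_univ_two, single_add_single_pow, single_add_single_pow, sum_mul_sum,
      ← Algebra.smul_def, smul_sum]
    refine sum_congr rfl fun k _ => ?_
    rw [smul_sum]
    refine sum_congr rfl fun l _ => ?_
    rw [AddMonoidAlgebra.single_mul_single, AddMonoidAlgebra.smul_single, smul_eq_mul]
    congr 1
    ext i; fin_cases i <;> simp
  have e2 : (toLaurent (MvPolynomial.monomial nu c)).coeff mu =
      ∑ k ∈ range (nu 0 + 1), ∑ l ∈ range (nu 1 + 1),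
        if ![(nu 0 : ℤ) - 2 * k, (nu 1 : ℤ) - 2 * l] = mu then
          c * (((nu 0).choose k : ℂ) * ((nu 1).choose l : ℂ)) else 0 := by
    rw [e1]
    simp only [AddMonoidAlgebra.coeff_sum, AddMonoidAlgebra.coeff_single, Finsupp.finsetSum_apply,
      Finsupp.single_apply]
  have e3 : ∀ k l : ℕ, ![(nu 0 : ℤ) - 2 * k, (nu 1 : ℤ) - 2 * l] = mu → k = 0 ∧ l = 0 := by
    rintro k l rfl
    simp only [Matrix.cons_val_zero, Matrix.cons_val_one] at h
    omega
  have e4 : (![(nu 0 : ℤ), (nu 1 : ℤ)] : Fin 2 → ℤ) = fun i => (nu i : ℤ) :=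
    vec_eta fun i => (nu i : ℤ)
  rw [e2, sum_eq_single 0, sum_eq_single 0]
  · simp [e4, eq_comm]
  · intro l _ hl
    rw [if_neg fun h2 => hl (e3 _ _ h2).2]
  · simp
  · intro k _ hk
    exact sum_eq_zero fun l _ => if_neg fun h2 => hk (e3 _ _ h2).1
  · simp

theorem coeff_toLaurent {f : MvPolynomial (Fin 2) ℂ} {N : ℕ}
    (hf : ∀ nu : Fin 2 →₀ ℕ, N < nu 0 + nu 1 → f.coeff nu = 0) (mu : Fin 2 → ℤ)
    (h : (N : ℤ) ≤ mu 0 + mu 1) :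
    (toLaurent f).coeff mu =
      ∑ nu ∈ f.support, if mu = (fun i => (nu i : ℤ)) then f.coeff nu else 0 := by
  conv_lhs => rw [f.as_sum]
  rw [map_sum, AddMonoidAlgebra.coeff_sum, Finsupp.finsetSum_apply]
  refine sum_congr rfl fun nu hnu => coeff_toLaurent_monomial nu _ mu ?_
  have : nu 0 + nu 1 ≤ N := not_lt.mp fun h2 => MvPolynomial.mem_support_iff.mp hnu (hf nu h2)
  omega

theorem coeff_toLaurent_of_lt {f : MvPolynomial (Fin 2) ℂ} {N : ℕ}
    (hf : ∀ nu : Fin 2 →₀ ℕ, N < nu 0 + nu 1 → f.coeff nu = 0) (mu : Fin 2 → ℤ)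
    (h : (N : ℤ) < mu 0 + mu 1) : (toLaurent f).coeff mu = 0 := by
  rw [coeff_toLaurent hf mu h.le]
  refine sum_eq_zero fun nu _ => ?_
  split_ifs with h2
  · subst h2
    have h' : (N : ℤ) < nu 0 + nu 1 := h
    exact hf nu (by exact_mod_cast h')
  · rfl

theorem coeff_toLaurent_of_eq {f : MvPolynomial (Fin 2) ℂ} {i j : ℕ}
    (hf : ∀ nu : Fin 2 →₀ ℕ, i + j < nu 0 + nu 1 → f.coeff nu = 0) :
    (toLaurent f).coeff ![(i : ℤ), (j : ℤ)] = f.coeff (expo i j) := by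
  rw [coeff_toLaurent hf _ (by simp)]
  have h1 : ∀ nu : Fin 2 →₀ ℕ, ![(i : ℤ), (j : ℤ)] = (fun i => (nu i : ℤ)) ↔ nu = expo i j := by
    intro nu
    constructor
    · intro h
      have h2 := congrFun h 0
      have h3 := congrFun h 1
      simp only [Matrix.cons_val_zero, Matrix.cons_val_one, Nat.cast_inj] at h2 h3
      rw [h2, h3, expo_eta]
    · rintro rfl
      ext k; fin_cases k <;> simp
  simp only [h1, sum_ite_eq', MvPolynomial.mem_support_iff]
  split_ifs with h2
  · rfl
  · exact (not_not.mp h2).symm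

/-- The character `μ ↦ x ^ μ` of the group of exponents. -/
def expEval {x : Fin 2 → ℂ} (hx : ∀ i, x i ≠ 0) : Multiplicative (Fin 2 → ℤ) →* ℂ where
  toFun mu := ∏ i, x i ^ (Multiplicative.toAdd mu i)
  map_one' := by simp
  map_mul' a b := by
    rw [← prod_mul_distrib]
    exact prod_congr rfl fun i _ => zpow_add₀ (hx i) _ _

theorem LaurentPoly.eval_eq_lift {x : Fin 2 → ℂ} (hx : ∀ i, x i ≠ 0) (P : LaurentPoly 2) :
    P.eval x = AddMonoidAlgebra.lift ℂ ℂ (Fin 2 → ℤ) (expEval hx) P := by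
  rw [AddMonoidAlgebra.lift_apply]
  rfl

theorem expEval_single {x : Fin 2 → ℂ} (hx : ∀ i, x i ≠ 0) (i : Fin 2) (k : ℤ) :
    expEval hx (Multiplicative.ofAdd (Pi.single i k)) = x i ^ k := by
  simp only [expEval, MonoidHom.coe_mk, OneHom.coe_mk, toAdd_ofAdd]
  rw [prod_eq_single i]
  · simp
  · intro j _ hj
    simp [hj]
  · simp

theorem eval_toLaurent {x : Fin 2 → ℂ} (hx : ∀ i, x i ≠ 0) (f : MvPolynomial (Fin 2) ℂ) :
    (toLaurent f).eval x = MvPolynomial.eval (fun i => x i + (x i)⁻¹) f := by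
  rw [LaurentPoly.eval_eq_lift hx, ← AlgHom.comp_apply, ← MvPolynomial.aeval_eq_eval]
  refine DFunLike.congr_fun (MvPolynomial.algHom_ext fun i => ?_) f
  have h1 : expEval hx (Multiplicative.ofAdd (-Pi.single i 1)) = (x i)⁻¹ := by
    rw [← Pi.single_neg, expEval_single]; simp
  simp only [AlgHom.comp_apply, toLaurent, MvPolynomial.aeval_X, map_add,
    AddMonoidAlgebra.lift_single, one_smul, h1, expEval_single, zpow_one]

/-- The action of `W₂` on exponents. -/
def signedPerm (σ : Equiv.Perm (Fin 2)) (ε : Fin 2 → ℤˣ) : (Fin 2 → ℤ) ≃+ (Fin 2 → ℤ) where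
  toFun mu i := (ε i : ℤ) * mu (σ i)
  invFun mu i := (ε (σ.symm i) : ℤ) * mu (σ.symm i)
  left_inv mu := by ext i; simp [← mul_assoc, ← Units.val_mul, Int.units_mul_self]
  right_inv mu := by ext i; simp [← mul_assoc, ← Units.val_mul, Int.units_mul_self]
  map_add' a b := by ext i; simp [mul_add]

/-- On generators a sign change leaves x + x⁻¹ fixed and the permutation acts by renaming, which a
symmetric polynomial does not see. -/
theorem domCongr_toLaurent {f : MvPolynomial (Fin 2) ℂ} (hf : f.IsSymmetric)
    (σ : Equiv.Perm (Fin 2)) (ε : Fin 2 → ℤˣ) :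
    AddMonoidAlgebra.domCongr ℂ ℂ (signedPerm σ ε) (toLaurent f) = toLaurent f := by
  conv_rhs => rw [← hf σ.symm]
  have h1 : ((AddMonoidAlgebra.domCongr ℂ ℂ (signedPerm σ ε)).toAlgHom.comp toLaurent) =
      toLaurent.comp (MvPolynomial.rename σ.symm) := by
    refine MvPolynomial.algHom_ext fun i => ?_
    have h2 : signedPerm σ ε (Pi.single i 1) = Pi.single (σ.symm i) (ε (σ.symm i) : ℤ) := by
      ext j
      by_cases h : j = σ.symm i
      · subst h; simp [signedPerm]
      · have h' : σ j ≠ i := fun h3 => h (by rw [← h3]; simp)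
        simp [signedPerm, h, h']
    have h4 : ∀ v, (AddMonoidAlgebra.domCongr ℂ ℂ (signedPerm σ ε)).toAlgHom
        (AddMonoidAlgebra.single v 1) = AddMonoidAlgebra.single (signedPerm σ ε v) 1 :=
      fun v => AddMonoidAlgebra.domCongr_single _ v 1
    simp only [AlgHom.comp_apply, toLaurent, MvPolynomial.aeval_X, map_add, MvPolynomial.rename_X,
      h4, map_neg, h2]
    rcases Int.units_eq_one_or (ε (σ.symm i)) with h3 | h3
    · rw [h3]; simp
    · rw [h3]
      simp only [Units.val_neg, Units.val_one, Pi.single_neg, neg_neg]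
      exact add_comm _ _
  exact DFunLike.congr_fun h1 f

theorem coeff_toLaurent_signedPerm {f : MvPolynomial (Fin 2) ℂ} (hf : f.IsSymmetric)
    (σ : Equiv.Perm (Fin 2)) (ε : Fin 2 → ℤˣ) (mu : Fin 2 → ℤ) :
    (toLaurent f).coeff (fun i => (ε i : ℤ) * mu (σ i)) = (toLaurent f).coeff mu := by
  conv_lhs => rw [← domCongr_toLaurent hf σ ε]
  rw [AddMonoidAlgebra.coeff_domCongr]
  congr 1
  exact (signedPerm σ ε).symm_apply_apply mu

/-- `W₂`-invariant Laurent polynomials of degree at most `N`. -/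
def invariantLE (N : ℕ) : Submodule ℂ (LaurentPoly 2) where
  carrier := {P | (∀ (σ : Equiv.Perm (Fin 2)) (ε : Fin 2 → ℤˣ) (mu : Fin 2 → ℤ),
    P.coeff (fun i => (ε i : ℤ) * mu (σ i)) = P.coeff mu) ∧
      ∀ mu : Fin 2 → ℤ, (N : ℤ) < mu 0 + mu 1 → P.coeff mu = 0}
  zero_mem' := by simp
  add_mem' h1 h2 := ⟨fun σ ε mu => by simp [h1.1 σ ε mu, h2.1 σ ε mu],
    fun mu hmu => by simp [h1.2 mu hmu, h2.2 mu hmu]⟩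
  smul_mem' c P h := ⟨fun σ ε mu => by simp [h.1 σ ε mu], fun mu hmu => by simp [h.2 mu hmu]⟩

theorem toLaurent_mem {f : MvPolynomial (Fin 2) ℂ} {N : ℕ} (hf : f ∈ symmetricLE N) :
    toLaurent f ∈ invariantLE N :=
  ⟨coeff_toLaurent_signedPerm hf.1, coeff_toLaurent_of_lt hf.2⟩

/-- Signs and a swap move any exponent to a partition, and partitions of weight above N carry
coefficient zero by the degree bound. -/
theorem eq_zero_of_mem_invariantLE {N : ℕ} {P : LaurentPoly 2} (hP : P ∈ invariantLE N)
    (h : ∀ i j : ℕ, j ≤ i → i + j ≤ N → P.coeff ![(i : ℤ), (j : ℤ)] = 0) : P = 0 := by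
  have h0 : ∀ i j : ℕ, j ≤ i → P.coeff ![(i : ℤ), (j : ℤ)] = 0 := fun i j hji => by
    by_cases hN : i + j ≤ N
    · exact h i j hji hN
    · exact hP.2 _ (by simp; omega)
  have h1 : ∀ i j : ℕ, P.coeff ![(i : ℤ), (j : ℤ)] = 0 := fun i j => by
    rcases le_total j i with hji | hij
    · exact h0 i j hji
    · rw [← hP.1 (Equiv.swap 0 1) 1, ← h0 j i hij]
      congr 1
      ext k; fin_cases k <;> simp
  have hsign : ∀ z : ℤ, ∃ e : ℤˣ, (e : ℤ) * z = z.natAbs := fun z => by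
    rcases le_total 0 z with hz | hz
    · exact ⟨1, by simp [abs_of_nonneg hz]⟩
    · exact ⟨-1, by simp [abs_of_nonpos hz]⟩
  ext mu
  choose e he using hsign
  rw [← hP.1 1 (fun i => e (mu i)) mu, AddMonoidAlgebra.coeff_zero, Finsupp.zero_apply,
    ← h1 (mu 0).natAbs (mu 1).natAbs]
  congr 1
  ext k; fin_cases k <;> exact he _

/-! ### `BC₂`-type interpolation Macdonald polynomials -/

/-- The nodes `b q^i + (b q^i)⁻¹`. -/
def bcNode (q b : ℂ) (i : ℕ) : ℂ := b * q ^ i + (b * q ^ i)⁻¹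

/-- The combination, with coefficients a and a⁻¹, of the node pairs built from q^i and from q^{-i}.
-/
theorem nodePair_bc {q t a : ℂ} (hq0 : q ≠ 0) (ht0 : t ≠ 0) :
    NodePair (fun k => 1 - q ^ k) (fun k => 1 - t * q ^ k) (fun k => 1 - t ^ 2 * q ^ k)
      (bcNode q a) (bcNode q (t * a)) := by
  have h := (nodePair_q q t).linear (nodePair_q_inv hq0 ht0) a a⁻¹
  have e1 : bcNode q a = fun i => a * q ^ i + a⁻¹ * (q ^ i)⁻¹ := by
    ext i; rw [bcNode, mul_inv]
  have e2 : bcNode q (t * a) = fun i => a * (t * q ^ i) + a⁻¹ * (t * q ^ i)⁻¹ := by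
    ext i; rw [bcNode]; simp only [mul_inv]; ring
  rw [e1, e2]
  exact h

/-- In the variables x + x⁻¹ the points q^μ t^δ a become pairs of BC nodes, so `interpSum_eq_zero`
gives the vanishing at every partition not containing λ. Uniqueness needs only the partitions of
weight at most |λ|. -/
theorem isBCInterpolationMacdonald_iff {q t : ℝ} {a : ℂ} (h0 : 0 < q) (h1 : q < 1) (ht0 : 0 < t)
    (ht1 : t < 1) (ha : a ≠ 0) {m₁ m₂ : ℕ} (hm : m₂ ≤ m₁)
    (hd : NodesDistinct (bcNode q a) (bcNode q (t * a)) (m₁ + m₂)) (P : LaurentPoly 2) :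
    IsBCInterpolationMacdonald q t a ![m₁, m₂] P ↔
      P = toLaurent (interpMv (qCoeff q t) (bcNode q a) (bcNode q (t * a)) m₁ m₂) := by
  have hR := recurrenceData_q (one_sub_pow_ne_zero h0 h1) (one_sub_mul_pow_ne_zero h0 h1 ht0 ht1)
  have hq0 : (q : ℂ) ≠ 0 := by exact_mod_cast h0.ne'
  have ht0' : (t : ℂ) ≠ 0 := by exact_mod_cast ht0.ne'
  have hn := nodePair_bc (a := a) hq0 ht0'
  have hx : ∀ (mu : Fin 2 → ℕ) (i : Fin 2), (q : ℂ) ^ mu i * (t : ℂ) ^ (2 - 1 - (i : ℕ)) * a ≠ 0 :=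
    fun mu i => mul_ne_zero (mul_ne_zero (pow_ne_zero _ hq0) (pow_ne_zero _ ht0')) ha
  have hev : ∀ (mu : Fin 2 → ℕ) (k l : ℕ),
      (toLaurent (interpMv (qCoeff q t) (bcNode q a) (bcNode q (t * a)) k l)).eval
        (fun i => (q : ℂ) ^ mu i * (t : ℂ) ^ (2 - 1 - (i : ℕ)) * a) =
      interpSum (qCoeff q t) (bcNode q a) (bcNode q (t * a)) k l (bcNode q (t * a) (mu 0))
        (bcNode q a (mu 1)) := by
    intro mu k l
    rw [eval_toLaurent (hx mu), eval_interpMv]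
    congr 1
    · simp [bcNode]; ring
    · simp [bcNode]; ring
  have hsum : ∑ i, ((![m₁, m₂] i : ℕ) : ℤ) = ((m₁ + m₂ : ℕ) : ℤ) := by simp
  have hlam : (fun i => ((![m₁, m₂] i : ℕ) : ℤ)) = ![(m₁ : ℤ), (m₂ : ℤ)] := by
    ext i; fin_cases i <;> rfl
  have hE1 : (toLaurent (interpMv (qCoeff q t) (bcNode q a) (bcNode q (t * a)) m₁ m₂)).coeff
      ![(m₁ : ℤ), (m₂ : ℤ)] = 1 := by
    rw [coeff_toLaurent_of_eq fun nu hnu => coeff_interpMv_eq_zero _ _ _ hm hnu,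
      coeff_interpMv_self hR hm]
  have hmem : ∀ P : LaurentPoly 2, (∀ mu ∈ P.coeff.support, ∑ i, mu i ≤ ((m₁ + m₂ : ℕ) : ℤ)) ↔
      ∀ mu : Fin 2 → ℤ, ((m₁ + m₂ : ℕ) : ℤ) < mu 0 + mu 1 → P.coeff mu = 0 := by
    intro P
    refine forall_congr' fun mu => ?_
    rw [Finsupp.mem_support_iff, Fin.sum_univ_two, ← not_lt, not_imp_not]
  rw [IsBCInterpolationMacdonald, hsum, hlam, hmem]
  constructor
  · rintro ⟨h2, h3, h4, h5⟩
    refine eq_of_interpolation hR hm hd (invariantLE (m₁ + m₂))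
      (fun i j => (Finsupp.lapply ![(i : ℤ), (j : ℤ)]).comp
        (AddMonoidAlgebra.coeffLinearEquiv ℂ).toLinearMap)
      (fun i j => (AddMonoidAlgebra.lift ℂ ℂ (Fin 2 → ℤ) (expEval (hx ![i, j]))).toLinearMap)
      (fun v hv h0 => eq_zero_of_mem_invariantLE hv h0)
      (fun i j => toLaurent (interpMv (qCoeff q t) (bcNode q a) (bcNode q (t * a)) i j))
      (fun i j hji hij => toLaurent_mem (interpMv_mem hR hn hji hij)) (fun i j k l => ?_) hE1
      ⟨h2, h3⟩ h4 fun i j hji hij hne => ?_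
    · have := hev ![i, j] k l
      rwa [LaurentPoly.eval_eq_lift (hx _)] at this
    · have := h5 ![i, j] (antitone_fin_two.mpr hji) fun h6 => hne ?_
      · rwa [LaurentPoly.eval_eq_lift (hx _)] at this
      · have h7 := h6 0
        have h8 := h6 1
        simp only [Matrix.cons_val_zero, Matrix.cons_val_one] at h7 h8
        exact Prod.ext (by simp; omega) (by simp; omega)
  · rintro rfl
    obtain ⟨h2, h3⟩ := toLaurent_mem (interpMv_mem hR hn hm le_rfl)
    refine ⟨h2, h3, hE1, fun mu hmu hnot => ?_⟩
    rw [hev]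
    refine interpSum_eq_zero _ _ _ (antitone_fin_two.mp hmu) fun h6 => hnot fun i => ?_
    fin_cases i
    · exact h6.2
    · exact h6.1

section

open Filter Topology

/-! ### The limit `q ↑ 1` -/

theorem tendsto_one_sub_cpow_div (c : ℂ) :
    Tendsto (fun q : ℝ => (1 - (q : ℂ) ^ c) / (1 - q)) (𝓝[<] 1) (𝓝 c) := by
  have h1 : HasDerivAt (fun q : ℝ => (q : ℂ) ^ c) c 1 := by
    have h2 : HasDerivAt (fun z : ℂ => z ^ c) (c * (1 : ℂ) ^ (c - 1)) ((1 : ℝ) : ℂ) := by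
      simpa using (hasDerivAt_id (1 : ℂ)).cpow_const (c := c) (Or.inl (by simp))
    simpa using h2.comp_ofReal
  have h3 := (hasDerivAt_iff_tendsto_slope.mp h1).mono_left
    (nhdsWithin_mono 1 fun q (hq : q < 1) => hq.ne)
  refine h3.congr fun q => ?_
  rw [slope_def_module, Complex.real_smul]
  simp only [Complex.ofReal_one, Complex.one_cpow]
  push_cast
  rw [← neg_sub (1 : ℂ) q, ← neg_sub (1 : ℂ) ((q : ℂ) ^ c), inv_neg, neg_mul_neg, div_eq_inv_mul]

theorem eventually_mem_Ioo_left : ∀ᶠ q : ℝ in 𝓝[<] 1, 0 < q ∧ q < 1 :=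
  (Ioo_mem_nhdsLT (zero_lt_one (α := ℝ)))

/-- The numerator is the square of q^{-x/2} - q^{x/2}, and this difference divided by 1 - q tends to
-x. -/
theorem tendsto_cpow_add_inv (x : ℂ) :
    Tendsto (fun q : ℝ => ((1 - (q : ℂ)) ^ 2)⁻¹ * ((q : ℂ) ^ x + ((q : ℂ) ^ x)⁻¹ - 2))
      (𝓝[<] 1) (𝓝 (x ^ 2)) := by
  have h := ((tendsto_one_sub_cpow_div (-(x / 2))).sub (tendsto_one_sub_cpow_div (x / 2))).pow 2
  rw [show (-(x / 2) - x / 2) ^ 2 = x ^ 2 by ring] at h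
  refine h.congr' ?_
  filter_upwards [eventually_mem_Ioo_left] with q hq
  have hq0 : (q : ℂ) ≠ 0 := by exact_mod_cast hq.1.ne'
  have h1 : (q : ℂ) ^ x = (q : ℂ) ^ (x / 2) * (q : ℂ) ^ (x / 2) := by
    rw [← Complex.cpow_add _ _ hq0]; ring_nf
  have h2 : (q : ℂ) ^ (x / 2) ≠ 0 := by simp [Complex.cpow_eq_zero_iff, hq0]
  rw [Complex.cpow_neg, h1, ← sub_div, div_pow, div_eq_inv_mul]
  congr 1
  field_simp
  ring

theorem tendsto_sub_node (x β : ℂ) :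
    Tendsto (fun q : ℝ => ((1 - (q : ℂ)) ^ 2)⁻¹ *
      ((q : ℂ) ^ x + ((q : ℂ) ^ x)⁻¹ - ((q : ℂ) ^ β + ((q : ℂ) ^ β)⁻¹)))
      (𝓝[<] 1) (𝓝 (x ^ 2 - β ^ 2)) :=
  ((tendsto_cpow_add_inv x).sub (tendsto_cpow_add_inv β)).congr fun q => by ring

theorem bcNode_cpow {q : ℝ} (hq : 0 < q) (β : ℂ) (i : ℕ) :
    bcNode q ((q : ℂ) ^ β) i = (q : ℂ) ^ (β + i) + ((q : ℂ) ^ (β + i))⁻¹ := by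
  have hq0 : (q : ℂ) ≠ 0 := by exact_mod_cast hq.ne'
  rw [bcNode, Complex.cpow_add _ _ hq0, Complex.cpow_natCast]

theorem ofReal_rpow_mul_cpow {q : ℝ} (hq : 0 < q) (τ : ℝ) (α : ℂ) :
    ((q ^ τ : ℝ) : ℂ) * (q : ℂ) ^ α = (q : ℂ) ^ ((τ : ℂ) + α) := by
  have hq0 : (q : ℂ) ≠ 0 := by exact_mod_cast hq.ne'
  rw [Complex.ofReal_cpow hq.le, Complex.cpow_add _ _ hq0]

theorem tendsto_qCoeff {τ : ℝ} (k : ℕ) :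
    Tendsto (fun q : ℝ => qCoeff q ((q ^ τ : ℝ) : ℂ) k) (𝓝[<] 1) (𝓝 (jackCoeff τ k)) := by
  have h1 : jackCoeff τ k = ∏ i ∈ range k, ((τ : ℂ) + i) / (1 + i) := by
    rw [jackCoeff, shiftedFactorial, prod_div_distrib, ← prod_range_add_one_eq_factorial]
    push_cast
    congr 1
    exact prod_congr rfl fun i _ => add_comm _ _
  rw [h1]
  have h2 := tendsto_finsetProd (range k) fun i _ =>
    (tendsto_one_sub_cpow_div ((τ : ℂ) + i)).div (tendsto_one_sub_cpow_div (1 + (i : ℂ)))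
      (by exact_mod_cast (by omega : 1 + i ≠ 0))
  refine h2.congr' ?_
  filter_upwards [eventually_mem_Ioo_left] with q hq
  have hq0 : (q : ℂ) ≠ 0 := by exact_mod_cast hq.1.ne'
  have hq1 : 1 - (q : ℂ) ≠ 0 := by simpa using one_sub_pow_ne_zero hq.1 hq.2 0
  rw [qCoeff, qShiftedFactorial, qShiftedFactorial, ← prod_div_distrib]
  refine prod_congr rfl fun i _ => ?_
  simp only [Pi.div_apply]
  rw [div_div_div_cancel_right₀ hq1, Complex.cpow_add _ _ hq0, Complex.cpow_add _ _ hq0,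
    Complex.cpow_natCast, Complex.cpow_one, Complex.ofReal_cpow hq.1.le]

/-- `interpSum` is homogeneous of degree m₁ + m₂ in the differences between variables and nodes, so
the factor (1-q)^{-2|λ|} can be shared out as (1-q)^{-2} for each difference. -/
theorem mul_interpSum (w : ℂ) (g r s : ℕ → ℂ) {m₁ m₂ : ℕ} (hm : m₂ ≤ m₁) (X Y : ℂ) :
    w ^ (m₁ + m₂) * interpSum g r s m₁ m₂ X Y =
      (g (m₁ - m₂))⁻¹ * ((∏ i ∈ range m₂, w * (X - r i)) * (∏ i ∈ range m₂, w * (Y - r i)) *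
        ∑ j ∈ range (m₁ - m₂ + 1), g j * g (m₁ - m₂ - j) *
          ((∏ i ∈ Ico j (m₁ - m₂), w * (X - s (i + m₂))) *
            ∏ l ∈ range j, w * (Y - r (l + m₂)))) := by
  simp only [interpSum, newtonSum, prod_mul_distrib, prod_const, card_range, Nat.card_Ico,
    Algebra.algebraMap_self, RingHom.id_apply, mul_sum]
  refine sum_congr rfl fun j hj => ?_
  have hj' : j ≤ m₁ - m₂ := by have := mem_range.mp hj; omega
  have h1 : w ^ (m₁ + m₂) = w ^ m₂ * w ^ m₂ * (w ^ (m₁ - m₂ - j) * w ^ j) := by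
    rw [← pow_add, ← pow_add, ← pow_add]; congr 1; omega
  rw [h1]
  ring

theorem tendsto_interpSum {τ : ℝ} (hτ : 0 < τ) (α : ℂ) {m₁ m₂ : ℕ} (hm : m₂ ≤ m₁) (x y : ℂ) :
    Tendsto (fun q : ℝ => ((1 - (q : ℂ)) ^ (2 * (m₁ + m₂)))⁻¹ *
      interpSum (qCoeff q ((q ^ τ : ℝ) : ℂ)) (bcNode q ((q : ℂ) ^ α))
        (bcNode q (((q ^ τ : ℝ) : ℂ) * (q : ℂ) ^ α)) m₁ m₂
        ((q : ℂ) ^ x + ((q : ℂ) ^ x)⁻¹) ((q : ℂ) ^ y + ((q : ℂ) ^ y)⁻¹)) (𝓝[<] 1)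
      (𝓝 (interpSum (jackCoeff τ) (fun i => (α + i) ^ 2) (fun i => ((τ : ℂ) + α + i) ^ 2) m₁ m₂
        (x ^ 2) (y ^ 2))) := by
  have hg := (recurrenceData_jack (ofReal_add_natCast_ne_zero hτ)).g_ne (m₁ - m₂)
  have h1 := mul_interpSum 1 (jackCoeff τ) (fun i => (α + i) ^ 2) (fun i => ((τ : ℂ) + α + i) ^ 2)
    hm (x ^ 2) (y ^ 2)
  simp only [one_pow, one_mul] at h1
  rw [h1]
  have h2 := ((tendsto_qCoeff (τ := τ) (m₁ - m₂)).inv₀ hg).mul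
    (((tendsto_finsetProd (range m₂) fun i _ => tendsto_sub_node x (α + i)).mul
      (tendsto_finsetProd (range m₂) fun i _ => tendsto_sub_node y (α + i))).mul
      (tendsto_finsetSum (range (m₁ - m₂ + 1)) fun j _ =>
        ((tendsto_qCoeff (τ := τ) j).mul (tendsto_qCoeff (τ := τ) (m₁ - m₂ - j))).mul
          ((tendsto_finsetProd (Ico j (m₁ - m₂)) fun i _ =>
            tendsto_sub_node x ((τ : ℂ) + α + (i + m₂ : ℕ))).mul
            (tendsto_finsetProd (range j) fun i _ => tendsto_sub_node y (α + (i + m₂ : ℕ))))))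
  refine h2.congr' ?_
  filter_upwards [eventually_mem_Ioo_left] with q hq
  rw [pow_mul, ← inv_pow ((1 - (q : ℂ)) ^ 2), mul_interpSum _ _ _ _ hm]
  simp only [ofReal_rpow_mul_cpow hq.1, bcNode_cpow hq.1]

/-- Two nodes with exponents β and γ differ, after scaling by (1-q)^{-2}, by a quantity tending to
β² - γ²; so it suffices that the finitely many limits be nonzero. -/
theorem eventually_nodesDistinct {τ : ℝ} (hτ : 0 < τ) {α : ℂ}
    (hα : ∀ i j : ℕ, 0 < i → (i : ℂ) + (j : ℂ) * (τ : ℂ) + 2 * α ≠ 0) (N : ℕ) :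
    ∀ᶠ q : ℝ in 𝓝[<] 1, NodesDistinct (bcNode q ((q : ℂ) ^ α))
      (bcNode q (((q ^ τ : ℝ) : ℂ) * (q : ℂ) ^ α)) N := by
  have key : ∀ β γ : ℂ, β ^ 2 - γ ^ 2 ≠ 0 → ∀ᶠ q : ℝ in 𝓝[<] 1,
      (q : ℂ) ^ β + ((q : ℂ) ^ β)⁻¹ ≠ (q : ℂ) ^ γ + ((q : ℂ) ^ γ)⁻¹ := fun β γ h => by
    filter_upwards [(tendsto_sub_node β γ).eventually_ne h] with q hq h2
    exact hq (by rw [h2, sub_self, mul_zero])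
  have h1 : ∀ i ∈ range (N + 1), ∀ j ∈ range i, ∀ᶠ q : ℝ in 𝓝[<] 1,
      bcNode q (((q ^ τ : ℝ) : ℂ) * (q : ℂ) ^ α) i ≠ bcNode q (((q ^ τ : ℝ) : ℂ) * (q : ℂ) ^ α) j ∧
      bcNode q (((q ^ τ : ℝ) : ℂ) * (q : ℂ) ^ α) i ≠ bcNode q ((q : ℂ) ^ α) j ∧
      bcNode q ((q : ℂ) ^ α) i ≠ bcNode q ((q : ℂ) ^ α) j := by
    intro i _ j hj
    have hji := mem_range.mp hj
    have hij : (i : ℂ) - j ≠ 0 := sub_ne_zero.mpr (by exact_mod_cast hji.ne')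
    have hτij : (τ : ℂ) + i - j ≠ 0 := by
      have : (j : ℝ) < i := by exact_mod_cast hji
      exact_mod_cast (by linarith : 0 < τ + i - j).ne'
    -- Each β² - γ² factors as (β - γ)(β + γ), and β + γ = i + j + cτ + 2α with c = 0, 1, 2 for the
    -- three kinds of pairs; i + j > 0 because j < i.
    have e0 := hα (i + j) 0 (by omega)
    have e1 := hα (i + j) 1 (by omega)
    have e2 := hα (i + j) 2 (by omega)
    push_cast at e0 e1 e2
    filter_upwards [eventually_mem_Ioo_left,
      key (τ + α + i) (τ + α + j) (fun h => mul_ne_zero hij e2 (by linear_combination h)),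
      key (τ + α + i) (α + j) (fun h => mul_ne_zero hτij e1 (by linear_combination h)),
      key (α + i) (α + j) (fun h => mul_ne_zero hij e0 (by linear_combination h))]
      with q hq k1 k2 k3
    simp only [ofReal_rpow_mul_cpow hq.1, bcNode_cpow hq.1]
    exact ⟨k1, k2, k3⟩
  have h2 : ∀ i ∈ range (N + 1), ∀ᶠ q : ℝ in 𝓝[<] 1, ∀ j ∈ range i, _ := fun i hi =>
    (eventually_all_finset _).mpr (h1 i hi)
  filter_upwards [(eventually_all_finset _).mpr h2] with q hq i hi j hj
  exact hq i (mem_range.mpr (by omega)) j (mem_range.mpr hj)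

theorem eventually_isBCInterpolationMacdonald_iff {τ : ℝ} (hτ : 0 < τ) {α : ℂ}
    (hα : ∀ i j : ℕ, 0 < i → (i : ℂ) + (j : ℂ) * (τ : ℂ) + 2 * α ≠ 0) {m₁ m₂ : ℕ} (hm : m₂ ≤ m₁) :
    ∀ᶠ q : ℝ in 𝓝[<] 1, ∀ P : LaurentPoly 2,
      IsBCInterpolationMacdonald q (q ^ τ) ((q : ℂ) ^ α) ![m₁, m₂] P ↔
        P = toLaurent (interpMv (qCoeff q ((q ^ τ : ℝ) : ℂ)) (bcNode q ((q : ℂ) ^ α))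
          (bcNode q (((q ^ τ : ℝ) : ℂ) * (q : ℂ) ^ α)) m₁ m₂) := by
  filter_upwards [eventually_mem_Ioo_left, eventually_nodesDistinct hτ hα (m₁ + m₂)] with q hq hd P
  have hq0 : (q : ℂ) ≠ 0 := by exact_mod_cast hq.1.ne'
  exact isBCInterpolationMacdonald_iff hq.1 hq.2 (Real.rpow_pos_of_pos hq.1 τ)
    (Real.rpow_lt_one hq.1.le hq.2 hτ) (by simp [Complex.cpow_eq_zero_iff, hq0]) hm hd P

/-! ### `BC₂`-type interpolation Jack polynomials -/

/-- The `BC₂`-type interpolation Jack polynomial. -/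
def bcJackMv (τ : ℝ) (α : ℂ) (m₁ m₂ : ℕ) : MvPolynomial (Fin 2) ℂ :=
  interpSum (jackCoeff τ) (fun i => (α + i) ^ 2) (fun i => ((τ : ℂ) + α + i) ^ 2) m₁ m₂
    (MvPolynomial.X 0 ^ 2) (MvPolynomial.X 1 ^ 2)

theorem eval_bcJackMv (τ : ℝ) (α : ℂ) (m₁ m₂ : ℕ) (x : Fin 2 → ℂ) :
    MvPolynomial.eval x (bcJackMv τ α m₁ m₂) = interpSum (jackCoeff τ) (fun i => (α + i) ^ 2)
      (fun i => ((τ : ℂ) + α + i) ^ 2) m₁ m₂ (x 0 ^ 2) (x 1 ^ 2) := by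
  have := map_interpSum (MvPolynomial.aeval x) (jackCoeff τ) (fun i => (α + i) ^ 2)
    (fun i => ((τ : ℂ) + α + i) ^ 2) m₁ m₂ (MvPolynomial.X 0 ^ 2) (MvPolynomial.X 1 ^ 2)
  simpa [bcJackMv, MvPolynomial.aeval_eq_eval] using this

/-- For q near 1 the Laurent polynomial in the definition is forced, so its rescaled limit is the
explicit one at every point; a polynomial is determined by its values. -/
theorem isBCInterpolationJack_iff {τ : ℝ} (hτ : 0 < τ) {α : ℂ}
    (hα : ∀ i j : ℕ, 0 < i → (i : ℂ) + (j : ℂ) * (τ : ℂ) + 2 * α ≠ 0) {m₁ m₂ : ℕ} (hm : m₂ ≤ m₁)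
    (F : MvPolynomial (Fin 2) ℂ) :
    IsBCInterpolationJack τ α ![m₁, m₂] F ↔ F = bcJackMv τ α m₁ m₂ := by
  have hev := eventually_isBCInterpolationMacdonald_iff hτ hα hm
  have hsum : ∑ i, ![m₁, m₂] i = m₁ + m₂ := by simp
  have hlim : ∀ x : Fin 2 → ℂ, Tendsto (fun q : ℝ => ((1 - (q : ℂ)) ^ (2 * (m₁ + m₂)))⁻¹ *
      (toLaurent (interpMv (qCoeff q ((q ^ τ : ℝ) : ℂ)) (bcNode q ((q : ℂ) ^ α))
        (bcNode q (((q ^ τ : ℝ) : ℂ) * (q : ℂ) ^ α)) m₁ m₂)).eval (fun i => (q : ℂ) ^ x i))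
      (𝓝[<] 1) (𝓝 (MvPolynomial.eval x (bcJackMv τ α m₁ m₂))) := by
    intro x
    rw [eval_bcJackMv]
    refine (tendsto_interpSum hτ α hm (x 0) (x 1)).congr' ?_
    filter_upwards [eventually_mem_Ioo_left] with q hq
    have hq0 : (q : ℂ) ≠ 0 := by exact_mod_cast hq.1.ne'
    rw [eval_toLaurent (fun i => by simp [Complex.cpow_eq_zero_iff, hq0]), eval_interpMv]
  constructor
  · rintro ⟨P, h1, h2⟩
    refine MvPolynomial.funext fun x => tendsto_nhds_unique (h2 x) ?_
    rw [hsum]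
    refine (hlim x).congr' ?_
    filter_upwards [hev, h1] with q hq hP
    rw [(hq _).mp hP]
  · rintro rfl
    refine ⟨_, hev.mono fun q hq => (hq _).mpr rfl, fun x => ?_⟩
    rw [hsum]
    exact hlim x

/-- The factorization x² - (a+i)² = -(a+i+x)(a+i-x) turns each Newton product into a pair of shifted
factorials; in the quotients the signs cancel. -/
theorem interpSum_bcJack_eq {τ : ℝ} (hτ : 0 < τ) (α : ℂ) {m₁ m₂ : ℕ} (hm : m₂ ≤ m₁) {x₁ x₂ : ℂ}
    (hx : ∀ j : ℕ, j < m₁ - m₂ → (m₂ : ℂ) + τ + α + x₁ + j ≠ 0 ∧ (m₂ : ℂ) + τ + α - x₁ + j ≠ 0) :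
    interpSum (jackCoeff τ) (fun i => (α + i) ^ 2) (fun i => ((τ : ℂ) + α + i) ^ 2) m₁ m₂
        (x₁ ^ 2) (x₂ ^ 2) =
      (-1) ^ (m₁ + m₂) *
        (shiftedFactorial (α + x₁) m₂ * shiftedFactorial (α - x₁) m₂ *
          shiftedFactorial (α + x₂) m₂ * shiftedFactorial (α - x₂) m₂) *
        (shiftedFactorial (m₂ + τ + α + x₁) (m₁ - m₂) *
          shiftedFactorial (m₂ + τ + α - x₁) (m₁ - m₂)) *
        hyp (m₁ - m₂) [(τ : ℂ), m₂ + α + x₂, m₂ + α - x₂]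
          [1 - (m₁ : ℂ) + m₂ - τ, m₂ + τ + α + x₁, m₂ + τ + α - x₁] 1 := by
  have hs : ∀ (a x : ℂ) (n : ℕ), shiftedFactorial (a + x) n * shiftedFactorial (a - x) n =
      (-1) ^ n * ∏ i ∈ range n, (x ^ 2 - (a + i) ^ 2) := by
    intro a x n
    rw [shiftedFactorial, shiftedFactorial, ← prod_mul_distrib]
    conv_rhs => rw [← card_range n, ← prod_const, card_range, ← prod_mul_distrib]
    exact prod_congr rfl fun i _ => by ring
  have e1 : ∀ (a x : ℂ) (n : ℕ), ∏ i ∈ range n, (x ^ 2 - (a + ((i + m₂ : ℕ) : ℂ)) ^ 2) =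
      (-1) ^ n * (shiftedFactorial (m₂ + a + x) n * shiftedFactorial (m₂ + a - x) n) := by
    intro a x n
    rw [hs, ← mul_assoc, ← mul_pow, neg_one_mul, neg_neg, one_pow, one_mul]
    refine prod_congr rfl fun i _ => ?_
    push_cast
    ring
  have e2 : ∀ (a x : ℂ) (n : ℕ), ∏ i ∈ range n, (x ^ 2 - (a + i) ^ 2) =
      (-1) ^ n * (shiftedFactorial (a + x) n * shiftedFactorial (a - x) n) := by
    intro a x n
    rw [hs, ← mul_assoc, ← mul_pow, neg_one_mul, neg_neg, one_pow, one_mul]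
  have hx' : ∀ j < m₁ - m₂, x₁ ^ 2 ≠ ((τ : ℂ) + α + ((j + m₂ : ℕ) : ℂ)) ^ 2 := by
    intro j hj h
    obtain ⟨h1, h2⟩ := hx j hj
    refine mul_ne_zero h1 h2 ?_
    push_cast at h
    linear_combination -h
  rw [interpSum_eq_second _ _ _ _ _ hx',
    show 1 - (m₁ : ℂ) + m₂ - τ = 1 - ((m₁ - m₂ : ℕ) : ℂ) - τ by push_cast [hm]; ring,
    hyp_eq (ofReal_add_natCast_ne_zero hτ)]
  simp only [e1, e2, List.map_cons, List.map_nil, List.prod_cons, List.prod_nil, mul_one, one_pow]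
  have hsign : ∀ k : ℕ, ((-1 : ℂ)) ^ k ≠ 0 := fun k => pow_ne_zero k (by norm_num)
  simp only [mul_div_mul_left _ _ (hsign _), ← add_assoc]
  have h3 : (-1 : ℂ) ^ (m₁ + m₂) = (-1) ^ m₂ * (-1) ^ m₂ * (-1) ^ (m₁ - m₂) := by
    rw [← pow_add, ← pow_add]; congr 1; omega
  rw [h3]
  ring

end

/-! ### Orthogonality of the coefficient sequences against a sequence of moments -/

/-- `∑ g j g (m - j) w (k - j)`. -/
def momentSum (g : ℕ → ℂ) (w : ℤ → ℂ) (m : ℕ) (k : ℤ) : ℂ :=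
  ∑ j ∈ range (m + 1), g j * g (m - j) * w (k - j)

/-- The three-term recurrence paired with a monomial: multiplication by one of the two variables
shifts the moment index k by one. -/
theorem momentSum_recurrence {p b d g : ℕ → ℂ} (h : RecurrenceData p b d g) (w : ℤ → ℂ) (m : ℕ)
    (k : ℤ) : p (m + 2) * momentSum g w (m + 2) k =
      b (m + 1) * (momentSum g w (m + 1) k + momentSum g w (m + 1) (k - 1)) -
        d m * momentSum g w m (k - 1) := by
  have e1 : momentSum g w (m + 2) k = g 0 * g (m + 2) * w k +
      ∑ i ∈ range (m + 1), g (i + 1) * g (m - i + 1) * w (k - 1 - i) +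
        g (m + 2) * g 0 * w (k - 1 - (m + 1 : ℕ)) := by
    rw [momentSum, sum_range_succ, sum_range_succ', add_comm (∑ _ ∈ _, _)]
    refine congrArg₂ _ (congrArg₂ _ (by simp) (sum_congr rfl fun i hi => ?_)) ?_
    · have := mem_range.mp hi
      rw [show m + 2 - (i + 1) = m - i + 1 by omega]
      congr 2; push_cast; ring
    · rw [Nat.sub_self]; congr 2; push_cast; ring
  have e2 : momentSum g w (m + 1) k = g 0 * g (m + 1) * w k +
      ∑ i ∈ range (m + 1), g (i + 1) * g (m - i) * w (k - 1 - i) := by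
    rw [momentSum, sum_range_succ', add_comm]
    refine congrArg₂ _ (by simp) (sum_congr rfl fun i hi => ?_)
    rw [show m + 1 - (i + 1) = m - i by omega]
    congr 2; push_cast; ring
  have e3 : momentSum g w (m + 1) (k - 1) =
      ∑ i ∈ range (m + 1), g i * g (m - i + 1) * w (k - 1 - i) +
        g (m + 1) * g 0 * w (k - 1 - (m + 1 : ℕ)) := by
    rw [momentSum, sum_range_succ]
    refine congrArg₂ _ (sum_congr rfl fun i hi => ?_) (by simp)
    have := mem_range.mp hi
    rw [show m + 1 - i = m - i + 1 by omega]
  have e4 : p (m + 2) * ∑ i ∈ range (m + 1), g (i + 1) * g (m - i + 1) * w (k - 1 - i) =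
      b (m + 1) * (∑ i ∈ range (m + 1), g (i + 1) * g (m - i) * w (k - 1 - i) +
        ∑ i ∈ range (m + 1), g i * g (m - i + 1) * w (k - 1 - i)) -
        d m * momentSum g w m (k - 1) := by
    rw [momentSum, ← sum_add_distrib, mul_sum, mul_sum, mul_sum, ← sum_sub_distrib]
    refine sum_congr rfl fun i hi => ?_
    have hi' := mem_range.mp hi
    have := h.g_mul i (m - i)
    rw [show i + (m - i) = m by omega] at this
    linear_combination w (k - 1 - i) * this
  have hp := h.g_succ (m + 1)
  rw [e1, e2, e3]
  linear_combination e4 + (g 0 * w k + g 0 * w (k - 1 - (m + 1 : ℕ))) * hp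

theorem momentSum_reflect (g : ℕ → ℂ) {w : ℤ → ℂ} (hw : ∀ k, w (-k) = w k) (m : ℕ) (k : ℤ) :
    momentSum g w m (m - k) = momentSum g w m k := by
  rw [momentSum, ← sum_range_reflect]
  refine sum_congr rfl fun j hj => ?_
  have hj' : j ≤ m := by have := mem_range.mp hj; omega
  rw [show m + 1 - 1 - j = m - j by omega, Nat.sub_sub_self hj', ← hw]
  push_cast [hj']
  rw [show -((m : ℤ) - k - (m - j)) = k - j by ring]
  ring

/-- The moments `w` are even, do not vanish identically, and satisfy the norm recurrence. -/
structure IsMomentSeq (b d g : ℕ → ℂ) (w : ℤ → ℂ) : Prop where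
  even : ∀ k, w (-k) = w k
  ne : w 0 ≠ 0
  base : 2 * b 1 * momentSum g w 1 0 = d 0 * momentSum g w 0 0
  step : ∀ m, b (m + 2) * momentSum g w (m + 2) 0 = d (m + 1) * momentSum g w (m + 1) 0

/-- Write S_m(k) for the sum. For 1 < k < m - 1 all three terms of the recurrence vanish by
induction. The case k = m - 1 reflects to k = 1, and there the two surviving terms at index 0 cancel
by the relation between consecutive S_m(0). -/
theorem IsMomentSeq.momentSum_eq_zero {p b d g : ℕ → ℂ} {w : ℤ → ℂ} (hw : IsMomentSeq b d g w)
    (h : RecurrenceData p b d g) (m : ℕ) : ∀ k : ℕ, 0 < k → k < m → momentSum g w m k = 0 := by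
  have hs : ∀ m : ℕ, momentSum g w m m = momentSum g w m 0 := fun m => by
    rw [← momentSum_reflect g hw.even, sub_self]
  induction m using Nat.strong_induction_on with
  | _ m ih =>
    have h1 : 1 < m → momentSum g w m 1 = 0 := by
      intro hm
      obtain ⟨n, rfl⟩ : ∃ n, m = n + 2 := ⟨m - 2, by omega⟩
      refine mul_left_cancel₀ (h.p_ne (n + 1)) ?_
      rw [momentSum_recurrence h, sub_self, mul_zero]
      match n, ih with
      -- Here S_1(1) is not zero by induction but equal to S_1(0) by reflection, which explains the
      -- factor 2 in `base`.
      | 0, _ =>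
        have := hs 1
        push_cast at this
        rw [zero_add, this]
        linear_combination hw.base
      | n + 1, ih =>
        have := ih (n + 1 + 1) (by omega) 1 (by omega) (by omega)
        push_cast at this
        rw [this]
        linear_combination hw.step n
    intro k hk0 hkm
    obtain ⟨n, rfl⟩ : ∃ n, m = n + 2 := ⟨m - 2, by omega⟩
    rcases Nat.lt_or_ge 1 k with hk | hk
    · rcases Nat.lt_or_ge k (n + 1) with hkn | hkn
      · refine mul_left_cancel₀ (h.p_ne (n + 1)) ?_
        have e1 := ih (n + 1) (by omega) k hk0 hkn
        have e2 := ih (n + 1) (by omega) (k - 1) (by omega) (by omega)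
        have e3 := ih n (by omega) (k - 1) (by omega) (by omega)
        push_cast [Nat.cast_sub hk0] at e2 e3
        rw [momentSum_recurrence h, e1, e2, e3]
        ring
      · rw [← momentSum_reflect g hw.even, show ((n + 2 : ℕ) : ℤ) - k = 1 by push_cast; omega]
        exact h1 (by omega)
    · rw [show k = 1 by omega]
      exact_mod_cast h1 (by omega)

theorem IsMomentSeq.momentSum_ne_zero {p b d g : ℕ → ℂ} {w : ℤ → ℂ} (hw : IsMomentSeq b d g w)
    (h : RecurrenceData p b d g) (hd : ∀ k, d k ≠ 0) (m : ℕ) : momentSum g w m 0 ≠ 0 := by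
  induction m with
  | zero => simpa [momentSum, h.g_zero] using hw.ne
  | succ m ih =>
    intro h0
    match m, ih with
    | 0, ih =>
      have := hw.base
      rw [zero_add] at h0
      rw [h0, mul_zero] at this
      exact mul_ne_zero (hd 0) ih this.symm
    | m + 1, ih =>
      have := hw.step m
      rw [h0, mul_zero] at this
      exact mul_ne_zero (hd _) ih this.symm

/-- The relation `step` compares two terminating sums whose summands are hypergeometric in j; their
difference is summed in closed form. -/
theorem isMomentSeq_jack {τ : ℂ} (hτ : ∀ k : ℕ, τ + k ≠ 0) {w : ℤ → ℂ} (heven : ∀ k, w (-k) = w k)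
    (h0 : w 0 ≠ 0) (hrec : ∀ j : ℕ, (j + 1 + τ) * w (j + 1 : ℕ) = (j - τ) * w j) :
    IsMomentSeq (fun k => τ + k) (fun k => 2 * τ + k) (jackCoeff τ) w where
  even := heven
  ne := h0
  base := by
    have h := recurrenceData_jack hτ
    have h1 := h.g_succ 0
    have h2 := hrec 0
    have h3 := heven 1
    simp only [momentSum, sum_range_succ, sum_range_zero, h.g_zero]
    norm_num [h.g_zero] at h1 h2 h3 ⊢
    rw [h1, h3]
    linear_combination 2 * τ * h2
  step m := by
    have h := recurrenceData_jack hτ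
    set g := jackCoeff τ
    -- The right side is a telescoping certificate: a rational multiple of the summand whose
    -- increments are the terms on the left. At n = m + 2 its third factor becomes (m + 1)τ, so the
    -- right side is the prefactor in absolute value times the term j = m + 2 of `momentSum` of
    -- order m + 2, which the partial sum omits.
    have key : ∀ n ≤ m + 2, -((m + 2) * τ * (m + 1)) * ∑ j ∈ range n,
        ((τ + (m + 2)) * (g j * g (m + 2 - j) * w j) -
          (2 * τ + (m + 1)) * (g j * g (m + 1 - j) * w j)) =
        n * (n + τ) * (n + (m + 2) * τ - (m + 2) - τ) * (g n * g (m + 2 - n) * w n) := by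
      intro n
      induction n with
      | zero => simp
      | succ n ih =>
        intro hn
        obtain ⟨l, hl⟩ : ∃ l, m + 1 = n + l := ⟨m + 1 - n, by omega⟩
        have hm' : (m : ℂ) = n + l - 1 := by
          have : (m : ℂ) + 1 = n + l := by exact_mod_cast hl
          linear_combination this
        rw [sum_range_succ, mul_add, ih (by omega), show m + 2 - n = l + 1 by omega,
          show m + 2 - (n + 1) = l by omega, show m + 1 - n = l by omega, h.g_succ_eq, h.g_succ_eq,
          hm']
        have h1 : ((l + 1 : ℕ) : ℂ) ≠ 0 := h.p_ne l
        have h2 : ((n + 1 : ℕ) : ℂ) ≠ 0 := h.p_ne n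
        have h3 := hrec n
        have h4 : (n : ℂ) + 1 + τ ≠ 0 := by
          have := hτ (n + 1)
          push_cast at this
          rwa [add_comm] at this
        have h5 : w (n + 1 : ℕ) = (n - τ) * w n / (n + 1 + τ) := by
          rw [eq_div_iff h4, ← h3]; ring
        rw [h5]
        push_cast at h1 h2 ⊢
        field_simp
        ring
    have k1 := key (m + 2) le_rfl
    have e1 : momentSum g w (m + 2) 0 = ∑ j ∈ range (m + 2), g j * g (m + 2 - j) * w j +
        g (m + 2) * w (m + 2 : ℕ) := by
      rw [momentSum, sum_range_succ]
      simp only [zero_sub, heven, Nat.sub_self, h.g_zero, mul_one]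
    have e2 : momentSum g w (m + 1) 0 = ∑ j ∈ range (m + 2), g j * g (m + 1 - j) * w j := by
      simp [momentSum, heven]
    have h6 : ((m : ℂ) + 2) * τ * (m + 1) ≠ 0 := by
      have := hτ 0
      simp only [Nat.cast_zero, add_zero] at this
      exact mul_ne_zero (mul_ne_zero (by exact_mod_cast (m + 1).succ_ne_zero) this)
        (by exact_mod_cast m.succ_ne_zero)
    rw [sum_sub_distrib, ← mul_sum, ← mul_sum, ← e2, Nat.sub_self, h.g_zero] at k1
    refine mul_left_cancel₀ h6 ?_
    rw [e1]
    push_cast at k1 ⊢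
    linear_combination -k1

/-- The q-analogue of the same telescoping. The condition 1 + q^k ≠ 0 enters because the recurrence
for w, and hence the certificate, has these factors in its denominators. -/
theorem isMomentSeq_q {q t : ℂ} (hq0 : q ≠ 0) (hq : ∀ k : ℕ, 1 - q ^ (k + 1) ≠ 0)
    (hq' : ∀ k : ℕ, 1 + q ^ k ≠ 0) (ht : ∀ k : ℕ, 1 - t * q ^ k ≠ 0) {w : ℤ → ℂ}
    (heven : ∀ k, w (-k) = w k) (h0 : w 0 ≠ 0)
    (hrec : ∀ j : ℕ, w (j + 1 : ℕ) * (1 - t * q ^ (j + 1)) * (1 + q ^ j) =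
      w j * (t - q ^ j) * (1 + q ^ (j + 1))) :
    IsMomentSeq (fun k => 1 - t * q ^ k) (fun k => 1 - t ^ 2 * q ^ k) (qCoeff q t) w where
  even := heven
  ne := h0
  base := by
    have h := recurrenceData_q hq ht
    have h1 := h.g_succ 0
    have h2 := hrec 0
    have h3 := heven 1
    have h4 := hq 0
    simp only [momentSum, sum_range_succ, sum_range_zero, h.g_zero]
    norm_num [h.g_zero] at h1 h2 h3 h4 ⊢
    rw [h3]
    refine mul_left_cancel₀ h4 ?_
    linear_combination 2 * (1 - t * q) * (w 0 + w 1) * h1 + (1 - t) * h2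
  step m := by
    have h := recurrenceData_q hq ht
    set g := qCoeff q t
    -- Telescoping certificate: its value at n = 0 is zero because of the factor 1 - q^n, and its
    -- increments reproduce the summand by the recurrences for g and w.
    have key : ∀ n ≤ m + 2, (1 - t) * (q ^ (m + 2) - 1) * (q ^ (m + 2) - q) * ∑ j ∈ range n,
        ((1 - t * q ^ (m + 2)) * (g j * g (m + 2 - j) * w j) -
          (1 - t ^ 2 * q ^ (m + 1)) * (g j * g (m + 1 - j) * w j)) =
        (1 - q ^ n) * (1 - t * q ^ n) / (1 + q ^ n) * q ^ (m + 2) *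
          ((q * t + q * q ^ (m + 2) - q - 2 * t * q ^ (m + 2) + q * t * q ^ (m + 2)) / q ^ n +
            (t + q ^ (m + 2) + 1 - 2 * q - t * q ^ (m + 2))) * (g n * g (m + 2 - n) * w n) := by
      intro n
      induction n with
      | zero => simp
      | succ n ih =>
        intro hn
        obtain ⟨l, hl⟩ : ∃ l, m + 1 = n + l := ⟨m + 1 - n, by omega⟩
        rw [sum_range_succ, mul_add, ih (by omega), show m + 2 - n = l + 1 by omega,
          show m + 2 - (n + 1) = l by omega, show m + 1 - n = l by omega, h.g_succ_eq, h.g_succ_eq,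
          show m + 2 = n + l + 1 by omega, hl]
        have h1 := hq l
        have h2 := hq n
        have h3 := hrec n
        have h4 := ht (n + 1)
        have h6 := hq' n
        have h7 := hq' (n + 1)
        have h5 : w (n + 1 : ℕ) = w n * (t - q ^ n) * (1 + q ^ (n + 1)) /
            ((1 - t * q ^ (n + 1)) * (1 + q ^ n)) := by
          rw [eq_div_iff (mul_ne_zero h4 h6), ← h3]; ring
        rw [h5]
        have h8 := pow_ne_zero n hq0
        simp only [pow_add, pow_one] at h1 h2 h4 h7 ⊢
        generalize q ^ n = u at *
        generalize q ^ l = v at *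
        have h4' : 1 - u * t * q ≠ 0 := by convert h4 using 2; ring
        have h4'' : 1 - t * u * q ≠ 0 := by convert h4 using 2; ring
        field_simp
        ring
    have k1 := key (m + 2) le_rfl
    have e1 : momentSum g w (m + 2) 0 = ∑ j ∈ range (m + 2), g j * g (m + 2 - j) * w j +
        g (m + 2) * w (m + 2 : ℕ) := by
      rw [momentSum, sum_range_succ]
      simp only [zero_sub, heven, Nat.sub_self, h.g_zero, mul_one]
    have e2 : momentSum g w (m + 1) 0 = ∑ j ∈ range (m + 2), g j * g (m + 1 - j) * w j := by
      simp [momentSum, heven]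
    have hN1 : q ^ (m + 2) - 1 ≠ 0 := fun h5 => hq (m + 1) (by linear_combination -h5)
    have hN2 : q ^ (m + 2) - q ≠ 0 := fun h5 =>
      mul_ne_zero hq0 (hq m) (by linear_combination -h5)
    have ht1 : 1 - t ≠ 0 := by simpa using ht 0
    have hN3 := hq' (m + 2)
    have hN4 := pow_ne_zero (m + 2) hq0
    rw [sum_sub_distrib, ← mul_sum, ← mul_sum, ← e2, Nat.sub_self, h.g_zero] at k1
    refine mul_left_cancel₀ (mul_ne_zero (mul_ne_zero ht1 hN1) hN2) ?_
    rw [e1]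
    -- At n = m + 2 the certificate collapses to minus the prefactor times 1 - t q^{m+2}, so that it
    -- supplies the omitted term j = m + 2.
    have k2 : (1 - q ^ (m + 2)) * (1 - t * q ^ (m + 2)) / (1 + q ^ (m + 2)) * q ^ (m + 2) *
          ((q * t + q * q ^ (m + 2) - q - 2 * t * q ^ (m + 2) + q * t * q ^ (m + 2)) / q ^ (m + 2) +
            (t + q ^ (m + 2) + 1 - 2 * q - t * q ^ (m + 2))) =
        -((1 - t) * (q ^ (m + 2) - 1) * (q ^ (m + 2) - q) * (1 - t * q ^ (m + 2))) := by
      generalize q ^ (m + 2) = N at *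
      field_simp
      ring
    rw [k2] at k1
    linear_combination k1

/-! ### The bilinear form attached to a sequence of moments -/

/-- The value of the form on a pair of monomials. -/
def monomialPairing (w : ℤ → ℂ) (nu kap : Fin 2 →₀ ℕ) : ℂ :=
  if nu 0 + nu 1 = kap 0 + kap 1 then w ((nu 0 : ℤ) - kap 0) else 0

/-- The bilinear form on `ℂ[x₁, x₂]` with moments `w`. -/
def pairing (w : ℤ → ℂ) : MvPolynomial (Fin 2) ℂ →ₗ[ℂ] MvPolynomial (Fin 2) ℂ →ₗ[ℂ] ℂ :=
  (MvPolynomial.basisMonomials (Fin 2) ℂ).constr ℂ fun nu =>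
    (MvPolynomial.basisMonomials (Fin 2) ℂ).constr ℂ fun kap => monomialPairing w nu kap

theorem pairing_monomial (w : ℤ → ℂ) (nu kap : Fin 2 →₀ ℕ) (a b : ℂ) :
    pairing w (MvPolynomial.monomial nu a) (MvPolynomial.monomial kap b) =
      a * b * monomialPairing w nu kap := by
  have h1 : ∀ (nu : Fin 2 →₀ ℕ) (a : ℂ), MvPolynomial.monomial nu a =
      a • MvPolynomial.basisMonomials (Fin 2) ℂ nu := fun nu a => by
    rw [MvPolynomial.coe_basisMonomials, MvPolynomial.smul_monomial, smul_eq_mul, mul_one]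
  rw [h1, h1, pairing, map_smul, map_smul, LinearMap.smul_apply, Module.Basis.constr_basis,
    Module.Basis.constr_basis, smul_eq_mul, smul_eq_mul]
  ring

theorem pairing_comm {w : ℤ → ℂ} (hw : ∀ k, w (-k) = w k) (P Q : MvPolynomial (Fin 2) ℂ) :
    pairing w P Q = pairing w Q P := by
  have h1 : ∀ nu kap, monomialPairing w nu kap = monomialPairing w kap nu := fun nu kap => by
    rw [monomialPairing, monomialPairing]
    split_ifs with h2 h3 h3
    · rw [← hw, neg_sub]
    · exact absurd h2.symm h3
    · exact absurd h3.symm h2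
    · rfl
  rw [P.as_sum, Q.as_sum]
  simp only [map_sum, LinearMap.sum_apply, pairing_monomial]
  rw [sum_comm]
  exact sum_congr rfl fun _ _ => sum_congr rfl fun _ _ => by rw [h1, mul_comm (P.coeff _)]

/-- The homogeneous polynomial `∑ g j g (m - j) / g m x₁ ^ (m₁ - j) x₂ ^ (m₂ + j)`. -/
def orthMv (g : ℕ → ℂ) (m₁ m₂ : ℕ) : MvPolynomial (Fin 2) ℂ :=
  ∑ j ∈ range (m₁ - m₂ + 1), MvPolynomial.monomial (expo (m₁ - j) (m₂ + j))
    (g j * g (m₁ - m₂ - j) / g (m₁ - m₂))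

theorem eval_orthMv (g : ℕ → ℂ) (m₁ m₂ : ℕ) (x : Fin 2 → ℂ) :
    MvPolynomial.eval x (orthMv g m₁ m₂) = ∑ j ∈ range (m₁ - m₂ + 1),
      g j * g (m₁ - m₂ - j) / g (m₁ - m₂) * (x 0 ^ (m₁ - j) * x 1 ^ (m₂ + j)) := by
  rw [orthMv, map_sum]
  refine sum_congr rfl fun j _ => ?_
  rw [MvPolynomial.eval_monomial, Finsupp.prod_fintype _ _ (by simp), Fin.prod_univ_two, expo_zero,
    expo_one]

theorem orthMv_isSymmetric (g : ℕ → ℂ) {m₁ m₂ : ℕ} (hm : m₂ ≤ m₁) :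
    (orthMv g m₁ m₂).IsSymmetric := isSymmetric_of_eval_comm fun x y => by
  rw [eval_orthMv, eval_orthMv, ← sum_range_reflect]
  refine sum_congr rfl fun j hj => ?_
  have hj' : j ≤ m₁ - m₂ := by have := mem_range.mp hj; omega
  rw [show m₁ - m₂ + 1 - 1 - j = m₁ - m₂ - j by omega, Nat.sub_sub_self hj',
    show m₁ - (m₁ - m₂ - j) = m₂ + j by omega, show m₂ + (m₁ - m₂ - j) = m₁ - j by omega]
  simp only [Matrix.cons_val_zero, Matrix.cons_val_one]
  ring

theorem coeff_orthMv_self {p b d g : ℕ → ℂ} (h : RecurrenceData p b d g) (m₁ m₂ : ℕ) :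
    (orthMv g m₁ m₂).coeff (expo m₁ m₂) = 1 := by
  rw [orthMv, MvPolynomial.coeff_sum, sum_eq_single 0]
  · simp [h.g_zero, h.g_ne]
  · intro j _ hj
    rw [MvPolynomial.coeff_monomial, if_neg]
    intro h1
    have := DFunLike.congr_fun h1 1
    simp only [expo_one] at this
    omega
  · simp

theorem of_coeff_orthMv_ne_zero (g : ℕ → ℂ) {m₁ m₂ : ℕ} (hm : m₂ ≤ m₁) {nu : Fin 2 →₀ ℕ}
    (h : (orthMv g m₁ m₂).coeff nu ≠ 0) : nu 0 ≤ m₁ ∧ nu 0 + nu 1 = m₁ + m₂ := by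
  rw [orthMv, MvPolynomial.coeff_sum] at h
  obtain ⟨j, hj, h1⟩ := exists_ne_zero_of_sum_ne_zero h
  rw [MvPolynomial.coeff_monomial] at h1
  have h2 : expo (m₁ - j) (m₂ + j) = nu := by
    by_contra h3
    exact h1 (if_neg h3)
  subst h2
  have := mem_range.mp hj
  simp only [expo_zero, expo_one]
  omega

theorem pairing_orthMv_monomial (w : ℤ → ℂ) (g : ℕ → ℂ) {m₁ m₂ : ℕ} (hm : m₂ ≤ m₁) (a b : ℕ) :
    pairing w (orthMv g m₁ m₂) (MvPolynomial.monomial (expo a b) 1) =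
      if m₁ + m₂ = a + b then (g (m₁ - m₂))⁻¹ * momentSum g w (m₁ - m₂) (m₁ - a) else 0 := by
  rw [orthMv, map_sum, LinearMap.sum_apply]
  simp only [pairing_monomial]
  split_ifs with h
  · rw [momentSum, mul_sum]
    refine sum_congr rfl fun j hj => ?_
    have := mem_range.mp hj
    rw [monomialPairing, if_pos (by rw [expo_zero, expo_one, expo_zero, expo_one]; omega),
      expo_zero, expo_zero, Nat.cast_sub (by omega), show (m₁ : ℤ) - j - a = m₁ - a - j by ring]
    ring
  · refine sum_eq_zero fun j hj => ?_
    have := mem_range.mp hj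
    rw [monomialPairing, if_neg (by rw [expo_zero, expo_one, expo_zero, expo_one]; omega),
      mul_zero]

/-! ### Symmetrized monomials, dominance, and uniqueness of orthogonal polynomials -/

theorem symMonomial_eq (mu : Fin 2 → ℕ) : symMonomial mu =
    if mu 0 = mu 1 then MvPolynomial.monomial (expo (mu 0) (mu 1)) 1 else
      MvPolynomial.monomial (expo (mu 0) (mu 1)) 1 +
        MvPolynomial.monomial (expo (mu 1) (mu 0)) 1 := by
  have h1 : (univ : Finset (Equiv.Perm (Fin 2))) = {1, Equiv.swap 0 1} := by decide
  have h2 : mu ∘ (1 : Equiv.Perm (Fin 2)) = ![mu 0, mu 1] := (vec_eta mu).symm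
  have h3 : mu ∘ (Equiv.swap (0 : Fin 2) 1) = ![mu 1, mu 0] := by
    ext i; fin_cases i <;> simp
  rw [symMonomial, h1, image_insert, image_singleton, h2, h3]
  split_ifs with h
  · rw [h, pair_eq_singleton, sum_singleton]; rfl
  · rw [sum_pair]
    · rfl
    · intro h4
      exact h (congrFun h4 0)

theorem coeff_symMonomial (mu : Fin 2 → ℕ) (hmu : Antitone mu) (nu : Fin 2 →₀ ℕ) :
    (symMonomial mu).coeff nu = if mu = ![max (nu 0) (nu 1), min (nu 0) (nu 1)] then 1 else 0 := by
  have hmu' := antitone_fin_two.mp hmu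
  have h1 : ∀ i j, expo i j = nu ↔ i = nu 0 ∧ j = nu 1 := fun i j => by
    constructor
    · rintro rfl; simp
    · rintro ⟨rfl, rfl⟩; exact expo_eta nu
  have h2 : mu = ![max (nu 0) (nu 1), min (nu 0) (nu 1)] ↔
      mu 0 = max (nu 0) (nu 1) ∧ mu 1 = min (nu 0) (nu 1) := by
    constructor
    · intro h; rw [h]; simp
    · rintro ⟨h3, h4⟩; rw [← h3, ← h4, vec_eta]
  rw [symMonomial_eq]
  simp only [h2]
  split_ifs with h3 h4 h4
  · rw [MvPolynomial.coeff_monomial, if_pos]; rw [h1]; omega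
  · rw [MvPolynomial.coeff_monomial, if_neg]; rw [h1]; omega
  · rw [MvPolynomial.coeff_add, MvPolynomial.coeff_monomial, MvPolynomial.coeff_monomial]
    simp only [h1]
    rcases le_total (nu 0) (nu 1) with h5 | h5
    · rw [if_neg (by omega), if_pos (by omega), zero_add]
    · rw [if_pos (by omega), if_neg (by omega), add_zero]
  · rw [MvPolynomial.coeff_add, MvPolynomial.coeff_monomial, MvPolynomial.coeff_monomial]
    simp only [h1]
    rw [if_neg (by omega), if_neg (by omega), add_zero]

theorem dominated_fin_two {mu lam : Fin 2 → ℕ} :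
    Dominated mu lam ↔ mu 0 ≤ lam 0 ∧ mu 0 + mu 1 ≤ lam 0 + lam 1 := by
  have h0 : (univ.filter (· ≤ (0 : Fin 2))) = {0} := by decide
  have h1 : (univ.filter (· ≤ (1 : Fin 2))) = univ := by decide
  rw [Dominated, Fin.forall_fin_two, h0, h1]
  simp

theorem exists_symMonomial_expansion {P : MvPolynomial (Fin 2) ℂ} (hP : P.IsSymmetric) :
    ∃ u : (Fin 2 → ℕ) →₀ ℂ, (∀ mu ∈ u.support, Antitone mu) ∧
      (∀ mu, Antitone mu → u mu = P.coeff (expo (mu 0) (mu 1))) ∧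
      P = ∑ mu ∈ u.support, MvPolynomial.C (u mu) * symMonomial mu := by
  classical
  let f : (Fin 2 → ℕ) → ℂ := fun mu => if Antitone mu then P.coeff (expo (mu 0) (mu 1)) else 0
  have hf : ∀ mu, f mu ≠ 0 → mu ∈ P.support.image fun nu => ![nu 0, nu 1] := by
    intro mu h
    have h1 : P.coeff (expo (mu 0) (mu 1)) ≠ 0 := fun h2 => h (by simp [f, h2])
    exact mem_image.mpr ⟨_, MvPolynomial.mem_support_iff.mpr h1, by simp [vec_eta]⟩
  let u := Finsupp.onFinset _ f hf
  have hu : ∀ mu, u mu = f mu := fun mu => rfl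
  have hanti : ∀ mu ∈ u.support, Antitone mu := fun mu hmu => by
    by_contra h
    exact Finsupp.mem_support_iff.mp hmu (by rw [hu]; exact if_neg h)
  have hcoeff : ∀ mu, Antitone mu → u mu = P.coeff (expo (mu 0) (mu 1)) := fun mu hmu => by
    rw [hu]; exact if_pos hmu
  refine ⟨u, hanti, hcoeff, ?_⟩
  ext nu
  rw [MvPolynomial.coeff_sum]
  have h1 : ∀ mu ∈ u.support, (MvPolynomial.C (u mu) * symMonomial mu).coeff nu =
      if mu = ![max (nu 0) (nu 1), min (nu 0) (nu 1)] then u mu else 0 := fun mu hmu => by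
    rw [MvPolynomial.coeff_C_mul, coeff_symMonomial mu (hanti mu hmu), mul_ite, mul_one, mul_zero]
  rw [sum_congr rfl h1, sum_ite_eq']
  have h2 : P.coeff nu = u ![max (nu 0) (nu 1), min (nu 0) (nu 1)] := by
    rw [hcoeff _ (antitone_fin_two.mpr (by simp))]
    simp only [Matrix.cons_val_zero, Matrix.cons_val_one]
    rcases le_total (nu 0) (nu 1) with h | h
    · rw [max_eq_right h, min_eq_left h, coeff_comm_of_isSymmetric hP, expo_eta]
    · rw [max_eq_left h, min_eq_right h, expo_eta]
  rw [h2]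
  split_ifs with h3
  · rfl
  · exact Finsupp.notMem_support_iff.mp h3

theorem orthMv_expansion {p b d g : ℕ → ℂ} (h : RecurrenceData p b d g) {lam : Fin 2 → ℕ}
    (hlam : Antitone lam) : ∃ u : (Fin 2 → ℕ) →₀ ℂ, u lam = 1 ∧
      (∀ mu ∈ u.support, Antitone mu ∧ Dominated mu lam) ∧
      orthMv g (lam 0) (lam 1) = ∑ mu ∈ u.support, MvPolynomial.C (u mu) * symMonomial mu := by
  have hm := antitone_fin_two.mp hlam
  obtain ⟨u, h1, h2, h3⟩ := exists_symMonomial_expansion (orthMv_isSymmetric g hm)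
  refine ⟨u, by rw [h2 lam hlam, coeff_orthMv_self h], fun mu hmu => ⟨h1 mu hmu, ?_⟩, h3⟩
  have h4 := Finsupp.mem_support_iff.mp hmu
  rw [h2 mu (h1 mu hmu)] at h4
  have := of_coeff_orthMv_ne_zero g hm h4
  simp only [expo_zero, expo_one] at this
  exact dominated_fin_two.mpr ⟨this.1, this.2.le⟩

/-- Monomials of another weight pair to zero. For equal weight, both exponents of m_μ are at most μ₁
< ν₁, so the moment sum is taken at an index strictly between 0 and ν₁ - ν₂. Only first parts are
compared, so this applies across weights. -/
theorem pairing_orthMv_symMonomial_eq_zero {p b d g : ℕ → ℂ} {w : ℤ → ℂ}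
    (hw : IsMomentSeq b d g w) (h : RecurrenceData p b d g) {mu nu : Fin 2 → ℕ} (hmu : Antitone mu)
    (hnu : Antitone nu) (hle : mu 0 ≤ nu 0) (hne : mu ≠ nu) :
    pairing w (orthMv g (nu 0) (nu 1)) (symMonomial mu) = 0 := by
  have hm := antitone_fin_two.mp hmu
  have hn := antitone_fin_two.mp hnu
  have key : ∀ a b : ℕ, a + b = mu 0 + mu 1 → a ≤ mu 0 → b ≤ mu 0 →
      pairing w (orthMv g (nu 0) (nu 1)) (MvPolynomial.monomial (expo a b) 1) = 0 := by
    intro a b hab ha hb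
    rw [pairing_orthMv_monomial _ _ hn]
    split_ifs with h1
    · have h2 : mu 0 < nu 0 := by
        refine lt_of_le_of_ne hle fun h3 => hne ?_
        rw [← vec_eta mu, ← vec_eta nu, h3, show mu 1 = nu 1 by omega]
      rw [show (nu 0 : ℤ) - a = (nu 0 - a : ℕ) by omega,
        hw.momentSum_eq_zero h _ _ (by omega) (by omega), mul_zero]
    · rfl
  rw [symMonomial_eq]
  split_ifs with h1
  · exact key _ _ rfl le_rfl hm
  · rw [map_add, key _ _ rfl le_rfl hm, key _ _ (add_comm _ _) hm le_rfl, add_zero]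

theorem pairing_orthMv_symMonomial_self {p b d g : ℕ → ℂ} {w : ℤ → ℂ}
    (hw : IsMomentSeq b d g w) (h : RecurrenceData p b d g) (hd : ∀ k, d k ≠ 0) {nu : Fin 2 → ℕ}
    (hnu : Antitone nu) : pairing w (orthMv g (nu 0) (nu 1)) (symMonomial nu) ≠ 0 := by
  have hn := antitone_fin_two.mp hnu
  have h2 := mul_ne_zero (inv_ne_zero (h.g_ne (nu 0 - nu 1)))
    (hw.momentSum_ne_zero h hd (nu 0 - nu 1))
  rw [symMonomial_eq]
  split_ifs with h1
  · rw [pairing_orthMv_monomial _ _ hn, if_pos rfl, sub_self]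
    exact h2
  · rw [map_add, pairing_orthMv_monomial _ _ hn, if_pos rfl, pairing_orthMv_monomial _ _ hn,
      if_pos (add_comm _ _), sub_self, show (nu 0 : ℤ) - nu 1 = (nu 0 - nu 1 : ℕ) - 0 by omega,
      momentSum_reflect g hw.even, ← two_mul]
    exact mul_ne_zero two_ne_zero h2

/-- Let D be the difference of two solutions and ν an index with maximal first part in its
expansion. D is orthogonal to every m_μ with μ < λ, hence to the orthogonal polynomial of index ν.
In the expansion of D only m_ν pairs nontrivially with that polynomial, so its coefficient is zero,
a contradiction. Nondegeneracy uses d_k ≠ 0. -/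
theorem isOrthogonalPoly_iff {p b d g : ℕ → ℂ} {w : ℤ → ℂ}
    (hw : IsMomentSeq b d g w) (h : RecurrenceData p b d g) (hd : ∀ k, d k ≠ 0)
    {Δplus : (Fin 2 → ℂ) → ℂ} {K : ℂ} (hK : K ≠ 0)
    (hint : ∀ P Q : MvPolynomial (Fin 2) ℂ, torusIntegral (fun x : Fin 2 → ℂ =>
      MvPolynomial.eval x P * MvPolynomial.eval x⁻¹ Q *
        (Δplus x * Δplus x⁻¹) * ∏ i, (x i)⁻¹) 0 1 = K * pairing w P Q)
    {lam : Fin 2 → ℕ} (hlam : Antitone lam) (P : MvPolynomial (Fin 2) ℂ) :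
    IsOrthogonalPoly Δplus lam P ↔ P = orthMv g (lam 0) (lam 1) := by
  have hiff : ∀ P : MvPolynomial (Fin 2) ℂ, IsOrthogonalPoly Δplus lam P ↔
      (∃ u : (Fin 2 → ℕ) →₀ ℂ, u lam = 1 ∧ (∀ mu ∈ u.support, Antitone mu ∧ Dominated mu lam) ∧
        P = ∑ mu ∈ u.support, MvPolynomial.C (u mu) * symMonomial mu) ∧
      ∀ mu : Fin 2 → ℕ, Antitone mu → Dominated mu lam → mu ≠ lam →
        pairing w P (symMonomial mu) = 0 := by
    intro P
    simp only [IsOrthogonalPoly, hint, mul_eq_zero, hK, false_or]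
  have hsum : ∀ u : (Fin 2 → ℕ) →₀ ℂ, ∑ mu ∈ u.support, MvPolynomial.C (u mu) * symMonomial mu =
      Finsupp.linearCombination ℂ symMonomial u := fun u => by
    rw [Finsupp.linearCombination_apply, Finsupp.sum]
    exact sum_congr rfl fun mu _ => (MvPolynomial.smul_eq_C_mul _ _).symm
  have hO : IsOrthogonalPoly Δplus lam (orthMv g (lam 0) (lam 1)) :=
    (hiff _).mpr ⟨orthMv_expansion h hlam, fun mu hmu hdom hne =>
      pairing_orthMv_symMonomial_eq_zero hw h hmu hlam (dominated_fin_two.mp hdom).1 hne⟩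
  refine ⟨fun hP => ?_, fun hP => hP ▸ hO⟩
  obtain ⟨⟨u, hu1, hu2, hu3⟩, hu4⟩ := (hiff _).mp hP
  obtain ⟨⟨v, hv1, hv2, hv3⟩, hv4⟩ := (hiff _).mp hO
  rw [hsum] at hu3 hv3
  suffices hD : u - v = 0 by rw [hu3, hv3, sub_eq_zero.mp hD]
  by_contra hD
  have hPv : P - orthMv g (lam 0) (lam 1) = Finsupp.linearCombination ℂ symMonomial (u - v) := by
    rw [map_sub, ← hu3, ← hv3]
  obtain ⟨nu, hnu, hmax⟩ := exists_max_image (u - v).support (fun mu => mu 0)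
    (Finsupp.support_nonempty_iff.mpr hD)
  have hmem : ∀ mu ∈ (u - v).support, Antitone mu ∧ Dominated mu lam := fun mu hmu => by
    rcases mem_union.mp (Finsupp.support_sub hmu) with h1 | h1
    · exact hu2 mu h1
    · exact hv2 mu h1
  have hnul : nu ≠ lam := by
    rintro rfl
    exact Finsupp.mem_support_iff.mp hnu (by simp [hu1, hv1])
  obtain ⟨hna, hnd⟩ := hmem nu hnu
  have hzero : pairing w (P - orthMv g (lam 0) (lam 1)) (orthMv g (nu 0) (nu 1)) = 0 := by
    obtain ⟨z, _, hz2, hz3⟩ := orthMv_expansion h hna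
    rw [hz3, map_sum]
    refine sum_eq_zero fun mu hmu => ?_
    obtain ⟨h1, h2⟩ := hz2 mu hmu
    rw [dominated_fin_two] at h2 hnd
    -- If μ were λ, then λ ≤ ν ≤ λ would give ν = λ, but the coefficients of m_λ cancel in the
    -- difference.
    have h3 : mu ≠ lam := by
      rintro rfl
      refine hnul ?_
      rw [← vec_eta nu, ← vec_eta mu, show nu 0 = mu 0 by omega, show nu 1 = mu 1 by omega]
    have h4 : Dominated mu lam := dominated_fin_two.mpr ⟨by omega, by omega⟩
    rw [← MvPolynomial.smul_eq_C_mul, map_smul, map_sub, LinearMap.sub_apply, hu4 mu h1 h4 h3,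
      hv4 mu h1 h4 h3, sub_zero, smul_zero]
  rw [hPv, Finsupp.linearCombination_apply, Finsupp.sum, map_sum, LinearMap.sum_apply,
    sum_eq_single_of_mem nu hnu] at hzero
  · rw [map_smul, LinearMap.smul_apply, pairing_comm hw.even, smul_eq_mul] at hzero
    exact mul_ne_zero (Finsupp.mem_support_iff.mp hnu)
      (pairing_orthMv_symMonomial_self hw h hd hna) hzero
  · intro mu hmu hne
    rw [map_smul, LinearMap.smul_apply, pairing_comm hw.even,
      pairing_orthMv_symMonomial_eq_zero hw h (hmem mu hmu).1 hna (hmax mu hmu) hne, smul_zero]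

/-! ### Moments of circle weights and the torus integral -/

/-- The moments of a weight function on the circle. -/
def moment (h : ℝ → ℂ) (k : ℤ) : ℂ :=
  ∫ θ in (0 : ℝ)..2 * Real.pi, Complex.exp (k * θ * Complex.I) * h θ

theorem exp_int_mul_periodic (k : ℤ) :
    Function.Periodic (fun θ : ℝ => Complex.exp (k * θ * Complex.I)) (2 * Real.pi) := fun θ => by
  have h : (k : ℂ) * ((θ + 2 * Real.pi : ℝ) : ℂ) * Complex.I =
      k * θ * Complex.I + k * (2 * Real.pi * Complex.I) := by
    push_cast; ring
  simp only [h]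
  rw [Complex.exp_add, Complex.exp_int_mul_two_pi_mul_I, mul_one]

theorem moment_eq_shift {h : ℝ → ℂ} (hper : Function.Periodic h (2 * Real.pi)) (k : ℤ) (y : ℝ) :
    ∫ θ in (0 : ℝ)..2 * Real.pi, Complex.exp (k * (θ - y : ℝ) * Complex.I) * h (θ - y) =
      moment h k := by
  rw [intervalIntegral.integral_comp_sub_right
    (fun θ : ℝ => Complex.exp (k * θ * Complex.I) * h θ), moment]
  have := ((exp_int_mul_periodic k).mul hper).intervalIntegral_add_eq (0 - y) 0
  simpa [sub_eq_neg_add, add_comm] using this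

theorem moment_comp_neg {h : ℝ → ℂ} (hper : Function.Periodic h (2 * Real.pi)) (k : ℤ) :
    moment (fun θ => h (-θ)) k = moment h (-k) := by
  have h1 := moment_eq_shift hper (-k) (2 * Real.pi)
  have h2 := intervalIntegral.integral_comp_sub_left (a := 0) (b := 2 * Real.pi)
    (fun θ : ℝ => Complex.exp ((-k : ℤ) * (θ - 2 * Real.pi : ℝ) * Complex.I) *
      h (θ - 2 * Real.pi)) (2 * Real.pi)
  rw [sub_self, sub_zero, h1] at h2
  rw [← h2, moment]
  refine intervalIntegral.integral_congr fun θ _ => ?_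
  simp only [sub_sub_cancel_left]
  congr 2
  push_cast
  ring

theorem moment_neg {h : ℝ → ℂ} (hper : Function.Periodic h (2 * Real.pi))
    (heven : ∀ θ, h (-θ) = h θ) (k : ℤ) : moment h (-k) = moment h k := by
  rw [← moment_comp_neg hper]
  simp only [heven]

theorem moment_zero_ne_zero {h : ℝ → ℂ} (hc : Continuous h) (hnonneg : ∀ θ, 0 ≤ (h θ).re)
    (hpos : 0 < (h Real.pi).re) : moment h 0 ≠ 0 := by
  intro h0
  have h1 : 0 < ∫ θ in (0 : ℝ)..2 * Real.pi, (h θ).re :=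
    intervalIntegral.integral_pos Real.two_pi_pos (Complex.continuous_re.comp hc).continuousOn
      (fun θ _ => hnonneg θ) ⟨Real.pi, ⟨Real.pi_pos.le, by linarith [Real.pi_pos]⟩, hpos⟩
  have h2 := Complex.reCLM.intervalIntegral_comp_comm
    (hc.intervalIntegrable (μ := MeasureTheory.volume) 0 (2 * Real.pi))
  simp only [Complex.reCLM_apply] at h2
  rw [h2] at h1
  have h3 : moment h 0 = ∫ θ in (0 : ℝ)..2 * Real.pi, h θ := by simp [moment]
  rw [← h3, h0] at h1
  exact lt_irrefl _ h1

theorem setIntegral_Icc_fin_two {F : ℝ → ℝ → ℂ} (hF : Continuous (Function.uncurry F)) {T : ℝ}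
    (hT : 0 ≤ T) : ∫ θ : Fin 2 → ℝ in Set.Icc 0 (fun _ => T), F (θ 0) (θ 1) =
      ∫ y in (0 : ℝ)..T, ∫ x in (0 : ℝ)..T, F x y := by
  have h1 : Set.Icc (0 : Fin 2 → ℝ) (fun _ => T) =
      MeasurableEquiv.finTwoArrow ⁻¹' (Set.Icc 0 T ×ˢ Set.Icc 0 T) := by
    ext θ
    simp [Set.mem_Icc, Pi.le_def, Fin.forall_fin_two]
  have h2 := (MeasureTheory.volume_preserving_finTwoArrow ℝ).setIntegral_preimage_emb
    MeasurableEquiv.finTwoArrow.measurableEmbedding (Function.uncurry F) (Set.Icc 0 T ×ˢ Set.Icc 0 T)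
  rw [h1]
  refine h2.trans ?_
  rw [MeasureTheory.Measure.volume_eq_prod, ← MeasureTheory.setIntegral_prod_swap,
    MeasureTheory.setIntegral_prod]
  · simp only [intervalIntegral.integral_of_le hT, MeasureTheory.integral_Icc_eq_integral_Ioc]
    rfl
  · rw [← MeasureTheory.Measure.volume_eq_prod]
    exact (hF.comp continuous_swap).continuousOn.integrableOn_compact
      (isCompact_Icc.prod isCompact_Icc)

theorem integral_exp_int_mul (k : ℤ) :
    ∫ θ in (0 : ℝ)..2 * Real.pi, Complex.exp (k * θ * Complex.I) =
      if k = 0 then 2 * Real.pi else 0 := by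
  split_ifs with hk
  · simp [hk]
  · have h1 : ∀ θ : ℝ, (k : ℂ) * θ * Complex.I = k * Complex.I * θ := fun θ => by ring
    have h2 : (k : ℂ) * Complex.I ≠ 0 := mul_ne_zero (Int.cast_ne_zero.mpr hk) Complex.I_ne_zero
    simp only [h1]
    rw [integral_exp_mul_complex h2]
    have h3 : (k : ℂ) * Complex.I * (2 * Real.pi : ℝ) = k * (2 * Real.pi * Complex.I) := by
      push_cast; ring
    rw [h3, Complex.exp_int_mul_two_pi_mul_I]
    simp

/-- Translating x by y separates the variables: the integral over x is a moment of h, and the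
remaining integral over y is that of a character. -/
theorem integral_exp_mul_exp_mul {h : ℝ → ℂ} (hc : Continuous h)
    (hper : Function.Periodic h (2 * Real.pi)) (a b : ℤ) :
    ∫ θ : Fin 2 → ℝ in Set.Icc 0 (fun _ => 2 * Real.pi),
      Complex.exp (a * θ 0 * Complex.I) * Complex.exp (b * θ 1 * Complex.I) * h (θ 0 - θ 1) =
      if a + b = 0 then 2 * Real.pi * moment h a else 0 := by
  rw [setIntegral_Icc_fin_two (F := fun x y => Complex.exp (a * x * Complex.I) *
    Complex.exp (b * y * Complex.I) * h (x - y)) (by unfold Function.uncurry; fun_prop)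
    Real.two_pi_pos.le]
  have h1 : ∀ y : ℝ, ∫ x in (0 : ℝ)..2 * Real.pi, Complex.exp (a * x * Complex.I) *
      Complex.exp (b * y * Complex.I) * h (x - y) =
      Complex.exp ((a + b : ℤ) * y * Complex.I) * moment h a := fun y => by
    rw [← moment_eq_shift hper a y, ← intervalIntegral.integral_const_mul]
    refine intervalIntegral.integral_congr fun x _ => ?_
    rw [← mul_assoc, ← Complex.exp_add, ← Complex.exp_add]
    congr 2
    push_cast
    ring
  simp only [h1]
  rw [intervalIntegral.integral_mul_const, integral_exp_int_mul]
  split_ifs <;> simp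

/-- The factor 2π is the integral over the diagonal direction, on which the weight is constant. The
sign is I², left by the two differentials dx = I x dθ after division by x₁x₂. -/
theorem torusIntegral_eq_pairing {Δplus : (Fin 2 → ℂ) → ℂ} {h : ℝ → ℂ} (hc : Continuous h)
    (hper : Function.Periodic h (2 * Real.pi))
    (hΔ : ∀ x y : ℝ, Δplus ![Complex.exp (x * Complex.I), Complex.exp (y * Complex.I)] *
      Δplus ![Complex.exp (x * Complex.I), Complex.exp (y * Complex.I)]⁻¹ = h (x - y))
    (P Q : MvPolynomial (Fin 2) ℂ) :
    torusIntegral (fun x : Fin 2 → ℂ => MvPolynomial.eval x P * MvPolynomial.eval x⁻¹ Q *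
      (Δplus x * Δplus x⁻¹) * ∏ i, (x i)⁻¹) 0 1 = -(2 * Real.pi) * pairing (moment h) P Q := by
  have hmap : ∀ θ : Fin 2 → ℝ, torusMap 0 1 θ =
      ![Complex.exp (θ 0 * Complex.I), Complex.exp (θ 1 * Complex.I)] := fun θ => by
    ext i; fin_cases i <;> simp [torusMap]
  have heval : ∀ θ : Fin 2 → ℝ,
      (∏ i, ((1 : Fin 2 → ℝ) i : ℂ) * Complex.exp (θ i * Complex.I) * Complex.I) •
      (MvPolynomial.eval (torusMap 0 1 θ) P * MvPolynomial.eval (torusMap 0 1 θ)⁻¹ Q *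
      (Δplus (torusMap 0 1 θ) * Δplus (torusMap 0 1 θ)⁻¹) * ∏ i, (torusMap 0 1 θ i)⁻¹) =
      ∑ nu ∈ P.support, ∑ kap ∈ Q.support, -(P.coeff nu * Q.coeff kap) *
        (Complex.exp (((nu 0 : ℤ) - kap 0 : ℤ) * θ 0 * Complex.I) *
          Complex.exp (((nu 1 : ℤ) - kap 1 : ℤ) * θ 1 * Complex.I) * h (θ 0 - θ 1)) := fun θ => by
    have e0 := Complex.exp_ne_zero (θ 0 * Complex.I)
    have e1 := Complex.exp_ne_zero (θ 1 * Complex.I)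
    have hexp : ∀ (a b : ℕ) (x : ℝ), Complex.exp (((a : ℤ) - b : ℤ) * x * Complex.I) =
        Complex.exp (x * Complex.I) ^ a * (Complex.exp (x * Complex.I))⁻¹ ^ b := fun a b x => by
      rw [← Complex.exp_neg, ← Complex.exp_nat_mul, ← Complex.exp_nat_mul, ← Complex.exp_add]
      congr 1
      push_cast
      ring
    simp only [hmap, hΔ, MvPolynomial.eval_eq', Fin.prod_univ_two, hexp]
    simp only [Pi.inv_apply, Pi.one_apply, Matrix.cons_val_zero, Matrix.cons_val_one, smul_eq_mul,
      Complex.ofReal_one, one_mul]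
    generalize Complex.exp (θ 0 * Complex.I) = u at *
    generalize Complex.exp (θ 1 * Complex.I) = v at *
    have huv : u * Complex.I * (v * Complex.I) * (u⁻¹ * v⁻¹) = -1 := by
      field_simp
      exact Complex.I_sq
    rw [mul_comm (_ * h _), ← mul_assoc, huv, sum_mul_sum, sum_mul, mul_sum]
    refine sum_congr rfl fun nu _ => ?_
    rw [sum_mul, mul_sum]
    exact sum_congr rfl fun kap _ => by ring
  have hint : ∀ (c : ℂ) (a b : ℤ), MeasureTheory.IntegrableOn (fun θ : Fin 2 → ℝ => c *
      (Complex.exp (a * θ 0 * Complex.I) * Complex.exp (b * θ 1 * Complex.I) * h (θ 0 - θ 1)))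
      (Set.Icc 0 fun _ => 2 * Real.pi) := fun c a b =>
    Continuous.integrableOn_Icc (by fun_prop)
  rw [torusIntegral]
  simp only [heval]
  rw [MeasureTheory.integral_finsetSum _ fun nu _ =>
    MeasureTheory.integrable_finsetSum _ fun kap _ => hint _ _ _]
  conv_rhs => rw [P.as_sum, Q.as_sum]
  simp only [map_sum, LinearMap.sum_apply, pairing_monomial]
  rw [sum_comm, mul_sum]
  refine sum_congr rfl fun nu _ => ?_
  rw [MeasureTheory.integral_finsetSum _ fun kap _ => hint _ _ _, mul_sum]
  refine sum_congr rfl fun kap _ => ?_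
  rw [MeasureTheory.integral_const_mul, integral_exp_mul_exp_mul hc hper, monomialPairing]
  by_cases h1 : nu 0 + nu 1 = kap 0 + kap 1
  · rw [if_pos h1, if_pos (by omega)]
    ring
  · rw [if_neg h1, if_neg (by omega), mul_zero, mul_zero, mul_zero]

/-! ### The weight of the Jack polynomials -/

/-- The weight function `(1 - e^{iθ})^τ (1 - e^{-iθ})^τ`. -/
def jackCircleWeight (τ : ℝ) (θ : ℝ) : ℂ :=
  (1 - Complex.exp (θ * Complex.I)) ^ (τ : ℂ) * (1 - Complex.exp (-(θ * Complex.I))) ^ (τ : ℂ)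

theorem zero_le_re_one_sub_exp (θ : ℝ) : 0 ≤ (1 - Complex.exp (θ * Complex.I)).re := by
  rw [Complex.sub_re, Complex.one_re, Complex.exp_ofReal_mul_I_re]
  linarith [Real.cos_le_one θ]

/-- The base stays in the closed right half-plane, where the principal power with exponent of
positive real part is continuous, including at the zero of the base. -/
theorem continuous_one_sub_exp_cpow {τ : ℝ} (hτ : 0 < τ) :
    Continuous fun θ : ℝ => (1 - Complex.exp (θ * Complex.I)) ^ (τ : ℂ) := by
  rw [continuous_iff_continuousAt]
  intro θ
  exact ContinuousAt.comp (f := fun θ : ℝ => 1 - Complex.exp (θ * Complex.I))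
    (Complex.continuousAt_cpow_const_of_re_pos (Or.inl (zero_le_re_one_sub_exp θ))
      (by rwa [Complex.ofReal_re])) (by fun_prop)

theorem continuous_jackCircleWeight {τ : ℝ} (hτ : 0 < τ) : Continuous (jackCircleWeight τ) := by
  have h1 := continuous_one_sub_exp_cpow hτ
  have h2 := h1.comp continuous_neg
  refine h1.mul (h2.congr fun θ => ?_)
  simp

theorem jackCircleWeight_periodic (τ : ℝ) :
    Function.Periodic (jackCircleWeight τ) (2 * Real.pi) := fun θ => by
  have h1 : ((θ + 2 * Real.pi : ℝ) : ℂ) * Complex.I = θ * Complex.I + 2 * Real.pi * Complex.I := by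
    push_cast; ring
  rw [jackCircleWeight, jackCircleWeight, h1, Complex.exp_neg, Complex.exp_periodic,
    ← Complex.exp_neg]

theorem jackCircleWeight_neg (τ θ : ℝ) : jackCircleWeight τ (-θ) = jackCircleWeight τ θ := by
  rw [jackCircleWeight, jackCircleWeight, Complex.ofReal_neg, neg_mul, neg_neg, mul_comm]

/-- The two factors are conjugate, since the base never has argument π. So the weight is real and
nonnegative, which gives w 0 ≠ 0. -/
theorem jackCircleWeight_eq (τ θ : ℝ) : jackCircleWeight τ θ =
    (Complex.normSq ((1 - Complex.exp (θ * Complex.I)) ^ (τ : ℂ)) : ℝ) := by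
  rw [Complex.normSq_eq_conj_mul_self, mul_comm, jackCircleWeight]
  congr 1
  have h1 : (1 - Complex.exp (θ * Complex.I)).arg ≠ Real.pi := fun h2 => by
    have h3 := Complex.arg_eq_pi_iff.mp h2
    exact absurd h3.1 (not_lt.mpr (zero_le_re_one_sub_exp θ))
  have h2 := Complex.cpow_conj (1 - Complex.exp (θ * Complex.I)) τ h1
  rw [Complex.conj_ofReal] at h2
  rw [h2, Complex.conj_conj, map_sub, map_one, ← Complex.exp_conj, map_mul, Complex.conj_ofReal, Complex.conj_I,
    mul_neg]

theorem moment_jackCircleWeight_zero {τ : ℝ} (hτ : 0 < τ) : moment (jackCircleWeight τ) 0 ≠ 0 := by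
  refine moment_zero_ne_zero (continuous_jackCircleWeight hτ) (fun θ => ?_) ?_
  · rw [jackCircleWeight_eq τ, Complex.ofReal_re]
    exact Complex.normSq_nonneg _
  · rw [jackCircleWeight_eq τ, Complex.ofReal_re, Complex.normSq_pos, Complex.exp_pi_mul_I]
    intro h
    rw [Complex.cpow_eq_zero_iff] at h
    norm_num at h

/-- Integrate the derivative of e^{ijθ}(1 - e^{iθ}) times the weight over (0, 2π). The factor 1 -
e^{iθ} vanishes at both ends and cancels the pole of the logarithmic derivative of the weight,
leaving a combination of two consecutive moments. Differentiability is needed only in the open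
interval, where the bases are in the slit plane. -/
theorem moment_jackCircleWeight_succ {τ : ℝ} (hτ : 0 < τ) (j : ℕ) :
    ((j : ℂ) + 1 + τ) * moment (jackCircleWeight τ) (j + 1 : ℕ) =
      (j - τ) * moment (jackCircleWeight τ) j := by
  have hc := continuous_jackCircleWeight hτ
  have hderiv : ∀ θ ∈ Set.Ioo 0 (2 * Real.pi), HasDerivAt (fun θ : ℝ =>
      Complex.exp ((j : ℤ) * θ * Complex.I) * (1 - Complex.exp (θ * Complex.I)) *
        jackCircleWeight τ θ)
      (Complex.I * ((j - τ) * (Complex.exp ((j : ℤ) * θ * Complex.I) * jackCircleWeight τ θ) -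
        (j + 1 + τ) * (Complex.exp ((j + 1 : ℕ) * θ * Complex.I) * jackCircleWeight τ θ))) θ := by
    intro θ hθ
    have hre : 0 < 1 - Real.cos θ := by
      have h1 := Real.cos_le_one θ
      have h2 : Real.cos θ ≠ 1 := fun h2 => by
        obtain ⟨n, hn⟩ := (Real.cos_eq_one_iff θ).mp h2
        have h3 : (0 : ℝ) < n := pos_of_mul_pos_left (hn ▸ hθ.1) Real.two_pi_pos.le
        have h4 : (n : ℝ) < 1 := by
          by_contra h4
          have := mul_le_mul_of_nonneg_right (not_lt.mp h4) Real.two_pi_pos.le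
          linarith [hθ.2]
        have h5 : 0 < n := by exact_mod_cast h3
        have h6 : n < 1 := by exact_mod_cast h4
        omega
      exact sub_pos.mpr (lt_of_le_of_ne h1 h2)
    have hs : (1 - Complex.exp (θ * Complex.I)) ∈ Complex.slitPlane := Or.inl (by
      rwa [Complex.sub_re, Complex.one_re, Complex.exp_ofReal_mul_I_re])
    have hs' : (1 - Complex.exp (-(θ * Complex.I))) ∈ Complex.slitPlane := Or.inl (by
      rwa [← neg_mul, ← Complex.ofReal_neg, Complex.sub_re, Complex.one_re,
        Complex.exp_ofReal_mul_I_re, Real.cos_neg])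
    have hne := Complex.slitPlane_ne_zero hs
    have hne' := Complex.slitPlane_ne_zero hs'
    have d0 : ∀ c : ℂ, HasDerivAt (fun z : ℂ => Complex.exp (c * z * Complex.I))
        (Complex.exp (c * θ * Complex.I) * (c * Complex.I)) θ := fun c => by
      simpa using (((hasDerivAt_id (θ : ℂ)).const_mul c).mul_const Complex.I).cexp
    have d1 : HasDerivAt (fun z : ℂ => 1 - Complex.exp (z * Complex.I))
        (-(Complex.exp (θ * Complex.I) * Complex.I)) θ := by
      simpa using (d0 1).const_sub 1
    have d2 : HasDerivAt (fun z : ℂ => 1 - Complex.exp (-(z * Complex.I)))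
        (Complex.exp (-(θ * Complex.I)) * Complex.I) θ := by
      simpa using (d0 (-1)).const_sub 1
    have d3 := (((d0 j).mul d1).mul ((d1.cpow_const (c := τ) hs).mul
      (d2.cpow_const (c := τ) hs'))).comp_ofReal
    refine d3.congr_deriv ?_
    have hpow : Complex.exp (((j + 1 : ℕ) : ℂ) * θ * Complex.I) =
        Complex.exp (j * θ * Complex.I) * Complex.exp (θ * Complex.I) := by
      rw [← Complex.exp_add]
      congr 1
      push_cast
      ring
    have hu := Complex.exp_ne_zero (θ * Complex.I)
    simp only [Pi.mul_apply, jackCircleWeight, Int.cast_natCast]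
    rw [Complex.cpow_sub _ _ hne, Complex.cpow_sub _ _ hne', hpow, Complex.cpow_one,
      Complex.cpow_one]
    rw [Complex.exp_neg] at hne' ⊢
    generalize Complex.exp (θ * Complex.I) = u at *
    generalize Complex.exp (j * θ * Complex.I) = v at *
    generalize (1 - u) ^ (τ : ℂ) = A at *
    generalize (1 - u⁻¹) ^ (τ : ℂ) = B at *
    have hu1 : (u - 1) ≠ 0 := fun h => hne (by linear_combination -h)
    have hu2 : 1 - u⁻¹ = (u - 1) / u := by field_simp
    rw [hu2]
    field_simp
    ring
  have h1 := intervalIntegral.integral_eq_sub_of_hasDerivAt_of_le Real.two_pi_pos.le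
    (by fun_prop) hderiv (Continuous.intervalIntegrable (by fun_prop) _ _)
  rw [intervalIntegral.integral_const_mul, intervalIntegral.integral_sub
    (Continuous.intervalIntegrable (by fun_prop) _ _)
    (Continuous.intervalIntegrable (by fun_prop) _ _), intervalIntegral.integral_const_mul,
    intervalIntegral.integral_const_mul] at h1
  have h2 : Complex.exp ((2 * Real.pi : ℝ) * Complex.I) = 1 := by
    push_cast; exact Complex.exp_two_pi_mul_I
  rw [h2] at h1
  simp only [Complex.ofReal_zero, zero_mul, Complex.exp_zero, sub_self, mul_zero,
    mul_eq_zero, Complex.I_ne_zero, false_or] at h1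
  rw [moment, moment]
  exact (sub_eq_zero.mp h1).symm

/-! ### The infinite `q`-shifted factorial -/

theorem summable_norm_mul_pow {q : ℝ} (h0 : 0 < q) (h1 : q < 1) (a : ℂ) : Summable fun i : ℕ => ‖-(a * (q : ℂ) ^ i)‖ := by
  simp only [norm_neg, norm_mul, norm_pow, Complex.norm_real, Real.norm_of_nonneg h0.le]
  exact (summable_geometric_of_lt_one h0.le h1).mul_left _

theorem multipliable_one_sub_mul_pow {q : ℝ} (h0 : 0 < q) (h1 : q < 1) (a : ℂ) : Multipliable fun i : ℕ => 1 - a * (q : ℂ) ^ i := by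
  simpa only [sub_eq_add_neg] using
    multipliable_one_add_of_summable (summable_norm_mul_pow h0 h1 a)

theorem qShiftedFactorialInf_eq {q : ℝ} (h0 : 0 < q) (h1 : q < 1) (a : ℂ) :
    qShiftedFactorialInf a q = (1 - a) * qShiftedFactorialInf (q * a) q := by
  have h2 : ∀ i : ℕ, 1 - a * (q : ℂ) ^ (i + 1) = 1 - q * a * (q : ℂ) ^ i := fun i => by ring
  rw [qShiftedFactorialInf, tprod_eq_zero_mul']
  · simp only [h2, pow_zero, mul_one]
    rfl
  · simp only [h2]
    exact multipliable_one_sub_mul_pow h0 h1 _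

theorem qShiftedFactorialInf_ne_zero {q : ℝ} (h0 : 0 < q) (h1 : q < 1) {a : ℂ} (ha : ∀ i : ℕ, 1 - a * (q : ℂ) ^ i ≠ 0) :
    qShiftedFactorialInf a q ≠ 0 := by
  have := tprod_one_add_ne_zero_of_summable (f := fun i : ℕ => -(a * (q : ℂ) ^ i))
    (by simpa only [← sub_eq_add_neg] using ha) (summable_norm_mul_pow h0 h1 a)
  simp only [← sub_eq_add_neg] at this
  exact this

theorem qShiftedFactorialInf_ne_zero_of_norm_lt {q : ℝ} (h0 : 0 < q) (h1 : q < 1) {a : ℂ} (ha : ‖a‖ < 1) :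
    qShiftedFactorialInf a q ≠ 0 := by
  refine qShiftedFactorialInf_ne_zero h0 h1 fun i hi => ?_
  have h2 : ‖a * (q : ℂ) ^ i‖ = 1 := by rw [← sub_eq_zero.mp hi, norm_one]
  rw [norm_mul, norm_pow, Complex.norm_real, Real.norm_of_nonneg h0.le] at h2
  have h3 := mul_le_of_le_one_right (norm_nonneg a) (pow_le_one₀ (n := i) h0.le h1.le)
  linarith

/-- On a ball around a the factors are bounded by a geometric series, so the product converges
locally uniformly. -/
theorem differentiable_qShiftedFactorialInf {q : ℝ} (h0 : 0 < q) (h1 : q < 1) :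
    Differentiable ℂ fun a : ℂ => qShiftedFactorialInf a q := by
  intro a
  have hs : IsOpen (Metric.ball (0 : ℂ) (‖a‖ + 1)) := Metric.isOpen_ball
  have h2 := Summable.hasProdLocallyUniformlyOn_nat_one_add (f := fun (i : ℕ) (z : ℂ) => -(z * (q : ℂ) ^ i))
    hs ((summable_geometric_of_lt_one h0.le h1).mul_left (‖a‖ + 1))
    (Filter.Eventually.of_forall fun i z hz => by
      rw [norm_neg, norm_mul, norm_pow, Complex.norm_real, Real.norm_of_nonneg h0.le]
      exact mul_le_mul_of_nonneg_right (mem_ball_zero_iff.mp hz).le (by positivity))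
    (fun i => by fun_prop)
  have h3 : DifferentiableOn ℂ (fun a : ℂ => qShiftedFactorialInf a q)
      (Metric.ball (0 : ℂ) (‖a‖ + 1)) := by
    have := TendstoLocallyUniformlyOn.differentiableOn h2 (Filter.Eventually.of_forall fun s => by
      fun_prop) hs
    simp only [← sub_eq_add_neg] at this
    exact this
  exact h3.differentiableAt (hs.mem_nhds (by simp))

theorem qShiftedFactorialInf_conj {q : ℝ} (h0 : 0 < q) (h1 : q < 1) (a : ℂ) : qShiftedFactorialInf ((starRingEnd ℂ) a) q =
    (starRingEnd ℂ) (qShiftedFactorialInf a q) := by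
  rw [qShiftedFactorialInf, qShiftedFactorialInf,
    (multipliable_one_sub_mul_pow h0 h1 a).map_tprod (starRingEnd ℂ) Complex.continuous_conj]
  simp

/-! ### The weight of the Macdonald polynomials -/

/-- The weight function on the unit circle, as a function on the punctured plane. -/
def qWeight (q t : ℝ) (z : ℂ) : ℂ :=
  qShiftedFactorialInf z q / qShiftedFactorialInf (t * z) q *
    (qShiftedFactorialInf z⁻¹ q / qShiftedFactorialInf (t * z⁻¹) q)

/-- The non-symmetric weight function, for which `(t - z) V(q z) = (1 - t z) V(z)`. -/
def qHalfWeight (q t : ℝ) (z : ℂ) : ℂ :=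
  qShiftedFactorialInf z q / qShiftedFactorialInf (t * z) q *
    (qShiftedFactorialInf (q * z⁻¹) q / qShiftedFactorialInf (q * (t * z⁻¹)) q)

theorem norm_ofReal_mul_lt {t : ℝ} (ht0 : 0 < t) (ht1 : t < 1) {z : ℂ} (hz : ‖z‖ ≤ 1) : ‖(t : ℂ) * z‖ < 1 := by
  rw [norm_mul, Complex.norm_real, Real.norm_of_nonneg ht0.le]
  nlinarith

/-- The denominators involve tz and qt/z, both of modulus at most t < 1 on the closed annulus. The
symmetric weight has t/z instead, with a pole at z = t that can lie inside; hence the detour through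
the half weight. -/
theorem qHalfWeight_differentiableAt {q t : ℝ} (h0 : 0 < q) (h1 : q < 1) (ht0 : 0 < t)
    (ht1 : t < 1) {z : ℂ} (hz : q ≤ ‖z‖) (hz' : ‖z‖ ≤ 1) :
    DifferentiableAt ℂ (qHalfWeight q t) z := by
  have hz0 : z ≠ 0 := norm_pos_iff.mp (h0.trans_le hz)
  have hd := differentiable_qShiftedFactorialInf h0 h1
  have d1 : DifferentiableAt ℂ (fun z : ℂ => qShiftedFactorialInf (t * z) q) z :=
    (hd _).comp z (by fun_prop)
  have d2 : DifferentiableAt ℂ (fun z : ℂ => qShiftedFactorialInf (q * z⁻¹) q) z :=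
    (hd _).comp z (by fun_prop (disch := assumption))
  have d3 : DifferentiableAt ℂ (fun z : ℂ => qShiftedFactorialInf (q * (t * z⁻¹)) q) z :=
    (hd _).comp z (by fun_prop (disch := assumption))
  refine ((hd z).div d1 ?_).mul (d2.div d3 ?_)
  · exact qShiftedFactorialInf_ne_zero_of_norm_lt h0 h1 (norm_ofReal_mul_lt ht0 ht1 hz')
  · refine qShiftedFactorialInf_ne_zero_of_norm_lt h0 h1 ?_
    rw [mul_left_comm]
    refine norm_ofReal_mul_lt ht0 ht1 ?_
    rw [norm_mul, norm_inv, Complex.norm_real, Real.norm_of_nonneg h0.le]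
    exact (div_le_one (h0.trans_le hz)).mpr hz

theorem one_sub_mul_ne_zero {t : ℝ} (ht0 : 0 < t) (ht1 : t < 1) {z : ℂ} (hz : ‖z‖ ≤ 1) : 1 - t * z ≠ 0 := fun h => by
  have := norm_ofReal_mul_lt ht0 ht1 hz
  rw [← sub_eq_zero.mp h, norm_one] at this
  exact lt_irrefl _ this

theorem qHalfWeight_mul {q : ℝ} (h0 : 0 < q) (t : ℝ) (z : ℂ) : qHalfWeight q t (q * z) = qHalfWeight q t z⁻¹ := by
  have hq : (q : ℂ) ≠ 0 := by exact_mod_cast h0.ne'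
  rw [qHalfWeight, qHalfWeight, inv_inv, mul_inv, mul_left_comm (t : ℂ) (q : ℂ)⁻¹,
    mul_inv_cancel_left₀ hq, mul_inv_cancel_left₀ hq, mul_left_comm (t : ℂ) (q : ℂ)]
  ring

theorem qHalfWeight_eq {q : ℝ} (h0 : 0 < q) (h1 : q < 1) (t : ℝ) (z : ℂ) :
    qHalfWeight q t z = (1 - z) / (1 - t * z) *
      (qShiftedFactorialInf (q * z) q / qShiftedFactorialInf (q * (t * z)) q *
        (qShiftedFactorialInf (q * z⁻¹) q / qShiftedFactorialInf (q * (t * z⁻¹)) q)) := by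
  rw [qHalfWeight, qShiftedFactorialInf_eq h0 h1 z, qShiftedFactorialInf_eq h0 h1 (t * z),
    mul_div_mul_comm, mul_assoc]

theorem qWeight_eq_mul {q : ℝ} (h0 : 0 < q) (h1 : q < 1) (t : ℝ) (z : ℂ) :
    qWeight q t z = (1 - z) / (1 - t * z) * ((1 - z⁻¹) / (1 - t * z⁻¹)) *
      (qShiftedFactorialInf (q * z) q / qShiftedFactorialInf (q * (t * z)) q *
        (qShiftedFactorialInf (q * z⁻¹) q / qShiftedFactorialInf (q * (t * z⁻¹)) q)) := by
  rw [qWeight, qShiftedFactorialInf_eq h0 h1 z, qShiftedFactorialInf_eq h0 h1 (t * z),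
    qShiftedFactorialInf_eq h0 h1 z⁻¹, qShiftedFactorialInf_eq h0 h1 (t * z⁻¹),
    mul_div_mul_comm, mul_div_mul_comm, mul_mul_mul_comm]

theorem qHalfWeight_inv {q t : ℝ} (h0 : 0 < q) (h1 : q < 1) (ht0 : 0 < t) (ht1 : t < 1) {z : ℂ}
    (hz : ‖z‖ = 1) : (t - z) * qHalfWeight q t z⁻¹ = (1 - t * z) * qHalfWeight q t z := by
  have hz0 : z ≠ 0 := norm_pos_iff.mp (by rw [hz]; exact one_pos)
  have e1 := one_sub_mul_ne_zero ht0 ht1 hz.le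
  have e2 := one_sub_mul_ne_zero ht0 ht1 (z := z⁻¹) (by rw [norm_inv, hz, inv_one])
  have e3 : z - t ≠ 0 := fun h => e2 (by rw [← sub_eq_zero.mp h, mul_inv_cancel₀ hz0, sub_self])
  have e4 : 1 - t * z⁻¹ = (z - t) / z := by field_simp
  rw [qHalfWeight_eq h0 h1, qHalfWeight_eq h0 h1, inv_inv, e4,
    mul_comm (qShiftedFactorialInf (q * z⁻¹) q / _)]
  generalize qShiftedFactorialInf (q * z) q / qShiftedFactorialInf (q * (t * z)) q *
        (qShiftedFactorialInf (q * z⁻¹) q / qShiftedFactorialInf (q * (t * z⁻¹)) q) = a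
  field_simp
  ring

/-- With the common factor removed this is the identity (z-t)/(z-1) + (1-tz)/(1-z) = 1 + t:
symmetrizing the half weight recovers the weight up to a constant. -/
theorem qWeight_eq {q t : ℝ} (h0 : 0 < q) (h1 : q < 1) (ht0 : 0 < t) (ht1 : t < 1) {z : ℂ}
    (hz : ‖z‖ = 1) : (1 + t) * qWeight q t z = qHalfWeight q t z + qHalfWeight q t z⁻¹ := by
  have hz0 : z ≠ 0 := norm_pos_iff.mp (by rw [hz]; exact one_pos)
  have e1 := one_sub_mul_ne_zero ht0 ht1 hz.le
  have e2 := one_sub_mul_ne_zero ht0 ht1 (z := z⁻¹) (by rw [norm_inv, hz, inv_one])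
  have e3 : z - t ≠ 0 := fun h => e2 (by rw [← sub_eq_zero.mp h, mul_inv_cancel₀ hz0, sub_self])
  have e4 : 1 - t * z⁻¹ = (z - t) / z := by field_simp
  rw [qHalfWeight_eq h0 h1, qHalfWeight_eq h0 h1, qWeight_eq_mul h0 h1, inv_inv, e4,
    mul_comm (qShiftedFactorialInf (q * z⁻¹) q / _)]
  generalize qShiftedFactorialInf (q * z) q / qShiftedFactorialInf (q * (t * z)) q *
        (qShiftedFactorialInf (q * z⁻¹) q / qShiftedFactorialInf (q * (t * z⁻¹)) q) = a
  field_simp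
  ring

theorem continuous_qWeight {q t : ℝ} (h0 : 0 < q) (h1 : q < 1) (ht0 : 0 < t)
    (ht1 : t < 1) : Continuous fun θ : ℝ => qWeight q t (Complex.exp (θ * Complex.I)) := by
  have hd := (differentiable_qShiftedFactorialInf h0 h1).continuous
  have hn : ∀ θ : ℝ, ‖Complex.exp (θ * Complex.I)‖ = 1 := Complex.norm_exp_ofReal_mul_I
  refine ((hd.comp (by fun_prop)).div (hd.comp (by fun_prop)) fun θ => ?_).mul
    ((hd.comp (Continuous.inv₀ (by fun_prop) fun θ => Complex.exp_ne_zero _)).div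
      (hd.comp (continuous_const.mul (Continuous.inv₀ (by fun_prop)
        fun θ => Complex.exp_ne_zero _))) fun θ => ?_)
  · exact qShiftedFactorialInf_ne_zero_of_norm_lt h0 h1
      (norm_ofReal_mul_lt ht0 ht1 (hn θ).le)
  · exact qShiftedFactorialInf_ne_zero_of_norm_lt h0 h1
      (norm_ofReal_mul_lt ht0 ht1 (by rw [norm_inv, hn, inv_one]))

theorem qWeight_inv (q t : ℝ) (z : ℂ) : qWeight q t z⁻¹ = qWeight q t z := by
  rw [qWeight, qWeight, inv_inv, mul_comm]

theorem qWeight_eq_normSq {q : ℝ} (h0 : 0 < q) (h1 : q < 1) (t : ℝ) {z : ℂ} (hz : ‖z‖ = 1) :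
    qWeight q t z =
      (Complex.normSq (qShiftedFactorialInf z q / qShiftedFactorialInf (t * z) q) : ℝ) := by
  have h2 : z⁻¹ = (starRingEnd ℂ) z := by
    rw [Complex.inv_def, Complex.normSq_eq_norm_sq, hz]
    simp
  have h3 : (t : ℂ) * (starRingEnd ℂ) z = (starRingEnd ℂ) (t * z) := by
    rw [map_mul, Complex.conj_ofReal]
  rw [Complex.normSq_eq_conj_mul_self, mul_comm, qWeight, h2, h3, qShiftedFactorialInf_conj h0 h1,
    qShiftedFactorialInf_conj h0 h1, map_div₀]

theorem circle_periodic (F : ℂ → ℂ) :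
    Function.Periodic (fun θ : ℝ => F (Complex.exp (θ * Complex.I))) (2 * Real.pi) := fun θ => by
  have h1 : ((θ + 2 * Real.pi : ℝ) : ℂ) * Complex.I = θ * Complex.I + 2 * Real.pi * Complex.I := by
    push_cast; ring
  simp only [h1, Complex.exp_periodic _]

theorem moment_qWeight_zero {q t : ℝ} (h0 : 0 < q) (h1 : q < 1) (ht0 : 0 < t) (ht1 : t < 1) :
    moment (fun θ => qWeight q t (Complex.exp (θ * Complex.I))) 0 ≠ 0 := by
  refine moment_zero_ne_zero (continuous_qWeight h0 h1 ht0 ht1) (fun θ => ?_) ?_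
  · rw [qWeight_eq_normSq h0 h1 t (Complex.norm_exp_ofReal_mul_I θ), Complex.ofReal_re]
    exact Complex.normSq_nonneg _
  · rw [qWeight_eq_normSq h0 h1 t (Complex.norm_exp_ofReal_mul_I _), Complex.ofReal_re,
      Complex.normSq_pos, Complex.exp_pi_mul_I]
    refine div_ne_zero (qShiftedFactorialInf_ne_zero h0 h1 fun i hi => ?_)
      (qShiftedFactorialInf_ne_zero_of_norm_lt h0 h1 (norm_ofReal_mul_lt ht0 ht1 (by simp)))
    have h2 : (1 : ℝ) + q ^ i = 0 := by
      have : ((1 + q ^ i : ℝ) : ℂ) = 0 := by push_cast; linear_combination hi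
      exact_mod_cast this
    linarith [pow_pos h0 i]

theorem continuous_qHalfWeight {q t : ℝ} (h0 : 0 < q) (h1 : q < 1) (ht0 : 0 < t) (ht1 : t < 1) :
    Continuous fun θ : ℝ => qHalfWeight q t (Complex.exp (θ * Complex.I)) :=
  continuous_iff_continuousAt.mpr fun θ => ContinuousAt.comp
    (f := fun θ : ℝ => Complex.exp (θ * Complex.I))
    (qHalfWeight_differentiableAt h0 h1 ht0 ht1
      (by rw [Complex.norm_exp_ofReal_mul_I]; exact h1.le)
      (Complex.norm_exp_ofReal_mul_I θ).le).continuousAt (by fun_prop)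

/-- Shifting the contour of integration from the unit circle to the circle of radius `q`. -/
theorem integral_circle_shift {q : ℝ} (h0 : 0 < q) (h1 : q < 1) {F : ℂ → ℂ}
    (hF : ∀ z, q ≤ ‖z‖ → ‖z‖ ≤ 1 → DifferentiableAt ℂ F z) :
    ∫ θ in (0 : ℝ)..2 * Real.pi, F (Complex.exp (θ * Complex.I)) =
      ∫ θ in (0 : ℝ)..2 * Real.pi, F (q * Complex.exp (θ * Complex.I)) := by
  have hd : ∀ z, q ≤ ‖z‖ → ‖z‖ ≤ 1 → DifferentiableAt ℂ (fun z => z⁻¹ * F z) z :=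
    fun z hz hz' => (differentiableAt_inv (norm_pos_iff.mp (h0.trans_le hz))).mul (hF z hz hz')
  have h2 := Complex.circleIntegral_eq_of_differentiable_on_annulus_off_countable h0 h1.le (c := 0)
    (f := fun z => z⁻¹ * F z) Set.countable_empty
    (fun z hz => (hd z (by simpa using hz.2) (by simpa using hz.1)).continuousAt.continuousWithinAt)
    (fun z hz => by
      have h3 := hz.1.1
      have h4 := hz.1.2
      rw [mem_ball_zero_iff] at h3
      rw [mem_closedBall_zero_iff, not_le] at h4
      exact hd z h4.le h3.le)
  have h3 : ∀ R : ℝ, R ≠ 0 → (∮ z in C(0, R), z⁻¹ * F z) =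
      Complex.I * ∫ θ in (0 : ℝ)..2 * Real.pi, F (R * Complex.exp (θ * Complex.I)) := by
    intro R hR
    rw [circleIntegral, ← intervalIntegral.integral_const_mul]
    refine intervalIntegral.integral_congr fun θ _ => ?_
    have hR' : (R : ℂ) ≠ 0 := by exact_mod_cast hR
    have := Complex.exp_ne_zero (θ * Complex.I)
    simp only [deriv_circleMap, circleMap, zero_add, smul_eq_mul]
    field_simp
  rw [h3 1 one_ne_zero, h3 q h0.ne'] at h2
  simpa using mul_left_cancel₀ Complex.I_ne_zero h2

theorem exp_int_mul_eq_zpow (k : ℤ) (θ : ℝ) :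
    Complex.exp (k * θ * Complex.I) = Complex.exp (θ * Complex.I) ^ k := by
  rw [mul_assoc, Complex.exp_int_mul]

/-- Move the contour from |z| = 1 to |z| = q inside the annulus of holomorphy. There z^k contributes
q^k, and the half weight at qz equals its value at z⁻¹. -/
theorem moment_qHalfWeight_inv {q t : ℝ} (h0 : 0 < q) (h1 : q < 1) (ht0 : 0 < t) (ht1 : t < 1)
    (k : ℤ) : moment (fun θ => qHalfWeight q t (Complex.exp (θ * Complex.I))) k =
      (q : ℂ) ^ k * moment (fun θ => qHalfWeight q t (Complex.exp (θ * Complex.I))⁻¹) k := by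
  rw [moment, moment, ← intervalIntegral.integral_const_mul]
  simp only [exp_int_mul_eq_zpow]
  rw [integral_circle_shift h0 h1 (F := fun z => z ^ k * qHalfWeight q t z)]
  · refine intervalIntegral.integral_congr fun θ _ => ?_
    simp only [qHalfWeight_mul h0, mul_zpow, mul_assoc]
  · intro z hz hz'
    exact (differentiableAt_zpow.mpr (Or.inl (norm_pos_iff.mp (h0.trans_le hz)))).mul
      (qHalfWeight_differentiableAt h0 h1 ht0 ht1 hz hz')

theorem moment_qHalfWeight_neg {q t : ℝ} (h0 : 0 < q) (h1 : q < 1) (ht0 : 0 < t) (ht1 : t < 1)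
    (k : ℤ) : moment (fun θ => qHalfWeight q t (Complex.exp (θ * Complex.I))) k =
      (q : ℂ) ^ k * moment (fun θ => qHalfWeight q t (Complex.exp (θ * Complex.I))) (-k) := by
  rw [moment_qHalfWeight_inv h0 h1 ht0 ht1, ← moment_comp_neg (circle_periodic _)]
  simp [Complex.exp_neg]

theorem moment_add {h₁ h₂ : ℝ → ℂ} (hc₁ : Continuous h₁) (hc₂ : Continuous h₂) (k : ℤ) :
    moment (fun θ => h₁ θ + h₂ θ) k = moment h₁ k + moment h₂ k := by
  rw [moment, moment, moment, ← intervalIntegral.integral_add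
    (Continuous.intervalIntegrable (by fun_prop) _ _)
    (Continuous.intervalIntegrable (by fun_prop) _ _)]
  simp only [mul_add]

theorem moment_const_mul (c : ℂ) (h : ℝ → ℂ) (k : ℤ) :
    moment (fun θ => c * h θ) k = c * moment h k := by
  rw [moment, moment, ← intervalIntegral.integral_const_mul]
  simp only [mul_left_comm]

theorem moment_exp_mul (h : ℝ → ℂ) (k : ℤ) :
    moment (fun θ => Complex.exp (θ * Complex.I) * h θ) k = moment h (k + 1) := by
  rw [moment, moment]
  refine intervalIntegral.integral_congr fun θ _ => ?_
  simp only [exp_int_mul_eq_zpow]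
  rw [zpow_add_one₀ (Complex.exp_ne_zero _), mul_assoc]

/-- The Fourier coefficients of the functional equation `qHalfWeight_inv`; the factor z raises the
index by one. -/
theorem moment_qHalfWeight_succ {q t : ℝ} (h0 : 0 < q) (h1 : q < 1) (ht0 : 0 < t) (ht1 : t < 1)
    (k : ℤ) :
    t * moment (fun θ => qHalfWeight q t (Complex.exp (θ * Complex.I))) (-k) -
      moment (fun θ => qHalfWeight q t (Complex.exp (θ * Complex.I))) (-(k + 1)) =
    moment (fun θ => qHalfWeight q t (Complex.exp (θ * Complex.I))) k -
      t * moment (fun θ => qHalfWeight q t (Complex.exp (θ * Complex.I))) (k + 1) := by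
  have hc := continuous_qHalfWeight h0 h1 ht0 ht1
  have hc' : Continuous fun θ : ℝ => qHalfWeight q t (Complex.exp (θ * Complex.I))⁻¹ :=
    (hc.comp continuous_neg).congr fun θ => by simp [Complex.exp_neg]
  have h2 : ∀ k, moment (fun θ => qHalfWeight q t (Complex.exp (θ * Complex.I))) (-k) =
      moment (fun θ => qHalfWeight q t (Complex.exp (θ * Complex.I))⁻¹) k := fun k => by
    rw [← moment_comp_neg (circle_periodic _)]
    simp [Complex.exp_neg]
  rw [h2, h2, ← moment_exp_mul, ← moment_exp_mul, ← moment_const_mul, ← moment_const_mul,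
    sub_eq_iff_eq_add, sub_add_eq_add_sub, eq_sub_iff_add_eq, ← moment_add (by fun_prop)
    (by fun_prop), ← moment_add (by fun_prop) (by fun_prop)]
  congr 1
  ext θ
  linear_combination qHalfWeight_inv h0 h1 ht0 ht1 (Complex.norm_exp_ofReal_mul_I θ)

theorem moment_qWeight {q t : ℝ} (h0 : 0 < q) (h1 : q < 1) (ht0 : 0 < t) (ht1 : t < 1) (k : ℕ) :
    (1 + t) * moment (fun θ => qWeight q t (Complex.exp (θ * Complex.I))) k = (1 + (q : ℂ) ^ k) *
      moment (fun θ => qHalfWeight q t (Complex.exp (θ * Complex.I))) (-k) := by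
  have hc := continuous_qHalfWeight h0 h1 ht0 ht1
  have hc' : Continuous fun θ : ℝ => qHalfWeight q t (Complex.exp (θ * Complex.I))⁻¹ :=
    (hc.comp continuous_neg).congr fun θ => by simp [Complex.exp_neg]
  have h2 := moment_qHalfWeight_neg h0 h1 ht0 ht1 k
  rw [zpow_natCast] at h2
  rw [← moment_const_mul, add_mul, ← h2, one_mul, add_comm _ (moment _ _),
    add_comm (moment _ _), ← moment_comp_neg (circle_periodic _)]
  simp only [Complex.ofReal_neg, neg_mul, Complex.exp_neg]
  rw [← moment_add hc' hc]
  congr 1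
  ext θ
  rw [qWeight_eq h0 h1 ht0 ht1 (Complex.norm_exp_ofReal_mul_I θ), add_comm]

/-- With v_k the moments of the half weight, v_k = q^k v_{-k} turns the functional equation into (t
- q^j) v_{-j} = (1 - t q^{j+1}) v_{-(j+1)}; the factors 1 + q^k then come from expressing the
moments of the weight through v_{-k}. -/
theorem moment_qWeight_succ {q t : ℝ} (h0 : 0 < q) (h1 : q < 1) (ht0 : 0 < t) (ht1 : t < 1)
    (j : ℕ) : moment (fun θ => qWeight q t (Complex.exp (θ * Complex.I))) (j + 1 : ℕ) *
      (1 - t * (q : ℂ) ^ (j + 1)) * (1 + (q : ℂ) ^ j) =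
    moment (fun θ => qWeight q t (Complex.exp (θ * Complex.I))) j * (t - (q : ℂ) ^ j) *
      (1 + (q : ℂ) ^ (j + 1)) := by
  have hq : (q : ℂ) ^ j ≠ 0 := pow_ne_zero _ (by exact_mod_cast h0.ne')
  have ht : (1 + t : ℂ) ≠ 0 := by
    rw [← Complex.ofReal_one, ← Complex.ofReal_add, Complex.ofReal_ne_zero]
    positivity
  have e1 := moment_qWeight h0 h1 ht0 ht1 j
  have e2 := moment_qWeight h0 h1 ht0 ht1 (j + 1)
  have e3 := moment_qHalfWeight_succ h0 h1 ht0 ht1 j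
  have e4 := moment_qHalfWeight_neg h0 h1 ht0 ht1 j
  have e5 := moment_qHalfWeight_neg h0 h1 ht0 ht1 (j + 1 : ℕ)
  rw [zpow_natCast] at e4 e5
  push_cast at e2 e5 ⊢
  rw [e4, e5] at e3
  refine mul_left_cancel₀ ht ?_
  linear_combination (1 - t * (q : ℂ) ^ (j + 1)) * (1 + (q : ℂ) ^ j) * e2 -
    (t - (q : ℂ) ^ j) * (1 + (q : ℂ) ^ (j + 1)) * e1 -
    (1 + (q : ℂ) ^ j) * (1 + (q : ℂ) ^ (j + 1)) * e3

/-! ### Macdonald and Jack polynomials in two variables -/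

theorem filter_fst_lt_snd : (univ : Finset (Fin 2 × Fin 2)).filter (fun p => p.1 < p.2) =
    {(0, 1)} := by decide

theorem macdonald_iff {q t : ℝ} (h0 : 0 < q) (h1 : q < 1) (ht0 : 0 < t) (ht1 : t < 1)
    {m₁ m₂ : ℕ} (hm : m₂ ≤ m₁) (P : MvPolynomial (Fin 2) ℂ) :
    IsMacdonald q t ![m₁, m₂] P ↔ P = orthMv (qCoeff q t) m₁ m₂ := by
  have hper := circle_periodic (qWeight q t)
  have hw : IsMomentSeq (fun k => 1 - t * (q : ℂ) ^ k) (fun k => 1 - (t : ℂ) ^ 2 * (q : ℂ) ^ k)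
      (qCoeff q t) (moment fun θ => qWeight q t (Complex.exp (θ * Complex.I))) :=
    isMomentSeq_q (by exact_mod_cast h0.ne') (one_sub_pow_ne_zero h0 h1)
      (fun k => by exact_mod_cast (by positivity : 0 < 1 + q ^ k).ne')
      (one_sub_mul_pow_ne_zero h0 h1 ht0 ht1)
      (moment_neg hper fun θ => by
        rw [Complex.ofReal_neg, neg_mul, Complex.exp_neg, qWeight_inv])
      (moment_qWeight_zero h0 h1 ht0 ht1) (moment_qWeight_succ h0 h1 ht0 ht1)
  have hd : ∀ k : ℕ, 1 - (t : ℂ) ^ 2 * (q : ℂ) ^ k ≠ 0 := by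
    have := one_sub_mul_pow_ne_zero h0 h1 (pow_pos ht0 2) (pow_lt_one₀ ht0.le ht1 two_ne_zero)
    simpa only [Complex.ofReal_pow] using this
  refine isOrthogonalPoly_iff hw
    (recurrenceData_q (one_sub_pow_ne_zero h0 h1) (one_sub_mul_pow_ne_zero h0 h1 ht0 ht1)) hd
    (K := -(2 * Real.pi)) (by simp [Real.pi_ne_zero])
    (torusIntegral_eq_pairing (continuous_qWeight h0 h1 ht0 ht1) hper fun x y => ?_)
    (antitone_fin_two.mpr hm) P
  have hz : Complex.exp ((x - y : ℝ) * Complex.I) =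
      Complex.exp (x * Complex.I) * (Complex.exp (y * Complex.I))⁻¹ := by
    rw [← Complex.exp_neg, ← Complex.exp_add]
    congr 1
    push_cast
    ring
  simp only [macdonaldWeight, filter_fst_lt_snd, prod_singleton, Pi.inv_apply,
    Matrix.cons_val_zero, Matrix.cons_val_one]
  rw [hz, qWeight, mul_inv, mul_assoc, mul_assoc]

theorem jack_iff {τ : ℝ} (hτ : 0 < τ) {m₁ m₂ : ℕ} (hm : m₂ ≤ m₁) (P : MvPolynomial (Fin 2) ℂ) :
    IsJack τ ![m₁, m₂] P ↔ P = orthMv (jackCoeff τ) m₁ m₂ := by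
  have hper := jackCircleWeight_periodic τ
  have hne := ofReal_add_natCast_ne_zero hτ
  have hw : IsMomentSeq (fun k => (τ : ℂ) + k) (fun k => 2 * (τ : ℂ) + k) (jackCoeff τ)
      (moment (jackCircleWeight τ)) :=
    isMomentSeq_jack hne (moment_neg hper (jackCircleWeight_neg τ))
      (moment_jackCircleWeight_zero hτ) (moment_jackCircleWeight_succ hτ)
  refine isOrthogonalPoly_iff hw (recurrenceData_jack hne)
    (fun k => by exact_mod_cast (by positivity : 0 < 2 * τ + k).ne')
    (K := -(2 * Real.pi)) (by simp [Real.pi_ne_zero])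
    (torusIntegral_eq_pairing (continuous_jackCircleWeight hτ) hper fun x y => ?_)
    (antitone_fin_two.mpr hm) P
  have hz : Complex.exp (x * Complex.I) * (Complex.exp (y * Complex.I))⁻¹ =
      Complex.exp ((x - y : ℝ) * Complex.I) := by
    rw [← Complex.exp_neg, ← Complex.exp_add]
    congr 1
    push_cast
    ring
  simp only [jackWeight, filter_fst_lt_snd, prod_singleton, Pi.inv_apply,
    Matrix.cons_val_zero, Matrix.cons_val_one]
  rw [← mul_inv, hz, jackCircleWeight, Complex.exp_neg]

/-! ### Explicit forms of the Macdonald and Jack polynomials -/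

theorem eval_orthMv_of_ne_zero (g : ℕ → ℂ) {m₁ m₂ : ℕ} (hm : m₂ ≤ m₁) {x₁ : ℂ} (x₂ : ℂ)
    (hx₁ : x₁ ≠ 0) : MvPolynomial.eval ![x₁, x₂] (orthMv g m₁ m₂) = x₁ ^ m₁ * x₂ ^ m₂ *
      ∑ k ∈ range (m₁ - m₂ + 1), g k * g (m₁ - m₂ - k) / g (m₁ - m₂) * (x₂ / x₁) ^ k := by
  rw [eval_orthMv, mul_sum]
  refine sum_congr rfl fun k hk => ?_
  have : m₁ = m₁ - k + k := by have := mem_range.mp hk; omega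
  have h1 : x₁ ^ m₁ = x₁ ^ (m₁ - k) * x₁ ^ k := by rw [← pow_add, ← this]
  simp only [Matrix.cons_val_zero, Matrix.cons_val_one]
  rw [h1, div_pow, pow_add x₂]
  field_simp

/-- Choose θ with e^{iθ} = x₁/s; then s² = x₁x₂ gives e^{-iθ} = x₂/s. The choice works for either
square root s, so no branch has to be fixed. -/
theorem exists_cos_eq {x₁ x₂ s : ℂ} (hs : s ≠ 0) (h : s ^ 2 = x₁ * x₂) :
    ∃ θ : ℂ, Complex.cos θ = (x₁ + x₂) / (2 * s) ∧ ∀ m₁ m₂ j : ℕ, m₂ + j ≤ m₁ →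
      s ^ (m₁ + m₂) * Complex.exp (Complex.I * (((m₁ - m₂ : ℕ) : ℂ) - 2 * j) * θ) =
        x₁ ^ (m₁ - j) * x₂ ^ (m₂ + j) := by
  have hx : x₁ * x₂ ≠ 0 := h ▸ pow_ne_zero 2 hs
  have hx₁ := left_ne_zero_of_mul hx
  have hx₂ := right_ne_zero_of_mul hx
  have hu : x₁ / s ≠ 0 := div_ne_zero hx₁ hs
  have h1 : -Complex.I * Complex.log (x₁ / s) * Complex.I = Complex.log (x₁ / s) := by
    linear_combination -Complex.log (x₁ / s) * Complex.I_sq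
  have hinv : (x₁ / s)⁻¹ = x₂ / s := by
    rw [inv_div, div_eq_div_iff hx₁ hs]
    linear_combination h
  refine ⟨-Complex.I * Complex.log (x₁ / s), ?_, fun m₁ m₂ j hj => ?_⟩
  · rw [Complex.cos, neg_mul _ Complex.I, h1, Complex.exp_neg, Complex.exp_log hu, hinv]
    field_simp
  · have h2 : Complex.I * (((m₁ - m₂ : ℕ) : ℂ) - 2 * j) * (-Complex.I * Complex.log (x₁ / s)) =
        (m₁ - j : ℕ) * Complex.log (x₁ / s) + -((m₂ + j : ℕ) * Complex.log (x₁ / s)) := by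
      rw [Nat.cast_sub (by omega), Nat.cast_sub (by omega), Nat.cast_add]
      linear_combination (-((m₁ : ℂ) - m₂ - 2 * j) * Complex.log (x₁ / s)) * Complex.I_sq
    rw [h2, Complex.exp_add, Complex.exp_neg, Complex.exp_nat_mul, Complex.exp_nat_mul,
      Complex.exp_log hu, ← inv_pow, hinv, div_pow, div_pow,
      show s ^ (m₁ + m₂) = s ^ (m₁ - j) * s ^ (m₂ + j) by rw [← pow_add]; congr 1; omega]
    field_simp

/-- The expansions of `orthMv` in monomials and in trigonometric functions, for coefficients
`a k / c k`. -/
theorem eval_orthMv_div {a c g : ℕ → ℂ} (hg : ∀ k, g k = a k / c k) (m₁ m₂ : ℕ) (x₁ x₂ : ℂ) :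
    MvPolynomial.eval ![x₁, x₂] (orthMv g m₁ m₂) = c (m₁ - m₂) / a (m₁ - m₂) *
      ∑ j ∈ range (m₁ - m₂ + 1), a j * a (m₁ - m₂ - j) / (c j * c (m₁ - m₂ - j)) *
        x₁ ^ (m₁ - j) * x₂ ^ (m₂ + j) := by
  rw [eval_orthMv, mul_sum]
  refine sum_congr rfl fun j _ => ?_
  simp only [hg, Matrix.cons_val_zero, Matrix.cons_val_one]
  rw [div_div_eq_mul_div, div_mul_div_comm]
  ring

theorem eval_orthMv_cos {a c g : ℕ → ℂ} (hg : ∀ k, g k = a k / c k) {m₁ m₂ : ℕ} (hm : m₂ ≤ m₁)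
    {p : Polynomial ℂ} (hp : ∀ θ, p.eval (Complex.cos θ) = ∑ j ∈ range (m₁ - m₂ + 1),
      a j * a (m₁ - m₂ - j) / (c j * c (m₁ - m₂ - j)) *
        Complex.exp (Complex.I * (((m₁ - m₂ : ℕ) : ℂ) - 2 * j) * θ))
    {x₁ x₂ s : ℂ} (hs : s ≠ 0) (h : s ^ 2 = x₁ * x₂) :
    MvPolynomial.eval ![x₁, x₂] (orthMv g m₁ m₂) = c (m₁ - m₂) / a (m₁ - m₂) * s ^ (m₁ + m₂) *
      p.eval ((x₁ + x₂) / (2 * s)) := by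
  obtain ⟨θ, hθ, h1⟩ := exists_cos_eq hs h
  rw [eval_orthMv_div hg, ← hθ, hp, mul_assoc, mul_sum (range _) _ (s ^ (m₁ + m₂))]
  congr 1
  refine sum_congr rfl fun j hj => ?_
  have := mem_range.mp hj
  rw [mul_left_comm, h1 m₁ m₂ j (by omega), mul_assoc]

theorem existsUnique_of_iff {α : Type*} {p : α → Prop} {a : α} (h : ∀ x, p x ↔ x = a) :
    ∃! x, p x :=
  ⟨a, (h a).mpr rfl, fun x hx => (h x).mp hx⟩

end InterpolationPoly

end

/-! ### The theorem -/

open InterpolationPoly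

theorem mainTheorem7 (m₁ m₂ : ℕ) (hm : m₂ ≤ m₁) :
    (∀ q t : ℝ, 0 < q → q < 1 → 0 < t → t < 1 →
      -- interpolation Macdonald polynomials
      ((∃! P : MvPolynomial (Fin 2) ℂ, IsInterpolationMacdonald q t ![m₁, m₂] P) ∧
        ∀ P : MvPolynomial (Fin 2) ℂ, IsInterpolationMacdonald q t ![m₁, m₂] P →
          ∀ x₁ x₂ : ℂ, x₁ ≠ 0 → x₂ ≠ 0 → (∀ j : ℕ, m₂ ≤ j → j < m₁ → x₂ ≠ (q : ℂ) ^ j) →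
            MvPolynomial.eval ![x₁, x₂] P =
              x₁ ^ m₂ * x₂ ^ m₁ * qShiftedFactorial x₁⁻¹ q m₂ * qShiftedFactorial x₂⁻¹ q m₁ *
                qHyp q (m₁ - m₂)
                  [(t : ℂ), (q : ℂ) ^ (1 - (m₁ : ℤ)) * (t : ℂ)⁻¹ * x₁]
                  [(q : ℂ) ^ (1 - (m₁ : ℤ) + (m₂ : ℤ)) * (t : ℂ)⁻¹, (q : ℂ) ^ (1 - (m₁ : ℤ)) * x₂]
                  q) ∧
      -- Macdonald polynomials
      ((∃! P : MvPolynomial (Fin 2) ℂ, IsMacdonald q t ![m₁, m₂] P) ∧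
        ∀ P : MvPolynomial (Fin 2) ℂ, IsMacdonald q t ![m₁, m₂] P →
          (∀ x₁ x₂ : ℂ, x₁ ≠ 0 →
            MvPolynomial.eval ![x₁, x₂] P =
              x₁ ^ m₁ * x₂ ^ m₂ *
                qHyp q (m₁ - m₂) [(t : ℂ)] [(q : ℂ) ^ (1 - (m₁ : ℤ) + (m₂ : ℤ)) * (t : ℂ)⁻¹]
                  (q * x₂ / (t * x₁))) ∧
          (∀ x₁ x₂ : ℂ,
            MvPolynomial.eval ![x₁, x₂] P =
              qShiftedFactorial q q (m₁ - m₂) / qShiftedFactorial t q (m₁ - m₂) *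
                ∑ j ∈ Finset.range (m₁ - m₂ + 1),
                  qShiftedFactorial t q j * qShiftedFactorial t q (m₁ - m₂ - j) /
                    (qShiftedFactorial q q j * qShiftedFactorial q q (m₁ - m₂ - j)) *
                    x₁ ^ (m₁ - j) * x₂ ^ (m₂ + j)) ∧
          -- `s` is any square root of `x₁ x₂`
          (∀ x₁ x₂ s : ℂ, s ≠ 0 → s ^ 2 = x₁ * x₂ →
            MvPolynomial.eval ![x₁, x₂] P =
              qShiftedFactorial q q (m₁ - m₂) / qShiftedFactorial t q (m₁ - m₂) *
                s ^ (m₁ + m₂) *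
                (qUltraspherical t q (m₁ - m₂)).eval ((x₁ + x₂) / (2 * s))))) ∧
    (∀ τ : ℝ, 0 < τ →
      -- `BC₂`-type interpolation Jack polynomials
      (∀ α : ℂ, (∀ i j : ℕ, 0 < i → (i : ℂ) + (j : ℂ) * (τ : ℂ) + 2 * α ≠ 0) →
        (∀ᶠ q in nhdsWithin (1 : ℝ) (Set.Iio 1),
          ∃! P : LaurentPoly 2,
            IsBCInterpolationMacdonald q (q ^ τ) ((q : ℂ) ^ α) ![m₁, m₂] P) ∧
        (∃! F : MvPolynomial (Fin 2) ℂ, IsBCInterpolationJack τ α ![m₁, m₂] F) ∧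
        ∀ F : MvPolynomial (Fin 2) ℂ, IsBCInterpolationJack τ α ![m₁, m₂] F →
          ∀ x₁ x₂ : ℂ,
            (∀ j : ℕ, j < m₁ - m₂ →
              (m₂ : ℂ) + τ + α + x₁ + j ≠ 0 ∧ (m₂ : ℂ) + τ + α - x₁ + j ≠ 0) →
            MvPolynomial.eval ![x₁, x₂] F =
              (-1) ^ (m₁ + m₂) *
                (shiftedFactorial (α + x₁) m₂ * shiftedFactorial (α - x₁) m₂ *
                  shiftedFactorial (α + x₂) m₂ * shiftedFactorial (α - x₂) m₂) *
                (shiftedFactorial (m₂ + τ + α + x₁) (m₁ - m₂) *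
                  shiftedFactorial (m₂ + τ + α - x₁) (m₁ - m₂)) *
                hyp (m₁ - m₂)
                  [(τ : ℂ), m₂ + α + x₂, m₂ + α - x₂]
                  [1 - (m₁ : ℂ) + m₂ - τ, m₂ + τ + α + x₁, m₂ + τ + α - x₁] 1) ∧
      -- interpolation Jack polynomials
      ((∃! P : MvPolynomial (Fin 2) ℂ, IsInterpolationJack τ ![m₁, m₂] P) ∧
        ∀ P : MvPolynomial (Fin 2) ℂ, IsInterpolationJack τ ![m₁, m₂] P →
          ∀ x₁ x₂ : ℂ, (∀ j : ℕ, m₂ ≤ j → j < m₁ → x₂ ≠ (j : ℂ)) →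
            MvPolynomial.eval ![x₁, x₂] P =
              (-1) ^ (m₁ + m₂) * shiftedFactorial (-x₁) m₂ * shiftedFactorial (-x₂) m₁ *
                hyp (m₁ - m₂)
                  [(τ : ℂ), -(m₁ : ℂ) + 1 - τ + x₁]
                  [1 - (m₁ : ℂ) + m₂ - τ, -(m₁ : ℂ) + 1 + x₂] 1) ∧
      -- Jack polynomials
      ((∃! P : MvPolynomial (Fin 2) ℂ, IsJack τ ![m₁, m₂] P) ∧
        ∀ P : MvPolynomial (Fin 2) ℂ, IsJack τ ![m₁, m₂] P →
          (∀ x₁ x₂ : ℂ, x₁ ≠ 0 →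
            MvPolynomial.eval ![x₁, x₂] P =
              x₁ ^ m₁ * x₂ ^ m₂ *
                hyp (m₁ - m₂) [(τ : ℂ)] [1 - (m₁ : ℂ) + m₂ - τ] (x₂ / x₁)) ∧
          (∀ x₁ x₂ : ℂ,
            MvPolynomial.eval ![x₁, x₂] P =
              (Nat.factorial (m₁ - m₂) : ℂ) / shiftedFactorial τ (m₁ - m₂) *
                ∑ j ∈ Finset.range (m₁ - m₂ + 1),
                  shiftedFactorial τ j * shiftedFactorial τ (m₁ - m₂ - j) /
                    ((Nat.factorial j : ℂ) * (Nat.factorial (m₁ - m₂ - j) : ℂ)) *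
                    x₁ ^ (m₁ - j) * x₂ ^ (m₂ + j)) ∧
          -- `s` is any square root of `x₁ x₂`
          (∀ x₁ x₂ s : ℂ, s ≠ 0 → s ^ 2 = x₁ * x₂ →
            MvPolynomial.eval ![x₁, x₂] P =
              (Nat.factorial (m₁ - m₂) : ℂ) / shiftedFactorial τ (m₁ - m₂) *
                s ^ (m₁ + m₂) *
                (ultraspherical τ (m₁ - m₂)).eval ((x₁ + x₂) / (2 * s))))) := by
  refine ⟨fun q t h0 h1 ht0 ht1 => ⟨?_, ?_⟩, fun τ hτ => ⟨fun α hα => ⟨?_, ?_⟩, ?_, ?_⟩⟩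
  · have hiff := interpolationMacdonald h0 h1 ht0 ht1 hm
    refine ⟨existsUnique_of_iff hiff, fun P hP x₁ x₂ hx₁ hx₂ hx => ?_⟩
    rw [(hiff P).mp hP, eval_interpMv]
    exact interpSum_q_eq (by exact_mod_cast h0.ne') (by exact_mod_cast ht0.ne')
      (one_sub_pow_ne_zero h0 h1) (one_sub_mul_pow_ne_zero h0 h1 ht0 ht1) hm hx₁ hx₂ hx
  · have hiff := macdonald_iff h0 h1 ht0 ht1 hm
    refine ⟨existsUnique_of_iff hiff, fun P hP => ?_⟩
    rw [(hiff P).mp hP]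
    refine ⟨fun x₁ x₂ hx₁ => ?_, fun x₁ x₂ => eval_orthMv_div (fun _ => rfl) m₁ m₂ x₁ x₂,
      fun x₁ x₂ s hs h =>
        eval_orthMv_cos (fun _ => rfl) hm (qUltraspherical_eval_cos t q _) hs h⟩
    rw [eval_orthMv_of_ne_zero _ hm _ hx₁, qHyp_macdonald (by exact_mod_cast h0.ne')
      (by exact_mod_cast ht0.ne') (one_sub_pow_ne_zero h0 h1)
      (one_sub_mul_pow_ne_zero h0 h1 ht0 ht1) hm]
  · exact (eventually_isBCInterpolationMacdonald_iff hτ hα hm).mono fun q h =>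
      existsUnique_of_iff h
  · have hiff := isBCInterpolationJack_iff hτ hα hm
    refine ⟨existsUnique_of_iff hiff, fun F hF x₁ x₂ hx => ?_⟩
    rw [(hiff F).mp hF, eval_bcJackMv]
    exact interpSum_bcJack_eq hτ α hm hx
  · have hiff := interpolationJack hτ hm
    refine ⟨existsUnique_of_iff hiff, fun P hP x₁ x₂ hx => ?_⟩
    rw [(hiff P).mp hP, eval_interpMv]
    exact interpSum_jack_eq (ofReal_add_natCast_ne_zero hτ) hm hx
  · have hiff := jack_iff hτ hm
    refine ⟨existsUnique_of_iff hiff, fun P hP => ?_⟩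
    rw [(hiff P).mp hP]
    refine ⟨fun x₁ x₂ hx₁ => ?_, fun x₁ x₂ => eval_orthMv_div (fun _ => rfl) m₁ m₂ x₁ x₂,
      fun x₁ x₂ s hs h =>
        eval_orthMv_cos (fun _ => rfl) hm (ultraspherical_eval_cos τ _) hs h⟩
    rw [eval_orthMv_of_ne_zero _ hm _ hx₁, hyp_jack (ofReal_add_natCast_ne_zero hτ) hm]
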